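/- Let $\mathcal G$ be the semiring of isomorphism classes of finite simple graphs under disjoint union and strong product, preordered by $H\le G$ iff there is a graph homomorphism $\overline H\to\overline G$ between the complements. Let $\mathcal G_{\mathrm{nc}}$ be the semiring of unitary isomorphism classes of noncommutative graphs (subspaces $S=S^*\subseteq B(\mathcal H)$ with $I\in S$ and $\dim\mathcal H<\infty$) under direct sum and tensor product, preordered by $T\le S$ iff there are finitely many linear maps $E_i:\mathcal K\to\mathcal H$, where $T\subseteq B(\mathcal K)$ and $S\subseteq B(\mathcal H)$, with $\sum_iE_i^*E_i=I$ and $E_i^*SE_j\subseteq T$ for all $i,j$. A graph $G$ is identified with $\operatorname{span}\{|x\rangle\langle y| : x=y\text{ or }x\sim y\}\subseteq B(\mathbb C^{V(G)})$, and $\mathcal I_d$ denotes $\mathbb CI\subseteq B(\mathbb C^d)$. Let $\mathcal A\subseteq\mathcal G_{\mathrm{nc}}$ be the subsemiring generated by all graphs and all $\mathcal I_d$, with the restricted preorder. For a preordered semiring $R$, let $\Delta(R,\le)$ be the set of monotone semiring homomorphisms $R\to\mathbb R_{\ge0}$. For $f\in\Delta(\mathcal G,\le)$ and $\alpha\in[1,\infty)$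 let $f_\alpha:\mathcal A\to\mathbb R_{\ge0}$ be the semiring homomorphism $f_\alpha\bigl(\bigoplus_{d=1}^rG_d\otimes\mathcal I_d\bigr)=\sum_{d=1}^rf(G_d)d^\alpha$. The pair $(f,\alpha)$ is called admissible if $f_\alpha\in\Delta(\mathcal A,\le)$, i.e. if $f_\alpha$ is monotone. For $f\in\Delta(\mathcal G,\le)$, a nonempty graph $G$ and a probability distribution $Q$ on $V(G)$, let $f(G,Q)=\lim_{n\to\infty}f\bigl(G^{\boxtimes n}[T^n_{Q_n}]\bigr)^{1/n}$, where $Q_n\to Q$ is a sequence of distributions on $V(G)$ such that $nQ_n$ is integer valued, $T^n_{Q_n}\subseteq V(G)^n$ is the set of words in which each vertex $v$ occurs exactly $nQ_n(v)$ times, and $G^{\boxtimes n}[\,\cdot\,]$ denotes the induced subgraph of the strong power. For $S=\bigoplus_{d=1}^rG_d\otimes\mathcal I_d$ and a probability distribution $Q$ on $\bigsqcup_{d=1}^rV(G_d)$, let $$\log f_\alpha(S,Q)=H(\pi_*Q)+\sum_{d=1}^r\pi_*Q(d)\bigl[\log f(G_d,Q_d)+\alpha\log d\bigr],$$ where $\pi$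 sends the vertices of $G_d$ to $d$, $H$ is the Shannon entropy, $Q_d$ is the normalized restriction of $Q$ to $V(G_d)$, and terms with $\pi_*Q(d)=0$ are zero. **Theorem.** (1) For all $f\in\Delta(\mathcal G,\le)$, all nonempty $G$ and all $Q$, the limit $f(G,Q)$ exists, does not depend on the sequence $(Q_n)_n$, and is positive. (2) The set of functionals $(S,Q)\mapsto\log f_\alpha(S,Q)$ with $f\in\Delta(\mathcal G,\le)$, $\alpha\in[1,\infty)$ and $f_\alpha\in\Delta(\mathcal A,\le)$ is convex. (3) If $(f,\alpha)$ and $(g,\beta)$ are admissible with $f,g\in\Delta(\mathcal G,\le)$ and $\lambda\in[0,1]$, then there is an $h\in\Delta(\mathcal G,\le)$ with $\log h(G,Q)=\lambda\log f(G,Q)+(1-\lambda)\log g(G,Q)$ for every nonempty graph $G$ and every probability distribution $Q$ on $V(G)$, and the pair $(h,\lambda\alpha+(1-\lambda)\beta)$ is admissible. -/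

import Mathlib

open Matrix Filter Topology
open scoped NNReal Kronecker

namespace ZeroError

/-! ## The preordered semiring of graphs -/

/-- A finite simple undirected graph. -/
structure FinGraph : Type 1 where
  V : Type
  [fintypeV : Fintype V]
  [decEqV : DecidableEq V]
  graph : SimpleGraph V

attribute [instance] FinGraph.fintypeV FinGraph.decEqV

namespace FinGraph

/-- `g ≃ g'`: adjacent or equal. -/
def AdjEq (G : FinGraph) (x y : G.V) : Prop := x = y ∨ G.graph.Adj x y

theorem AdjEq.symm {G : FinGraph} {x y : G.V} (h : G.AdjEq x y) : G.AdjEq y x :=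
  h.elim (fun h => Or.inl h.symm) (fun h => Or.inr h.symm)

theorem AdjEq.refl {G : FinGraph} (x : G.V) : G.AdjEq x x := Or.inl rfl

/-- Isomorphism of graphs. -/
instance isoSetoid : Setoid FinGraph where
  r G H := Nonempty (G.graph ≃g H.graph)
  iseqv := ⟨fun _ => ⟨SimpleGraph.Iso.refl⟩, fun ⟨e⟩ => ⟨e.symm⟩, fun ⟨e⟩ ⟨f⟩ => ⟨f.comp e⟩⟩

/-- The empty graph. -/
abbrev empty : FinGraph := ⟨PEmpty, ⊥⟩

/-- The one-vertex graph. -/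
abbrev point : FinGraph := ⟨PUnit, ⊥⟩

/-- Disjoint union. -/
abbrev disjUnion (G H : FinGraph) : FinGraph := ⟨G.V ⊕ H.V, G.graph ⊕g H.graph⟩

/-- Strong product: `(g, h) ≃ (g', h')` iff `g ≃ g'` and `h ≃ h'`. -/
abbrev strongProd (G H : FinGraph) : FinGraph where
  V := G.V × H.V
  graph :=
    { Adj := fun x y => x ≠ y ∧ G.AdjEq x.1 y.1 ∧ H.AdjEq x.2 y.2
      symm := ⟨fun _ _ h => ⟨h.1.symm, h.2.1.symm, h.2.2.symm⟩⟩
      loopless := ⟨fun _ h => h.1 rfl⟩ }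

/-- `n`-fold strong power, on the words of length `n`. -/
def strongPow (G : FinGraph) (n : ℕ) : SimpleGraph (Fin n → G.V) where
  Adj x y := x ≠ y ∧ ∀ i, G.AdjEq (x i) (y i)
  symm := ⟨fun _ _ h => ⟨h.1.symm, fun i => (h.2 i).symm⟩⟩
  loopless := ⟨fun _ h => h.1 rfl⟩

/-- `H ≤ G`: there is a cohomomorphism, i.e. a homomorphism between the complements. -/
def CohomLE (H G : FinGraph) : Prop := Nonempty (H.graphᶜ →g G.graphᶜ)

theorem CohomLE.trans {G H K : FinGraph} (h₁ : CohomLE G H) (h₂ : CohomLE H K) : CohomLE G K :=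
  let ⟨f⟩ := h₁
  let ⟨g⟩ := h₂
  ⟨g.comp f⟩

theorem cohomLE_of_iso {G H : FinGraph} (h : G ≈ H) : CohomLE G H := by
  obtain ⟨e⟩ := h
  refine ⟨⟨e, ?_⟩⟩
  intro a b hab
  rw [SimpleGraph.compl_adj] at hab ⊢
  exact ⟨fun h => hab.1 (e.injective h), fun h => hab.2 (e.map_rel_iff.1 h)⟩

theorem iso_of_adjEq {G H : FinGraph} (e : G.V ≃ H.V)
    (h : ∀ x y, H.AdjEq (e x) (e y) ↔ G.AdjEq x y) : G ≈ H := by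
  refine ⟨⟨e, ?_⟩⟩
  intro a b
  have := h a b
  unfold AdjEq at this
  by_cases hab : a = b
  · subst hab; simp
  · simpa [hab] using this

theorem adjEq_iff_of_iso {G H : FinGraph} (e : G.graph ≃g H.graph) (x y : G.V) :
    H.AdjEq (e x) (e y) ↔ G.AdjEq x y := by
  unfold AdjEq
  rw [e.map_adj_iff, e.injective.eq_iff]

theorem strongProd_adjEq {G H : FinGraph} (x y : G.V × H.V) :
    (G.strongProd H).AdjEq x y ↔ G.AdjEq x.1 y.1 ∧ H.AdjEq x.2 y.2 := by
  constructor
  · rintro (h | h)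
    · subst h; exact ⟨AdjEq.refl _, AdjEq.refl _⟩
    · exact h.2
  · intro h
    by_cases hxy : x = y
    · exact Or.inl hxy
    · exact Or.inr ⟨hxy, h⟩

theorem disjUnion_adjEq {G H : FinGraph} (x y : G.V ⊕ H.V) :
    (G.disjUnion H).AdjEq x y ↔ Sum.LiftRel G.AdjEq H.AdjEq x y := by
  rcases x with x | x <;> rcases y with y | y <;>
    simp [AdjEq, disjUnion]

theorem disjUnion_congr {G G' H H' : FinGraph} (hG : G ≈ G') (hH : H ≈ H') :
    G.disjUnion H ≈ G'.disjUnion H' :=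
  let ⟨e⟩ := hG
  let ⟨f⟩ := hH
  ⟨e.sumCongr f⟩

theorem strongProd_congr {G G' H H' : FinGraph} (hG : G ≈ G') (hH : H ≈ H') :
    G.strongProd H ≈ G'.strongProd H' := by
  obtain ⟨e⟩ := hG
  obtain ⟨f⟩ := hH
  refine iso_of_adjEq (e.toEquiv.prodCongr f.toEquiv) fun x y => ?_
  rw [strongProd_adjEq, strongProd_adjEq]
  exact and_congr (adjEq_iff_of_iso e _ _) (adjEq_iff_of_iso f _ _)

end FinGraph

open FinGraph

/-- The set `𝒢` of isomorphism classes of finite graphs. -/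
def GraphClass : Type 1 := Quotient FinGraph.isoSetoid

/-- The isomorphism class of a graph. -/
def FinGraph.toClass (G : FinGraph) : GraphClass := Quotient.mk _ G

namespace GraphClass

instance : Zero GraphClass := ⟨FinGraph.empty.toClass⟩
instance : One GraphClass := ⟨FinGraph.point.toClass⟩
instance : Add GraphClass :=
  ⟨Quotient.map₂ FinGraph.disjUnion fun _ _ h _ _ h' => disjUnion_congr h h'⟩
instance : Mul GraphClass :=
  ⟨Quotient.map₂ FinGraph.strongProd fun _ _ h _ _ h' => strongProd_congr h h'⟩

protected theorem add_comm (a b : GraphClass) : a + b = b + a :=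
  Quotient.inductionOn₂ a b fun _ _ => Quotient.sound ⟨SimpleGraph.Iso.sumComm⟩

protected theorem mul_comm (a b : GraphClass) : a * b = b * a :=
  Quotient.inductionOn₂ a b fun _ _ => Quotient.sound <|
    iso_of_adjEq (Equiv.prodComm _ _) fun x y => by
      rw [strongProd_adjEq, strongProd_adjEq]; exact and_comm

protected theorem zero_add (a : GraphClass) : 0 + a = a :=
  Quotient.inductionOn a fun _ => Quotient.sound <|
    iso_of_adjEq (Equiv.emptySum PEmpty _) fun x y => by
      rw [disjUnion_adjEq]
      rcases x with x | x <;> rcases y with y | y <;> first | exact x.elim | exact y.elim | simp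

protected theorem one_mul (a : GraphClass) : 1 * a = a :=
  Quotient.inductionOn a fun _ => Quotient.sound <|
    iso_of_adjEq (Equiv.punitProd _) fun x y => by
      rw [strongProd_adjEq]
      exact ⟨fun h => ⟨Or.inl rfl, h⟩, fun h => h.2⟩

protected theorem zero_mul (a : GraphClass) : 0 * a = 0 :=
  Quotient.inductionOn a fun _ => Quotient.sound <|
    iso_of_adjEq (Equiv.pemptyProd _) fun x _ => x.1.elim

protected theorem add_mul (a b c : GraphClass) : (a + b) * c = a * c + b * c :=
  Quotient.inductionOn₃ a b c fun _ _ _ => Quotient.sound <|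
    iso_of_adjEq (Equiv.sumProdDistrib _ _ _) fun x y => by
      rw [strongProd_adjEq, disjUnion_adjEq, disjUnion_adjEq]
      rcases x with ⟨x | x, z⟩ <;> rcases y with ⟨y | y, w⟩ <;> simp [strongProd_adjEq]

instance : CommSemiring GraphClass where
  add_assoc a b c := Quotient.inductionOn₃ a b c fun _ _ _ =>
    Quotient.sound ⟨SimpleGraph.Iso.sumAssoc⟩
  zero_add := GraphClass.zero_add
  add_zero a := (GraphClass.add_comm a 0).trans (GraphClass.zero_add a)
  add_comm := GraphClass.add_comm
  nsmul := nsmulRec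
  mul_assoc a b c := Quotient.inductionOn₃ a b c fun _ _ _ => Quotient.sound <|
    iso_of_adjEq (Equiv.prodAssoc _ _ _) fun x y => by
      simp only [strongProd_adjEq]
      exact and_assoc.symm
  one_mul := GraphClass.one_mul
  mul_one a := (GraphClass.mul_comm a 1).trans (GraphClass.one_mul a)
  mul_comm := GraphClass.mul_comm
  zero_mul := GraphClass.zero_mul
  mul_zero a := (GraphClass.mul_comm a 0).trans (GraphClass.zero_mul a)
  right_distrib := GraphClass.add_mul
  left_distrib a b c := by
    rw [GraphClass.mul_comm, GraphClass.add_mul, GraphClass.mul_comm b, GraphClass.mul_comm c]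

/-- The cohomomorphism preorder on `𝒢`. -/
instance : Preorder GraphClass where
  le := Quotient.lift₂ FinGraph.CohomLE fun _ _ _ _ h h' => propext
    ⟨fun k => ((cohomLE_of_iso (Setoid.symm h)).trans k).trans (cohomLE_of_iso h'),
      fun k => ((cohomLE_of_iso h).trans k).trans (cohomLE_of_iso (Setoid.symm h'))⟩
  le_refl a := Quotient.inductionOn a fun _ => cohomLE_of_iso (Setoid.refl _)
  le_trans a b c := Quotient.inductionOn₃ a b c fun _ _ _ h₁ h₂ => CohomLE.trans h₁ h₂

end GraphClass

/-! ## The preordered semiring of noncommutative graphs -/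

/-- A noncommutative graph: a self-adjoint subspace of `B(ℂ^ι)` containing the identity. The
Hilbert space `ℂ^ι` comes with its standard orthonormal basis and the operators are written as
matrices; up to unitary isomorphism this covers all finite dimensional Hilbert spaces. -/
structure NCGraph : Type 1 where
  ι : Type
  [fintypeι : Fintype ι]
  [decEqι : DecidableEq ι]
  space : Submodule ℂ (Matrix ι ι ℂ)
  one_mem : (1 : Matrix ι ι ℂ) ∈ space
  star_mem : ∀ A ∈ space, Aᴴ ∈ space

attribute [instance] NCGraph.fintypeι NCGraph.decEqι

namespace NCGraph

/-- `U S U* = T` for a unitary `U`. -/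
def Iso (S T : NCGraph) : Prop :=
  ∃ U : Matrix T.ι S.ι ℂ, Uᴴ * U = 1 ∧ U * Uᴴ = 1 ∧
    (fun A => U * A * Uᴴ) '' (S.space : Set (Matrix S.ι S.ι ℂ)) = T.space

/-- `T ≤ S`: there is a cohomomorphism from `T` to `S`, i.e. a finite family of operators `E i`
with `∑ i, (E i)* (E i) = I` and `(E i)* S (E j) ⊆ T`. -/
def CohomLE (T S : NCGraph) : Prop :=
  ∃ (m : ℕ) (E : Fin m → Matrix S.ι T.ι ℂ), ∑ i, (E i)ᴴ * E i = 1 ∧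
    ∀ i j, ∀ A ∈ S.space, (E i)ᴴ * A * E j ∈ T.space

/-- The noncommutative graph on the zero space. -/
abbrev zero : NCGraph := ⟨PEmpty, ⊤, trivial, fun _ _ => trivial⟩

/-- The identity channel `ℂ I ⊆ B(ℂ^ι)`. -/
abbrev scalars (ι : Type) [Fintype ι] [DecidableEq ι] : NCGraph where
  ι := ι
  space := Submodule.span ℂ {1}
  one_mem := Submodule.subset_span rfl
  star_mem A hA := by
    obtain ⟨c, rfl⟩ := Submodule.mem_span_singleton.1 hA
    rw [conjTranspose_smul, conjTranspose_one]
    exact Submodule.smul_mem _ _ (Submodule.subset_span rfl)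

/-- The confusability graph `ℂ I ⊆ B(ℂ^d)` of the noiseless `d`-dimensional quantum channel. -/
abbrev idealQuantum (d : ℕ) : NCGraph := scalars (Fin d)

/-- The noncommutative graph of a graph, spanned by `|x⟩⟨y|` with `x ≃ y`. -/
abbrev ofGraph (G : FinGraph) : NCGraph where
  ι := G.V
  space := Submodule.span ℂ {M | ∃ x y, G.AdjEq x y ∧ M = Matrix.single x y 1}
  one_mem := by
    rw [Matrix.matrix_eq_sum_single (1 : Matrix G.V G.V ℂ)]
    refine Submodule.sum_mem _ fun i _ => Submodule.sum_mem _ fun j _ => ?_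
    by_cases h : i = j
    · subst h
      rw [Matrix.one_apply_eq]
      exact Submodule.subset_span ⟨i, i, AdjEq.refl _, rfl⟩
    · rw [Matrix.one_apply_ne h, Matrix.single_zero]
      exact Submodule.zero_mem _
  star_mem A hA := by
    induction hA using Submodule.span_induction with
    | mem x h =>
      obtain ⟨x, y, h, rfl⟩ := h
      refine Submodule.subset_span ⟨y, x, h.symm, ?_⟩
      rw [Matrix.conjTranspose_single, star_one]
    | zero => rw [conjTranspose_zero]; exact Submodule.zero_mem _
    | add x y _ _ hx hy => rw [conjTranspose_add]; exact Submodule.add_mem _ hx hy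
    | smul a x _ hx => rw [conjTranspose_smul]; exact Submodule.smul_mem _ _ hx

/-- Direct sum `S ⊕ T = {A ⊕ B | A ∈ S, B ∈ T}`. -/
abbrev directSum (S T : NCGraph) : NCGraph where
  ι := S.ι ⊕ T.ι
  space :=
    { carrier := {M | ∃ A ∈ S.space, ∃ B ∈ T.space, M = fromBlocks A 0 0 B}
      zero_mem' := ⟨0, S.space.zero_mem, 0, T.space.zero_mem, fromBlocks_zero.symm⟩
      add_mem' := by
        rintro _ _ ⟨A, hA, B, hB, rfl⟩ ⟨A', hA', B', hB', rfl⟩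
        exact ⟨_, S.space.add_mem hA hA', _, T.space.add_mem hB hB', by simp [fromBlocks_add]⟩
      smul_mem' := by
        rintro c _ ⟨A, hA, B, hB, rfl⟩
        exact ⟨_, S.space.smul_mem c hA, _, T.space.smul_mem c hB, by simp [fromBlocks_smul]⟩ }
  one_mem := ⟨1, S.one_mem, 1, T.one_mem, fromBlocks_one.symm⟩
  star_mem := by
    rintro _ ⟨A, hA, B, hB, rfl⟩
    exact ⟨_, S.star_mem _ hA, _, T.star_mem _ hB, by simp [fromBlocks_conjTranspose]⟩

/-- Tensor product `S ⊗ T = span {A ⊗ B | A ∈ S, B ∈ T}`. -/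
abbrev tensor (S T : NCGraph) : NCGraph where
  ι := S.ι × T.ι
  space := Submodule.span ℂ {M | ∃ A ∈ S.space, ∃ B ∈ T.space, M = A ⊗ₖ B}
  one_mem := Submodule.subset_span ⟨1, S.one_mem, 1, T.one_mem, one_kronecker_one.symm⟩
  star_mem M hM := by
    induction hM using Submodule.span_induction with
    | mem x h =>
      obtain ⟨A, hA, B, hB, rfl⟩ := h
      exact Submodule.subset_span ⟨_, S.star_mem _ hA, _, T.star_mem _ hB, conjTranspose_kronecker _ _⟩
    | zero => rw [conjTranspose_zero]; exact Submodule.zero_mem _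
    | add x y _ _ hx hy => rw [conjTranspose_add]; exact Submodule.add_mem _ hx hy
    | smul a x _ hx => rw [conjTranspose_smul]; exact Submodule.smul_mem _ _ hx

theorem Iso.of_mem {S T : NCGraph} (U : Matrix T.ι S.ι ℂ) (h₁ : Uᴴ * U = 1) (h₂ : U * Uᴴ = 1)
    (hS : ∀ A ∈ S.space, U * A * Uᴴ ∈ T.space) (hT : ∀ B ∈ T.space, Uᴴ * B * U ∈ S.space) :
    S.Iso T := by
  refine ⟨U, h₁, h₂, Set.Subset.antisymm ?_ ?_⟩
  · rintro _ ⟨A, hA, rfl⟩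
    exact hS A hA
  · intro B hB
    refine ⟨_, hT B hB, ?_⟩
    calc U * (Uᴴ * B * U) * Uᴴ = (U * Uᴴ) * B * (U * Uᴴ) := by simp only [Matrix.mul_assoc]
      _ = B := by rw [h₂, Matrix.one_mul, Matrix.mul_one]

theorem Iso.exists_mem {S T : NCGraph} (h : S.Iso T) : ∃ U : Matrix T.ι S.ι ℂ,
    Uᴴ * U = 1 ∧ U * Uᴴ = 1 ∧ (∀ A ∈ S.space, U * A * Uᴴ ∈ T.space) ∧
      ∀ B ∈ T.space, Uᴴ * B * U ∈ S.space := by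
  obtain ⟨U, h₁, h₂, h⟩ := h
  refine ⟨U, h₁, h₂, fun A hA => ?_, fun B hB => ?_⟩
  · have : U * A * Uᴴ ∈ (T.space : Set _) := h ▸ ⟨A, hA, rfl⟩
    exact this
  · have hB' : B ∈ (T.space : Set _) := hB
    rw [← h] at hB'
    obtain ⟨A, hA, rfl⟩ := hB'
    have : Uᴴ * (U * A * Uᴴ) * U = A := by
      calc Uᴴ * (U * A * Uᴴ) * U = (Uᴴ * U) * A * (Uᴴ * U) := by simp only [Matrix.mul_assoc]
        _ = A := by rw [h₁, Matrix.one_mul, Matrix.mul_one]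
    rwa [← this] at hA

theorem Iso.refl (S : NCGraph) : S.Iso S :=
  Iso.of_mem 1 (by simp) (by simp) (by simp) (by simp)

theorem Iso.symm {S T : NCGraph} (h : S.Iso T) : T.Iso S := by
  obtain ⟨U, h₁, h₂, hS, hT⟩ := h.exists_mem
  exact Iso.of_mem Uᴴ (by simpa using h₂) (by simpa using h₁) (by simpa using hT)
    (by simpa using hS)

theorem Iso.trans {S T R : NCGraph} (h : S.Iso T) (h' : T.Iso R) : S.Iso R := by
  obtain ⟨U, h₁, h₂, hS, hT⟩ := h.exists_mem
  obtain ⟨W, k₁, k₂, kS, kT⟩ := h'.exists_mem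
  refine Iso.of_mem (W * U) ?_ ?_ (fun A hA => ?_) (fun B hB => ?_)
  · rw [conjTranspose_mul, Matrix.mul_assoc, ← Matrix.mul_assoc Wᴴ, k₁, Matrix.one_mul, h₁]
  · rw [conjTranspose_mul, Matrix.mul_assoc, ← Matrix.mul_assoc U, h₂, Matrix.one_mul, k₂]
  · have := kS _ (hS A hA)
    simpa only [conjTranspose_mul, Matrix.mul_assoc] using this
  · have := hT _ (kT B hB)
    simpa only [conjTranspose_mul, Matrix.mul_assoc] using this

/-- Unitary isomorphism of noncommutative graphs. -/
instance isoSetoid : Setoid NCGraph where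
  r := Iso
  iseqv := ⟨Iso.refl, Iso.symm, Iso.trans⟩

/-- A bijection of the standard bases that matches the spaces is an isomorphism. -/
theorem iso_of_equiv {S T : NCGraph} (e : S.ι ≃ T.ι)
    (hS : ∀ A ∈ S.space, A.submatrix e.symm e.symm ∈ T.space)
    (hT : ∀ B ∈ T.space, B.submatrix e e ∈ S.space) : S ≈ T := by
  have hU : ((1 : Matrix S.ι S.ι ℂ).submatrix e.symm id)ᴴ
      = (1 : Matrix S.ι S.ι ℂ).submatrix id e.symm := by
    rw [conjTranspose_submatrix, conjTranspose_one]
  have key (A : Matrix S.ι S.ι ℂ) : (1 : Matrix S.ι S.ι ℂ).submatrix e.symm id * A *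
      (1 : Matrix S.ι S.ι ℂ).submatrix id e.symm = A.submatrix e.symm e.symm := by
    ext i j
    simp [Matrix.mul_apply, Matrix.one_apply]
  have key' (B : Matrix T.ι T.ι ℂ) : (1 : Matrix S.ι S.ι ℂ).submatrix id e.symm * B *
      (1 : Matrix S.ι S.ι ℂ).submatrix e.symm id = B.submatrix e e := by
    ext i j
    simp [Matrix.mul_apply, Matrix.one_apply, Equiv.eq_symm_apply, Equiv.symm_apply_eq]
  refine Iso.of_mem ((1 : Matrix S.ι S.ι ℂ).submatrix e.symm id) ?_ ?_ ?_ ?_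
  · have := key' 1
    rw [Matrix.mul_one] at this
    rw [hU, this, submatrix_one_equiv]
  · have := key 1
    rw [Matrix.mul_one] at this
    rw [hU, this, submatrix_one_equiv]
  · intro A hA
    rw [hU, key]
    exact hS A hA
  · intro B hB
    rw [hU, key']
    exact hT B hB

theorem cohomLE_of_iso {S T : NCGraph} (h : S ≈ T) : CohomLE S T := by
  obtain ⟨U, h₁, -, -, hT⟩ := Iso.exists_mem h
  exact ⟨1, fun _ => U, by simpa using h₁, fun _ _ => hT⟩

theorem CohomLE.trans {R S T : NCGraph} (h : CohomLE R S) (h' : CohomLE S T) : CohomLE R T := by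
  obtain ⟨m, E, hE, hE'⟩ := h
  obtain ⟨n, F, hF, hF'⟩ := h'
  refine ⟨m * n, fun k => F (finProdFinEquiv.symm k).2 * E (finProdFinEquiv.symm k).1, ?_, ?_⟩
  · rw [Equiv.sum_comp finProdFinEquiv.symm (fun p : Fin m × Fin n => (F p.2 * E p.1)ᴴ *
      (F p.2 * E p.1)), Fintype.sum_prod_type, ← hE]
    refine Finset.sum_congr rfl fun i _ => ?_
    calc ∑ j, (F j * E i)ᴴ * (F j * E i) = ∑ j, (E i)ᴴ * ((F j)ᴴ * F j) * E i := by
          simp only [conjTranspose_mul, Matrix.mul_assoc]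
      _ = (E i)ᴴ * (∑ j, (F j)ᴴ * F j) * E i := by
          rw [Matrix.mul_sum, Matrix.sum_mul]
      _ = (E i)ᴴ * E i := by rw [hF, Matrix.mul_one]
  · intro i j A hA
    have := hE' (finProdFinEquiv.symm i).1 (finProdFinEquiv.symm j).1 _
      (hF' (finProdFinEquiv.symm i).2 (finProdFinEquiv.symm j).2 A hA)
    simpa only [conjTranspose_mul, Matrix.mul_assoc] using this

/-- Induction on the elements of a tensor product, for linear conditions. -/
theorem tensor_mem {S T : NCGraph} {κ : Type} {P : Submodule ℂ (Matrix κ κ ℂ)}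
    (L : Matrix (S.ι × T.ι) (S.ι × T.ι) ℂ →ₗ[ℂ] Matrix κ κ ℂ)
    (h : ∀ A ∈ S.space, ∀ B ∈ T.space, L (A ⊗ₖ B) ∈ P) :
    ∀ M ∈ (S.tensor T).space, L M ∈ P := by
  have : (S.tensor T).space ≤ P.comap L := by
    refine Submodule.span_le.2 ?_
    rintro _ ⟨A, hA, B, hB, rfl⟩
    exact h A hA B hB
  exact this

/-- `M ↦ U M W` as a linear map. -/
def sandwich {κ ι : Type} [Fintype ι] (U : Matrix κ ι ℂ) (W : Matrix ι κ ℂ) :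
    Matrix ι ι ℂ →ₗ[ℂ] Matrix κ κ ℂ where
  toFun M := U * M * W
  map_add' := by simp [Matrix.mul_add, Matrix.add_mul]
  map_smul' := by simp

/-- `M ↦ M.submatrix e e` as a linear map. -/
def submatrixL {κ ι : Type} (e : κ → ι) : Matrix ι ι ℂ →ₗ[ℂ] Matrix κ κ ℂ where
  toFun M := M.submatrix e e
  map_add' _ _ := rfl
  map_smul' _ _ := rfl

/-- `M ↦ M ⊗ B` as a linear map. -/
def kronL {κ ι : Type} (B : Matrix κ κ ℂ) : Matrix ι ι ℂ →ₗ[ℂ] Matrix (ι × κ) (ι × κ) ℂ where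
  toFun M := M ⊗ₖ B
  map_add' _ _ := add_kronecker _ _ _
  map_smul' _ _ := smul_kronecker _ _ _

/-- `M ↦ A ⊗ M` as a linear map. -/
def kronR {κ ι : Type} (A : Matrix ι ι ℂ) : Matrix κ κ ℂ →ₗ[ℂ] Matrix (ι × κ) (ι × κ) ℂ where
  toFun M := A ⊗ₖ M
  map_add' _ _ := kronecker_add _ _ _
  map_smul' _ _ := kronecker_smul _ _ _

theorem kron_mem {S T : NCGraph} {A : Matrix S.ι S.ι ℂ} {B : Matrix T.ι T.ι ℂ}
    (hA : A ∈ S.space) (hB : B ∈ T.space) : A ⊗ₖ B ∈ (S.tensor T).space :=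
  Submodule.subset_span ⟨A, hA, B, hB, rfl⟩

theorem directSum_congr {S S' T T' : NCGraph} (hS : S ≈ S') (hT : T ≈ T') :
    S.directSum T ≈ S'.directSum T' := by
  obtain ⟨U, h₁, h₂, h₃, h₄⟩ := Iso.exists_mem hS
  obtain ⟨W, k₁, k₂, k₃, k₄⟩ := Iso.exists_mem hT
  refine Iso.of_mem (S := S.directSum T) (T := S'.directSum T') (fromBlocks U 0 0 W) ?_ ?_ ?_ ?_
  · rw [fromBlocks_conjTranspose]
    refine (fromBlocks_multiply _ _ _ _ _ _ _ _).trans ?_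
    simp [h₁, k₁]
  · rw [fromBlocks_conjTranspose]
    refine (fromBlocks_multiply _ _ _ _ _ _ _ _).trans ?_
    simp [h₂, k₂]
  · rintro _ ⟨A, hA, B, hB, rfl⟩
    refine ⟨_, h₃ A hA, _, k₃ B hB, ?_⟩
    rw [fromBlocks_conjTranspose]
    refine (congrArg (· * _) (fromBlocks_multiply _ _ _ _ _ _ _ _)).trans ?_
    refine (fromBlocks_multiply _ _ _ _ _ _ _ _).trans ?_
    simp
  · rintro _ ⟨A, hA, B, hB, rfl⟩
    refine ⟨_, h₄ A hA, _, k₄ B hB, ?_⟩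
    rw [fromBlocks_conjTranspose]
    refine (congrArg (· * _) (fromBlocks_multiply _ _ _ _ _ _ _ _)).trans ?_
    refine (fromBlocks_multiply _ _ _ _ _ _ _ _).trans ?_
    simp

theorem tensor_congr {S S' T T' : NCGraph} (hS : S ≈ S') (hT : T ≈ T') :
    S.tensor T ≈ S'.tensor T' := by
  obtain ⟨U, h₁, h₂, h₃, h₄⟩ := Iso.exists_mem hS
  obtain ⟨W, k₁, k₂, k₃, k₄⟩ := Iso.exists_mem hT
  refine Iso.of_mem (S := S.tensor T) (T := S'.tensor T') (U ⊗ₖ W) ?_ ?_ ?_ ?_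
  · rw [conjTranspose_kronecker]
    refine (mul_kronecker_mul _ _ _ _).symm.trans ?_
    rw [h₁, k₁]
    exact one_kronecker_one
  · rw [conjTranspose_kronecker]
    refine (mul_kronecker_mul _ _ _ _).symm.trans ?_
    rw [h₂, k₂]
    exact one_kronecker_one
  · refine tensor_mem (sandwich (U ⊗ₖ W) (U ⊗ₖ W)ᴴ) fun A hA B hB => ?_
    have : sandwich (U ⊗ₖ W) (U ⊗ₖ W)ᴴ (A ⊗ₖ B) = (U * A * Uᴴ) ⊗ₖ (W * B * Wᴴ) := by
      simp only [sandwich, LinearMap.coe_mk, AddHom.coe_mk, conjTranspose_kronecker,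
        mul_kronecker_mul]
    rw [this]
    exact kron_mem (h₃ A hA) (k₃ B hB)
  · refine tensor_mem (sandwich (U ⊗ₖ W)ᴴ (U ⊗ₖ W)) fun A hA B hB => ?_
    have : sandwich (U ⊗ₖ W)ᴴ (U ⊗ₖ W) (A ⊗ₖ B) = (Uᴴ * A * U) ⊗ₖ (Wᴴ * B * W) := by
      simp only [sandwich, LinearMap.coe_mk, AddHom.coe_mk, conjTranspose_kronecker,
        mul_kronecker_mul]
    rw [this]
    exact kron_mem (h₄ A hA) (k₄ B hB)

theorem ofGraph_congr {G H : FinGraph} (h : G ≈ H) : ofGraph G ≈ ofGraph H := by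
  have aux {G H : FinGraph} (e : G.graph ≃g H.graph) : ∀ A ∈ (ofGraph G).space,
      A.submatrix e.toEquiv.symm e.toEquiv.symm ∈ (ofGraph H).space := by
    have : (ofGraph G).space ≤ (ofGraph H).space.comap (submatrixL e.toEquiv.symm) := by
      refine Submodule.span_le.2 ?_
      rintro _ ⟨x, y, hxy, rfl⟩
      refine Submodule.subset_span ⟨e x, e y, (adjEq_iff_of_iso e x y).2 hxy, ?_⟩
      exact Matrix.submatrix_single_equiv e.toEquiv.symm e.toEquiv.symm x y 1
    exact this
  obtain ⟨e⟩ := h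
  exact iso_of_equiv (S := ofGraph G) (T := ofGraph H) e.toEquiv (aux e) (aux e.symm)

end NCGraph

open NCGraph

/-- The set `𝒢_nc` of isomorphism classes of noncommutative graphs. -/
def NCClass : Type 1 := Quotient NCGraph.isoSetoid

/-- The isomorphism class of a noncommutative graph. -/
def NCGraph.toClass (S : NCGraph) : NCClass := Quotient.mk _ S

namespace NCClass

instance : Zero NCClass := ⟨NCGraph.zero.toClass⟩
instance : One NCClass := ⟨(NCGraph.scalars PUnit).toClass⟩
instance : Add NCClass :=
  ⟨Quotient.map₂ NCGraph.directSum fun _ _ h _ _ h' => directSum_congr h h'⟩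
instance : Mul NCClass :=
  ⟨Quotient.map₂ NCGraph.tensor fun _ _ h _ _ h' => tensor_congr h h'⟩

protected theorem add_comm (a b : NCClass) : a + b = b + a :=
  Quotient.inductionOn₂ a b fun S T => Quotient.sound <| by
    refine iso_of_equiv (S := S.directSum T) (T := T.directSum S) (Equiv.sumComm _ _) ?_ ?_
    all_goals
      rintro _ ⟨A, hA, B, hB, rfl⟩
      exact ⟨B, hB, A, hA, by ext (i | i) (j | j) <;> rfl⟩

protected theorem add_assoc (a b c : NCClass) : a + b + c = a + (b + c) :=
  Quotient.inductionOn₃ a b c fun S T R => Quotient.sound <| by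
    refine iso_of_equiv (S := (S.directSum T).directSum R) (T := S.directSum (T.directSum R))
      (Equiv.sumAssoc _ _ _) ?_ ?_
    · rintro _ ⟨_, ⟨A, hA, B, hB, rfl⟩, C, hC, rfl⟩
      exact ⟨A, hA, _, ⟨B, hB, C, hC, rfl⟩, by ext (i | i | i) (j | j | j) <;> rfl⟩
    · rintro _ ⟨A, hA, _, ⟨B, hB, C, hC, rfl⟩, rfl⟩
      exact ⟨_, ⟨A, hA, B, hB, rfl⟩, C, hC, by ext ((i | i) | i) ((j | j) | j) <;> rfl⟩

protected theorem zero_add (a : NCClass) : 0 + a = a :=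
  Quotient.inductionOn a fun S => Quotient.sound <| by
    refine iso_of_equiv (S := NCGraph.zero.directSum S) (T := S) (Equiv.emptySum PEmpty _) ?_ ?_
    · rintro _ ⟨A, hA, B, hB, rfl⟩
      exact hB
    · intro B hB
      exact ⟨0, trivial, B, hB, by
        ext (i | i) (j | j) <;> first | exact i.elim | exact j.elim | rfl⟩

protected theorem mul_comm (a b : NCClass) : a * b = b * a :=
  Quotient.inductionOn₂ a b fun S T => Quotient.sound <| by
    have aux (S T : NCGraph) : ∀ M ∈ (S.tensor T).space,
        M.submatrix (Equiv.prodComm T.ι S.ι) (Equiv.prodComm T.ι S.ι) ∈ (T.tensor S).space := by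
      refine tensor_mem (submatrixL (Equiv.prodComm T.ι S.ι)) fun A hA B hB => ?_
      have : submatrixL (Equiv.prodComm T.ι S.ι) (A ⊗ₖ B) = B ⊗ₖ A := by
        ext i j
        exact mul_comm _ _
      rw [this]
      exact kron_mem hB hA
    exact iso_of_equiv (S := S.tensor T) (T := T.tensor S) (Equiv.prodComm _ _)
      (aux S T) (aux T S)

protected theorem mul_assoc (a b c : NCClass) : a * b * c = a * (b * c) :=
  Quotient.inductionOn₃ a b c fun S T R => Quotient.sound <| by
    refine iso_of_equiv (S := (S.tensor T).tensor R) (T := S.tensor (T.tensor R))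
      (Equiv.prodAssoc _ _ _) ?_ ?_
    · refine tensor_mem (S := S.tensor T) (T := R)
        (submatrixL (Equiv.prodAssoc S.ι T.ι R.ι).symm) fun M hM C hC => ?_
      refine tensor_mem (S := S) (T := T)
        ((submatrixL (Equiv.prodAssoc S.ι T.ι R.ι).symm).comp (kronL C))
        (fun A hA B hB => ?_) M hM
      have : (submatrixL (Equiv.prodAssoc S.ι T.ι R.ι).symm) (kronL C (A ⊗ₖ B))
          = A ⊗ₖ (B ⊗ₖ C) := by
        ext i j
        exact mul_assoc _ _ _
      rw [LinearMap.comp_apply, this]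
      exact kron_mem (S := S) (T := T.tensor R) hA (kron_mem hB hC)
    · refine tensor_mem (S := S) (T := T.tensor R)
        (submatrixL (Equiv.prodAssoc S.ι T.ι R.ι)) fun A hA M hM => ?_
      refine tensor_mem (S := T) (T := R)
        ((submatrixL (Equiv.prodAssoc S.ι T.ι R.ι)).comp (kronR A))
        (fun B hB C hC => ?_) M hM
      have : (submatrixL (Equiv.prodAssoc S.ι T.ι R.ι)) (kronR A (B ⊗ₖ C))
          = (A ⊗ₖ B) ⊗ₖ C := by
        ext i j
        exact (mul_assoc _ _ _).symm
      rw [LinearMap.comp_apply, this]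
      exact kron_mem (S := S.tensor T) (T := R) (kron_mem hA hB) hC

protected theorem one_mul (a : NCClass) : 1 * a = a :=
  Quotient.inductionOn a fun S => Quotient.sound <| by
    refine iso_of_equiv (S := (NCGraph.scalars PUnit).tensor S) (T := S) (Equiv.punitProd _) ?_ ?_
    · refine tensor_mem (S := NCGraph.scalars PUnit) (T := S)
        (submatrixL (Equiv.punitProd S.ι).symm) fun A hA B hB => ?_
      have : submatrixL (Equiv.punitProd S.ι).symm (A ⊗ₖ B) = A PUnit.unit PUnit.unit • B := by
        ext i j
        rfl
      rw [this]
      exact S.space.smul_mem _ hB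
    · intro B hB
      have : B.submatrix (Equiv.punitProd S.ι) (Equiv.punitProd S.ι)
          = (1 : Matrix PUnit PUnit ℂ) ⊗ₖ B := by
        ext i j
        simp
      rw [this]
      exact kron_mem (S := NCGraph.scalars PUnit) (NCGraph.scalars PUnit).one_mem hB

protected theorem zero_mul (a : NCClass) : 0 * a = 0 :=
  Quotient.inductionOn a fun S => Quotient.sound <| by
    refine iso_of_equiv (S := NCGraph.zero.tensor S) (T := NCGraph.zero)
      (Equiv.pemptyProd _) (fun _ _ => trivial) fun B _ => ?_
    have : B.submatrix (Equiv.pemptyProd S.ι) (Equiv.pemptyProd S.ι) = 0 := by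
      ext i j
      exact i.1.elim
    rw [this]
    exact Submodule.zero_mem _

protected theorem add_mul (a b c : NCClass) : (a + b) * c = a * c + b * c :=
  Quotient.inductionOn₃ a b c fun S T R => Quotient.sound <| by
    refine iso_of_equiv (S := (S.directSum T).tensor R)
      (T := (S.tensor R).directSum (T.tensor R)) (Equiv.sumProdDistrib _ _ _) ?_ ?_
    · refine tensor_mem (S := S.directSum T) (T := R)
        (submatrixL (Equiv.sumProdDistrib S.ι T.ι R.ι).symm) ?_
      rintro _ ⟨A, hA, B, hB, rfl⟩ C hC
      refine ⟨_, kron_mem hA hC, _, kron_mem hB hC, ?_⟩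
      change ((fromBlocks A 0 0 B) ⊗ₖ C).submatrix (Equiv.sumProdDistrib S.ι T.ι R.ι).symm
        (Equiv.sumProdDistrib S.ι T.ι R.ι).symm = _
      ext (i | i) (j | j) <;> simp
    · rintro _ ⟨M, hM, N, hN, rfl⟩
      have h₁ : (fromBlocks M 0 0 (0 : Matrix (T.ι × R.ι) (T.ι × R.ι) ℂ)).submatrix
          (Equiv.sumProdDistrib S.ι T.ι R.ι) (Equiv.sumProdDistrib S.ι T.ι R.ι)
          ∈ ((S.directSum T).tensor R).space := by
        refine tensor_mem (S := S) (T := R)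
          ((submatrixL (Equiv.sumProdDistrib S.ι T.ι R.ι)).comp
            ({ toFun := fun M => fromBlocks M 0 0 0
               map_add' := by simp [fromBlocks_add]
               map_smul' := by simp [fromBlocks_smul] } :
              Matrix (S.ι × R.ι) (S.ι × R.ι) ℂ →ₗ[ℂ]
                Matrix (S.ι × R.ι ⊕ T.ι × R.ι) (S.ι × R.ι ⊕ T.ι × R.ι) ℂ))
          (fun A hA C hC => ?_) M hM
        have : (fromBlocks (A ⊗ₖ C) 0 0 (0 : Matrix (T.ι × R.ι) (T.ι × R.ι) ℂ)).submatrix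
            (Equiv.sumProdDistrib S.ι T.ι R.ι) (Equiv.sumProdDistrib S.ι T.ι R.ι)
            = (fromBlocks A 0 0 0) ⊗ₖ C := by
          ext ⟨i | i, k⟩ ⟨j | j, l⟩ <;> simp
        refine (congrArg (· ∈ ((S.directSum T).tensor R).space) this).mpr ?_
        exact kron_mem (S := S.directSum T) ⟨A, hA, 0, T.space.zero_mem, rfl⟩ hC
      have h₂ : (fromBlocks (0 : Matrix (S.ι × R.ι) (S.ι × R.ι) ℂ) 0 0 N).submatrix
          (Equiv.sumProdDistrib S.ι T.ι R.ι) (Equiv.sumProdDistrib S.ι T.ι R.ι)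
          ∈ ((S.directSum T).tensor R).space := by
        refine tensor_mem (S := T) (T := R)
          ((submatrixL (Equiv.sumProdDistrib S.ι T.ι R.ι)).comp
            ({ toFun := fun M => fromBlocks 0 0 0 M
               map_add' := by simp [fromBlocks_add]
               map_smul' := by simp [fromBlocks_smul] } :
              Matrix (T.ι × R.ι) (T.ι × R.ι) ℂ →ₗ[ℂ]
                Matrix (S.ι × R.ι ⊕ T.ι × R.ι) (S.ι × R.ι ⊕ T.ι × R.ι) ℂ))
          (fun A hA C hC => ?_) N hN
        have : (fromBlocks (0 : Matrix (S.ι × R.ι) (S.ι × R.ι) ℂ) 0 0 (A ⊗ₖ C)).submatrix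
            (Equiv.sumProdDistrib S.ι T.ι R.ι) (Equiv.sumProdDistrib S.ι T.ι R.ι)
            = (fromBlocks 0 0 0 A) ⊗ₖ C := by
          ext ⟨i | i, k⟩ ⟨j | j, l⟩ <;> simp
        refine (congrArg (· ∈ ((S.directSum T).tensor R).space) this).mpr ?_
        exact kron_mem (S := S.directSum T) ⟨0, S.space.zero_mem, A, hA, rfl⟩ hC
      have := Submodule.add_mem _ h₁ h₂
      have h₃ : fromBlocks M 0 0 N = fromBlocks M 0 0 (0 : Matrix (T.ι × R.ι) (T.ι × R.ι) ℂ) +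
          fromBlocks (0 : Matrix (S.ι × R.ι) (S.ι × R.ι) ℂ) 0 0 N := by
        simp [fromBlocks_add]
      rw [h₃]
      exact this

instance : CommSemiring NCClass where
  add_assoc := NCClass.add_assoc
  zero_add := NCClass.zero_add
  add_zero a := (NCClass.add_comm a 0).trans (NCClass.zero_add a)
  add_comm := NCClass.add_comm
  nsmul := nsmulRec
  mul_assoc := NCClass.mul_assoc
  one_mul := NCClass.one_mul
  mul_one a := (NCClass.mul_comm a 1).trans (NCClass.one_mul a)
  mul_comm := NCClass.mul_comm
  zero_mul := NCClass.zero_mul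
  mul_zero a := (NCClass.mul_comm a 0).trans (NCClass.zero_mul a)
  right_distrib := NCClass.add_mul
  left_distrib a b c := by
    rw [NCClass.mul_comm, NCClass.add_mul, NCClass.mul_comm b, NCClass.mul_comm c]

/-- The cohomomorphism preorder on `𝒢_nc`. -/
instance : Preorder NCClass where
  le := Quotient.lift₂ NCGraph.CohomLE fun _ _ _ _ h h' => propext
    ⟨fun k => ((NCGraph.cohomLE_of_iso (Setoid.symm h)).trans k).trans (NCGraph.cohomLE_of_iso h'),
      fun k => ((NCGraph.cohomLE_of_iso h).trans k).trans
        (NCGraph.cohomLE_of_iso (Setoid.symm h'))⟩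
  le_refl a := Quotient.inductionOn a fun _ => NCGraph.cohomLE_of_iso (Setoid.refl _)
  le_trans a b c := Quotient.inductionOn₃ a b c fun _ _ _ h₁ h₂ => NCGraph.CohomLE.trans h₁ h₂

/-- The map `𝒢 → 𝒢_nc` that sends a graph to its noncommutative graph. -/
def ofGraphClass : GraphClass → NCClass :=
  Quotient.map NCGraph.ofGraph fun _ _ h => ofGraph_congr h

end NCClass

/-! ## Asymptotic spectra and the intermediate semiring -/

/-- The asymptotic spectrum: monotone semiring homomorphisms to the nonnegative reals. -/
def asymptoticSpectrum (S : Type*) [CommSemiring S] [Preorder S] : Set (S →+* ℝ≥0) :=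
  {φ | Monotone φ}

/-- The subsemiring `𝒜` of `𝒢_nc` generated by the graphs and the noiseless quantum channels,
with the preorder of `𝒢_nc`. -/
def algA : Subsemiring NCClass :=
  Subsemiring.closure
    (Set.range NCClass.ofGraphClass ∪ Set.range fun d : ℕ => (NCGraph.idealQuantum d).toClass)

/-- A graph as an element of `𝒜`. -/
def graphA (G : FinGraph) : algA :=
  ⟨NCClass.ofGraphClass G.toClass, Subsemiring.subset_closure (Or.inl ⟨_, rfl⟩)⟩

/-- The noiseless `d`-dimensional quantum channel as an element of `𝒜`. -/
def quantumA (d : ℕ) : algA :=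
  ⟨(NCGraph.idealQuantum d).toClass, Subsemiring.subset_closure (Or.inr ⟨d, rfl⟩)⟩

/-- The element `⨁_{d=1}^r G_d ⊗ ℂ I_d` of `𝒜`. The graph `G_d` has the index `d - 1` in the family
`G : Fin r → FinGraph`. -/
def familyA {r : ℕ} (G : Fin r → FinGraph) : algA := ∑ d : Fin r, graphA (G d) * quantumA ((d : ℕ) + 1)

/-- `φ` is the homomorphism `f_α`, given by `f_α (⨁_d G_d ⊗ ℂ I_d) = ∑_d f (G_d) d ^ α`. -/
def IsFAlpha (f : GraphClass →+* ℝ≥0) (α : ℝ) (φ : algA →+* ℝ≥0) : Prop :=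
  ∀ (r : ℕ) (G : Fin r → FinGraph),
    φ (familyA G) = ∑ d : Fin r, f (G d).toClass * ((d : ℝ≥0) + 1) ^ α

/-- `α ∈ [1, ∞)` is an admissible exponent for `f`: the map `f_α` is an element of the asymptotic
spectrum of `𝒜`. -/
def IsAdmissible (f : GraphClass →+* ℝ≥0) (α : ℝ) : Prop :=
  1 ≤ α ∧ ∃ φ ∈ asymptoticSpectrum algA, IsFAlpha f α φ

/-! ## Probabilistic refinements -/

/-- The subgraph of the `n`-th strong power of `G` induced on the type class of the words in which
every vertex `v` occurs exactly `c v` times. -/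
abbrev typeGraph (G : FinGraph) (n : ℕ) (c : G.V → ℕ) : FinGraph :=
  ⟨{x : Fin n → G.V // ∀ v, (Finset.univ.filter fun i => x i = v).card = c v},
    (G.strongPow n).comap Subtype.val⟩

/-- For every sequence of `n`-types `Q_n = c n / n` on `V(G)` that converges to `Q`, the `n`-th root
of the value of `f` on the type graph of `Q_n` converges to `L`. -/
def IsRefinementValue (f : GraphClass →+* ℝ≥0) (G : FinGraph) (Q : G.V → ℝ) (L : ℝ) : Prop :=
  ∀ c : ℕ → G.V → ℕ, (∀ n, ∑ v, c n v = n) →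
    (∀ v, Tendsto (fun n : ℕ => (c n v : ℝ) / n) atTop (𝓝 (Q v))) →
    Tendsto (fun n : ℕ => ((f (typeGraph G n (c n)).toClass : ℝ≥0) : ℝ) ^ (1 / (n : ℝ)))
      atTop (𝓝 L)

/-- The probabilistic refinement `f (G, Q)`: the common limit along all such sequences. -/
noncomputable def probRefinement (f : GraphClass →+* ℝ≥0) (G : FinGraph) (Q : G.V → ℝ) : ℝ :=
  Classical.epsilon (IsRefinementValue f G Q)

/-- A pair `(S, Q)` with `S = ⨁_{d=1}^r G_d ⊗ ℂ I_d` and `Q` a probability distribution on the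
disjoint union of the vertex sets. -/
structure ProbFamily : Type 1 where
  r : ℕ
  G : Fin r → FinGraph
  Q : (Σ d, (G d).V) → ℝ
  Q_mem : Q ∈ stdSimplex ℝ (Σ d, (G d).V)

namespace ProbFamily

/-- The marginal `π_* Q`. -/
def marginal (X : ProbFamily) (d : Fin X.r) : ℝ := ∑ v, X.Q ⟨d, v⟩

/-- The normalized restriction `Q_d` of `Q` to `V(G_d)`. -/
noncomputable def cond (X : ProbFamily) (d : Fin X.r) (v : (X.G d).V) : ℝ :=
  X.Q ⟨d, v⟩ / X.marginal d

end ProbFamily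

/-- `log f_α (S, Q) = H(π_* Q) + ∑_d π_* Q (d) (log f (G_d, Q_d) + α log d)`. -/
noncomputable def logRefinement (f : GraphClass →+* ℝ≥0) (α : ℝ) (X : ProbFamily) : ℝ :=
  ∑ d, Real.negMulLog (X.marginal d) +
    ∑ d, X.marginal d *
      (Real.log (probRefinement f (X.G d) (X.cond d)) + α * Real.log ((d : ℝ) + 1))

/-- The functionals `(S, Q) ↦ log f_α (S, Q)` with `f_α` in the asymptotic spectrum of `𝒜`. -/
def logFunctionals : Set (ProbFamily → ℝ) :=
  {F | ∃ f ∈ asymptoticSpectrum GraphClass, ∃ α : ℝ, IsAdmissible f α ∧ F = logRefinement f α}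

end ZeroError

/-!
The type graphs, induced on the words of a given type in a strong power, replace the graph. For
`f, g` in the asymptotic spectrum, the pointwise geometric mean `F = f ^ a * g ^ b` is
multiplicative and monotone, but not additive. Additivity is restored by passing to the growth
rate of `F` on type graphs: a type of `G ⊔ H` is a choice of positions together with a type of `G`
and one of `H`, so that the growth rates on a disjoint union add up by the binomial theorem.
Multiplicativity survives since the product of two type graphs is vertex transitive: it is covered
by copies of its largest subgraph of joint type, and the number of copies grows only polynomially.
The growth rates `h` of `F` are therefore an element of the asymptotic spectrum, and the
refinement of `h` is the geometric mean of those of `f` and `g`, as the type graphs of a type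
graph sit in type graphs of `G`.

A cohomomorphism between graphs with dimensions yields a map of vertices and an isometry between
the spaces at each vertex and its image. Tensor powers of the isometries compare type graphs
tensored with `ℂ I_D`, where admissibility of `(f, α)` and `(g, β)` applies. Hence the growth
rates with vertex weights `dim ^ (a α + b β)` are monotone.
-/

namespace ZeroError

open FinGraph NCGraph
open scoped Finset

namespace FinGraph

theorem toClass_le_iff {G H : FinGraph} :
    G.toClass ≤ H.toClass ↔ ∃ φ : G.V → H.V, ∀ x y, H.AdjEq (φ x) (φ y) → G.AdjEq x y := by
  have compl_adj_iff (X : FinGraph) (x y : X.V) : X.graphᶜ.Adj x y ↔ ¬ X.AdjEq x y := by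
    rw [SimpleGraph.compl_adj, AdjEq, not_or]
  constructor
  · rintro ⟨φ⟩
    exact ⟨φ, fun x y => by
      simpa only [compl_adj_iff, not_imp_not] using φ.map_adj (v := x) (w := y)⟩
  · rintro ⟨φ, hφ⟩
    exact ⟨⟨φ, fun {x y} => by simpa only [compl_adj_iff, not_imp_not] using hφ x y⟩⟩

theorem toClass_eq {G H : FinGraph} (e : G.V ≃ H.V)
    (h : ∀ x y, H.AdjEq (e x) (e y) ↔ G.AdjEq x y) : G.toClass = H.toClass :=
  Quotient.sound (iso_of_adjEq e h)

theorem toClass_disjUnion (G H : FinGraph) : (G.disjUnion H).toClass = G.toClass + H.toClass := rfl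

theorem toClass_strongProd (G H : FinGraph) :
    (G.strongProd H).toClass = G.toClass * H.toClass := rfl

theorem toClass_mul_le_toClass_mul (X : FinGraph) {G H : FinGraph} (h : G.toClass ≤ H.toClass) :
    X.toClass * G.toClass ≤ X.toClass * H.toClass := by
  obtain ⟨φ, hφ⟩ := toClass_le_iff.1 h
  rw [← toClass_strongProd, ← toClass_strongProd, toClass_le_iff]
  refine ⟨Prod.map id φ, fun x y hxy => ?_⟩
  rw [strongProd_adjEq] at hxy ⊢
  exact ⟨hxy.1, hφ _ _ hxy.2⟩

instance : MulLeftMono GraphClass where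
  elim := by
    rintro ⟨X⟩ ⟨G⟩ ⟨H⟩ h
    exact toClass_mul_le_toClass_mul X h

theorem one_le_toClass (G : FinGraph) [Nonempty G.V] : 1 ≤ G.toClass :=
  toClass_le_iff.2 ⟨fun _ => Classical.arbitrary G.V, fun _ _ _ => AdjEq.refl _⟩

/-- The graph without edges on a finite type. Its class is a natural number in the semiring. -/
abbrev edgeless (K : Type) [Fintype K] [DecidableEq K] : FinGraph := ⟨K, ⊥⟩

theorem edgeless_adjEq {K : Type} [Fintype K] [DecidableEq K] (x y : K) :
    (edgeless K).AdjEq x y ↔ x = y :=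
  or_iff_left id

theorem toClass_edgeless (K : Type) [Fintype K] [DecidableEq K] :
    (edgeless K).toClass = (Fintype.card K : GraphClass) := by
  have edgeless_congr {K L : Type} [Fintype K] [DecidableEq K] [Fintype L] [DecidableEq L]
      (e : K ≃ L) : (edgeless K).toClass = (edgeless L).toClass :=
    toClass_eq (H := edgeless L) e fun x y => by
      rw [edgeless_adjEq, edgeless_adjEq, e.injective.eq_iff]
  have toClass_edgeless_fin (n : ℕ) : (edgeless (Fin n)).toClass = n := by
    induction n with
    | zero =>
      rw [Nat.cast_zero]
      exact toClass_eq (H := FinGraph.empty) finZeroEquiv' fun x => x.elim0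
    | succ n ih =>
      have edgeless_sum : (edgeless (Fin n ⊕ PUnit)).toClass =
          ((edgeless (Fin n)).disjUnion FinGraph.point).toClass :=
        toClass_eq (H := (edgeless (Fin n)).disjUnion FinGraph.point) (Equiv.refl _) fun x y => by
          rw [disjUnion_adjEq, edgeless_adjEq]
          rcases x with x | x <;> rcases y with y | y <;> simp [AdjEq]
      rw [edgeless_congr (finSumFinEquiv.symm.trans
        ((Equiv.refl _).sumCongr (Equiv.equivPUnit (Fin 1)))), edgeless_sum, toClass_disjUnion, ih,
        Nat.cast_succ]
      rfl
  rw [edgeless_congr (Fintype.equivFin K), toClass_edgeless_fin]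

theorem toClass_le_natCast {G : FinGraph} {n : ℕ} (h : Fintype.card G.V ≤ n) : G.toClass ≤ n := by
  obtain ⟨j⟩ : Nonempty (G.V ↪ Fin n) :=
    Function.Embedding.nonempty_of_card_le (h.trans_eq (Fintype.card_fin n).symm)
  have toClass_edgeless_fin := toClass_edgeless (Fin n)
  rw [Fintype.card_fin] at toClass_edgeless_fin
  rw [← toClass_edgeless_fin, toClass_le_iff]
  exact ⟨j, fun x y hxy => Or.inl (j.injective ((edgeless_adjEq _ _).1 hxy))⟩

theorem toClass_le_card_mul {X Y : FinGraph} {K : Type} [Fintype K] (j : K → Y.V → X.V)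
    (hj : ∀ k y y', Y.AdjEq y y' → X.AdjEq (j k y) (j k y')) (hs : ∀ x, ∃ k y, j k y = x) :
    X.toClass ≤ Fintype.card K * Y.toClass := by
  classical
  rw [← toClass_edgeless, ← toClass_strongProd, toClass_le_iff]
  choose k y hky using hs
  refine ⟨fun x => (k x, y x), fun x x' hx => ?_⟩
  obtain ⟨hk, hy⟩ := (strongProd_adjEq _ _).1 hx
  have hkx : k x = k x' := (edgeless_adjEq _ _).1 hk
  have hxx' := hj (k x) _ _ hy
  rwa [hky, hkx, hky] at hxx'

/-- The subgraph induced on a fibre of a labelling of the vertices. -/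
abbrev fiber {K : Type*} [DecidableEq K] (X : FinGraph) (κ : X.V → K) (k : K) : FinGraph :=
  ⟨{x // κ x = k}, X.graph.comap Subtype.val⟩

theorem fiber_adjEq {K : Type*} [DecidableEq K] {X : FinGraph} {κ : X.V → K} {k : K}
    (x y : (X.fiber κ k).V) : (X.fiber κ k).AdjEq x y ↔ X.AdjEq x.1 y.1 :=
  or_congr_left Subtype.ext_iff

section Power

variable (X : FinGraph) (J : Type) [Fintype J] [DecidableEq J]

/-- The strong power with factors indexed by a finite type, of which `FinGraph.strongPow` is the
case `J = Fin n`. -/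
abbrev power : FinGraph where
  V := J → X.V
  graph :=
    { Adj := fun x y => x ≠ y ∧ ∀ i, X.AdjEq (x i) (y i)
      symm := ⟨fun _ _ h => ⟨h.1.symm, fun i => (h.2 i).symm⟩⟩
      loopless := ⟨fun _ h => h.1 rfl⟩ }

variable {X J}

theorem power_adjEq (x y : J → X.V) : (X.power J).AdjEq x y ↔ ∀ i, X.AdjEq (x i) (y i) := by
  constructor
  · rintro (rfl | h)
    · exact fun i => AdjEq.refl _
    · exact h.2
  · intro h
    by_cases hxy : x = y
    · exact Or.inl hxy
    · exact Or.inr ⟨hxy, h⟩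

end Power

theorem toClass_power_fin (X : FinGraph) (m : ℕ) : (X.power (Fin m)).toClass = X.toClass ^ m := by
  induction m with
  | zero =>
    rw [pow_zero]
    exact toClass_eq (H := FinGraph.point) (Equiv.ofUnique _ _) fun x y =>
      ⟨fun _ => Or.inl (Subsingleton.elim _ _), fun _ => Or.inl rfl⟩
  | succ m ih =>
    rw [pow_succ', ← ih, ← toClass_strongProd]
    refine (toClass_eq (G := X.strongProd (X.power (Fin m))) (Fin.consEquiv fun _ => X.V)
      fun x y => ?_).symm
    rw [power_adjEq, strongProd_adjEq, power_adjEq, Fin.forall_fin_succ]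
    simp only [Fin.consEquiv_apply, Fin.cons_zero, Fin.cons_succ]

end FinGraph

/-! ## Words and their types -/

section Words

variable {I J U V W : Type*} [Fintype I] [Fintype J] [DecidableEq V]

/-- The number of occurrences of the letter `v` in the word `x`. The vector `wordCount x` is the
type of the word, without the normalization by the length. -/
def wordCount (x : I → V) (v : V) : ℕ := #{i | x i = v}

theorem wordCount_eq_sum (x : I → V) (v : V) : wordCount x v = ∑ i, if x i = v then 1 else 0 :=
  Finset.card_filter _ _

theorem wordCount_le (x : I → V) (v : V) : wordCount x v ≤ Fintype.card I :=
  Finset.card_le_univ _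

theorem sum_wordCount [Fintype V] (x : I → V) : ∑ v, wordCount x v = Fintype.card I :=
  (Finset.card_eq_sum_card_fiberwise fun i _ => Finset.mem_coe.2 (Finset.mem_univ (x i))).symm

theorem prod_pow_wordCount {M : Type*} [CommMonoid M] [Fintype V] (g : V → M) (x : I → V) :
    ∏ v, g v ^ wordCount x v = ∏ i, g (x i) := by
  rw [← Finset.prod_fiberwise' Finset.univ x g]
  simp only [Finset.prod_const, wordCount]

theorem wordCount_comp_equiv (x : I → V) (e : J ≃ I) : wordCount (x ∘ e) = wordCount x := by
  ext v
  simp only [wordCount_eq_sum, Function.comp_apply]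
  exact Equiv.sum_comp e fun i => if x i = v then 1 else 0

theorem wordCount_sumElim (x : I → V) (y : J → V) :
    wordCount (Sum.elim x y) = wordCount x + wordCount y := by
  ext v
  simp only [Pi.add_apply, wordCount_eq_sum, Fintype.sum_sum_type, Sum.elim_inl, Sum.elim_inr]
  rfl

theorem wordCount_sumMap [DecidableEq W] (x : I → V) (y : J → W) :
    wordCount (Sum.map x y) = Sum.elim (wordCount x) (wordCount y) := by
  ext (v | w)
  · simp only [wordCount_eq_sum, Sum.elim_inl, Fintype.sum_sum_type, Sum.map_inl, Sum.map_inr,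
      Sum.inl.injEq, reduceCtorEq, if_false, Finset.sum_const_zero, add_zero]
  · simp only [wordCount_eq_sum, Sum.elim_inr, Fintype.sum_sum_type, Sum.map_inl, Sum.map_inr,
      Sum.inr.injEq, reduceCtorEq, if_false, Finset.sum_const_zero, zero_add]

theorem wordCount_uncurry (x : J → I → V) (v : V) :
    wordCount (fun p : J × I => x p.1 p.2) v = ∑ j, wordCount (x j) v := by
  simp only [wordCount_eq_sum]
  exact Fintype.sum_prod_type _

/-- The push-forward of a vector of multiplicities. -/
def pushCount [Fintype U] (φ : U → V) (c : U → ℕ) (v : V) : ℕ := ∑ u with φ u = v, c u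

theorem sum_pushCount [Fintype U] [Fintype V] (φ : U → V) (c : U → ℕ) :
    ∑ v, pushCount φ c v = ∑ u, c u :=
  Finset.sum_fiberwise _ _ _

theorem prod_pow_pushCount {M : Type*} [CommMonoid M] [Fintype U] [Fintype V] (φ : U → V)
    (c : U → ℕ) (w : V → M) : ∏ v, w v ^ pushCount φ c v = ∏ u, w (φ u) ^ c u := by
  rw [← Finset.prod_fiberwise _ φ]
  refine Finset.prod_congr rfl fun v _ => ?_
  rw [pushCount, ← Finset.prod_pow_eq_pow_sum]
  exact Finset.prod_congr rfl fun u hu => by rw [(Finset.mem_filter.1 hu).2]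

theorem wordCount_comp [Fintype U] [DecidableEq U] (φ : U → V) (x : I → U) :
    wordCount (φ ∘ x) = pushCount φ (wordCount x) := by
  ext v
  refine (Finset.card_eq_sum_card_fiberwise (f := x) (t := {u | φ u = v}) fun i hi => ?_).trans
    (Finset.sum_congr rfl fun u hu => congrArg Finset.card ?_)
  · simpa using hi
  · ext i
    simp only [Finset.mem_filter, Finset.mem_univ, true_and, Function.comp_apply] at hu ⊢
    exact and_iff_right_of_imp fun h => h ▸ hu

theorem pushCount_codiagonal [Fintype V] (c d : V → ℕ) :
    pushCount (Sum.elim id id) (Sum.elim c d) = c + d := by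
  ext v
  simp only [pushCount, Finset.sum_filter, Fintype.sum_sum_type, Sum.elim_inl, Sum.elim_inr, id]
  exact congrArg₂ (· + ·) (Fintype.sum_ite_eq' v c) (Fintype.sum_ite_eq' v d)

theorem exists_perm_of_wordCount_eq {x y : I → V} (h : wordCount x = wordCount y) :
    ∃ σ : Equiv.Perm I, x ∘ σ = y := by
  have e (v : V) : {i // y i = v} ≃ {i // x i = v} := Fintype.equivOfCardEq <| by
    rw [Fintype.card_subtype, Fintype.card_subtype]
    exact (congrFun h v).symm
  exact ⟨Equiv.ofFiberEquiv e, funext fun i => Equiv.ofFiberEquiv_map e i⟩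

theorem exists_wordCount_eq [Fintype V] (c : V → ℕ) (h : Fintype.card I = ∑ v, c v) :
    ∃ x : I → V, wordCount x = c := by
  have e : I ≃ Σ v, Fin (c v) := Fintype.equivOfCardEq (by simp [h])
  refine ⟨Sigma.fst ∘ e, ?_⟩
  rw [wordCount_comp_equiv]
  ext v
  rw [wordCount_eq_sum, Fintype.sum_sigma, Finset.sum_eq_single v] <;> simp +contextual

theorem exists_lift_of_wordCount_eq_pushCount [Fintype U] [DecidableEq U] (φ : U → V) (c : U → ℕ)
    (x : I → V) (hI : Fintype.card I = ∑ u, c u) (h : wordCount x = pushCount φ c) :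
    ∃ y : I → U, wordCount y = c ∧ φ ∘ y = x := by
  obtain ⟨y, rfl⟩ := exists_wordCount_eq c hI
  obtain ⟨σ, hσ⟩ := exists_perm_of_wordCount_eq ((wordCount_comp φ y).trans h.symm)
  exact ⟨y ∘ σ, wordCount_comp_equiv y σ, hσ⟩

end Words

/-! ## Type graphs -/

section TypeGraphs

variable {I J : Type} [Fintype I] [DecidableEq I] [Fintype J] [DecidableEq J] {G H : FinGraph}

/-- The type graph of the multiplicities `c`, on the words with positions in `I`. Up to isomorphism
it is `typeGraph G n c` when `I` has `n` elements; other index types save reindexing. -/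
abbrev wordGraph (I : Type) [Fintype I] [DecidableEq I] (G : FinGraph) (c : G.V → ℕ) : FinGraph :=
  (G.power I).fiber wordCount c

theorem wordGraph_adjEq {c : G.V → ℕ} (x y : (wordGraph I G c).V) :
    (wordGraph I G c).AdjEq x y ↔ ∀ i, G.AdjEq (x.1 i) (y.1 i) :=
  (fiber_adjEq _ _).trans (power_adjEq _ _)

theorem wordGraph_congr (e : I ≃ J) (G : FinGraph) (c : G.V → ℕ) :
    (wordGraph I G c).toClass = (wordGraph J G c).toClass := by
  refine toClass_eq (H := wordGraph J G c)
    ((e.arrowCongr (Equiv.refl _)).subtypeEquiv fun x => ?_) fun x y => ?_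
  · exact (congrArg (· = c) (wordCount_comp_equiv x e.symm)).symm.to_iff
  · rw [wordGraph_adjEq, wordGraph_adjEq]
    exact e.symm.forall_congr_right (q := fun i => G.AdjEq (x.1 i) (y.1 i))

theorem toClass_typeGraph (G : FinGraph) (n : ℕ) (c : G.V → ℕ) :
    (typeGraph G n c).toClass = (wordGraph (Fin n) G c).toClass := by
  refine toClass_eq (H := wordGraph (Fin n) G c)
    (Equiv.subtypeEquivRight fun _ => funext_iff.symm) fun x y => ?_
  rw [wordGraph_adjEq]
  exact (power_adjEq x.1 y.1).symm.trans (or_congr_left Subtype.ext_iff.symm)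

/-- The class of the type graph of a vector of multiplicities. -/
def typeGraphClass (G : FinGraph) (c : G.V → ℕ) : GraphClass :=
  (wordGraph (Fin (∑ v, c v)) G c).toClass

theorem toClass_wordGraph {c : G.V → ℕ} (h : Fintype.card I = ∑ v, c v) :
    (wordGraph I G c).toClass = typeGraphClass G c :=
  wordGraph_congr (Fintype.equivFinOfCardEq h) G c

theorem one_le_typeGraphClass (G : FinGraph) (c : G.V → ℕ) : 1 ≤ typeGraphClass G c :=
  have : Nonempty (wordGraph (Fin (∑ v, c v)) G c).V :=
    let ⟨x, hx⟩ := exists_wordCount_eq c (Fintype.card_fin _)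
    ⟨x, hx⟩
  one_le_toClass _

theorem typeGraphClass_le_card_pow (G : FinGraph) (c : G.V → ℕ) :
    typeGraphClass G c ≤ (Fintype.card G.V ^ ∑ v, c v : ℕ) :=
  toClass_le_natCast <|
    (Fintype.card_subtype_le _).trans_eq (by rw [Fintype.card_fun, Fintype.card_fin])

theorem typeGraphClass_mul_le (G : FinGraph) (c d : G.V → ℕ) :
    typeGraphClass G c * typeGraphClass G d ≤ typeGraphClass G (c + d) := by
  rw [← toClass_wordGraph (I := Fin (∑ v, c v) ⊕ Fin (∑ v, d v)) (c := c + d)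
    (by simp [Finset.sum_add_distrib]), typeGraphClass, typeGraphClass, ← toClass_strongProd,
    toClass_le_iff]
  refine ⟨fun x => ⟨Sum.elim x.1.1 x.2.1, by rw [wordCount_sumElim, x.1.2, x.2.2]⟩,
    fun x y h => ?_⟩
  rw [wordGraph_adjEq] at h
  rw [strongProd_adjEq, wordGraph_adjEq, wordGraph_adjEq]
  exact ⟨fun i => h (Sum.inl i), fun i => h (Sum.inr i)⟩

theorem typeGraphClass_map (φ : G.V → H.V) (hφ : ∀ x y, H.AdjEq (φ x) (φ y) → G.AdjEq x y)
    (c : G.V → ℕ) : typeGraphClass G c ≤ typeGraphClass H (pushCount φ c) := by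
  rw [← toClass_wordGraph (I := Fin (∑ v, c v)) (c := pushCount φ c)
    (by rw [sum_pushCount, Fintype.card_fin]), typeGraphClass, toClass_le_iff]
  refine ⟨fun x => ⟨φ ∘ x.1, by rw [wordCount_comp, x.2]⟩, fun x y h => ?_⟩
  rw [wordGraph_adjEq] at h ⊢
  exact fun i => hφ _ _ (h i)

theorem typeGraphClass_pushCount_le (φ : H.V → G.V)
    (hφ : ∀ x y, H.AdjEq x y → G.AdjEq (φ x) (φ y)) (c : H.V → ℕ) :
    typeGraphClass G (pushCount φ c) ≤ typeGraphClass H c := by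
  have hI : Fintype.card (Fin (∑ v, pushCount φ c v)) = ∑ u, c u := by
    rw [Fintype.card_fin, sum_pushCount]
  rw [← toClass_wordGraph hI, typeGraphClass, toClass_le_iff]
  choose y hy hφy using fun x : (wordGraph (Fin (∑ v, pushCount φ c v)) G (pushCount φ c)).V =>
    exists_lift_of_wordCount_eq_pushCount φ c x.1 hI x.2
  refine ⟨fun x => ⟨y x, hy x⟩, fun x x' h => ?_⟩
  rw [wordGraph_adjEq] at h ⊢
  rw [← hφy x, ← hφy x']
  exact fun i => hφ _ _ (h i)

theorem typeGraphClass_strongProd_le (G H : FinGraph) (c : G.V × H.V → ℕ) :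
    typeGraphClass (G.strongProd H) c ≤
      typeGraphClass G (pushCount Prod.fst c) * typeGraphClass H (pushCount Prod.snd c) := by
  rw [← toClass_wordGraph (I := Fin (∑ v, c v)) (c := pushCount Prod.fst c)
    (by rw [sum_pushCount, Fintype.card_fin]), ← toClass_wordGraph (I := Fin (∑ v, c v))
    (c := pushCount Prod.snd c) (by rw [sum_pushCount, Fintype.card_fin]), typeGraphClass,
    ← toClass_strongProd, toClass_le_iff]
  refine ⟨fun x => (⟨Prod.fst ∘ x.1, by rw [wordCount_comp, x.2]⟩,
    ⟨Prod.snd ∘ x.1, by rw [wordCount_comp, x.2]⟩), fun x y h => ?_⟩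
  rw [strongProd_adjEq, wordGraph_adjEq, wordGraph_adjEq] at h
  rw [wordGraph_adjEq]
  exact fun i => (strongProd_adjEq _ _).2 ⟨h.1 i, h.2 i⟩

theorem typeGraphClass_wordGraph_le {c : G.V → ℕ} (hI : Fintype.card I = ∑ v, c v)
    (k : (wordGraph I G c).V → ℕ) :
    typeGraphClass (wordGraph I G c) k ≤ typeGraphClass G ((∑ x, k x) • c) := by
  rw [← toClass_wordGraph (I := Fin (∑ v, k v) × I) (c := (∑ x, k x) • c)
    (by simp [hI, Finset.mul_sum]), typeGraphClass, toClass_le_iff]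
  refine ⟨fun z => ⟨fun p => (z.1 p.1).1 p.2, ?_⟩, fun x y h => ?_⟩
  · ext v
    refine (wordCount_uncurry (fun j => (z.1 j).1) v).trans ?_
    simp [(z.1 _).2]
  · rw [wordGraph_adjEq] at h ⊢
    exact fun j => (wordGraph_adjEq _ _).2 fun i => h (j, i)

end TypeGraphs

section DisjointUnion

variable {J K : Type} [Fintype J] [DecidableEq J] [Fintype K] [DecidableEq K] {n : ℕ}
  {G H : FinGraph} {c : G.V → ℕ} {d : H.V → ℕ}

/-- The word in the disjoint union `G ⊔ H` that spells `x.1` at the positions `e (Sum.inl j)` and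
`x.2` at the positions `e (Sum.inr k)`. -/
def shuffle (e : J ⊕ K ≃ Fin n) (x : ((wordGraph J G c).strongProd (wordGraph K H d)).V) :
    (wordGraph (Fin n) (G.disjUnion H) (Sum.elim c d)).V :=
  ⟨Sum.map x.1.1 x.2.1 ∘ e.symm, by
    rw [wordCount_comp_equiv, wordCount_sumMap, x.1.2, x.2.2]⟩

theorem shuffle_apply (e : J ⊕ K ≃ Fin n)
    (x : ((wordGraph J G c).strongProd (wordGraph K H d)).V) (i : J ⊕ K) :
    (shuffle e x).1 (e i) = Sum.map x.1.1 x.2.1 i :=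
  congrArg (Sum.map x.1.1 x.2.1) (e.symm_apply_apply i)

theorem shuffle_adjEq (e : J ⊕ K ≃ Fin n)
    (x y : ((wordGraph J G c).strongProd (wordGraph K H d)).V) :
    (wordGraph (Fin n) (G.disjUnion H) (Sum.elim c d)).AdjEq (shuffle e x) (shuffle e y) ↔
      ((wordGraph J G c).strongProd (wordGraph K H d)).AdjEq x y := by
  rw [wordGraph_adjEq, strongProd_adjEq, wordGraph_adjEq, wordGraph_adjEq, ← e.forall_congr_right]
  simp only [shuffle_apply, disjUnion_adjEq, Sum.forall, Sum.map_inl, Sum.map_inr,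
    Sum.liftRel_inl_inl, Sum.liftRel_inr_inr]

theorem isLeft_shuffle (e : J ⊕ K ≃ Fin n)
    (x : ((wordGraph J G c).strongProd (wordGraph K H d)).V) (i : Fin n) :
    ((shuffle e x).1 i).isLeft = (e.symm i).isLeft :=
  Sum.isLeft_map _ _ _

theorem shuffle_injective (e : J ⊕ K ≃ Fin n) :
    Function.Injective (shuffle e : ((wordGraph J G c).strongProd (wordGraph K H d)).V → _) := by
  intro x y h
  have hxy (i : J ⊕ K) : Sum.map x.1.1 x.2.1 i = Sum.map y.1.1 y.2.1 i := by
    rw [← shuffle_apply e, h, shuffle_apply]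
  exact Prod.ext (Subtype.ext (funext fun j => Sum.inl_injective (hxy (Sum.inl j))))
    (Subtype.ext (funext fun k => Sum.inr_injective (hxy (Sum.inr k))))

theorem exists_shuffle_eq (e : J ⊕ K ≃ Fin n)
    (z : (wordGraph (Fin n) (G.disjUnion H) (Sum.elim c d)).V)
    (hz : ∀ i, (z.1 i).isLeft = (e.symm i).isLeft) : ∃ x, shuffle e x = z := by
  have hl (j : J) : ∃ v, z.1 (e (Sum.inl j)) = Sum.inl v := Sum.isLeft_iff.1 <| by
    rw [hz, e.symm_apply_apply, Sum.isLeft_inl]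
  have hr (k : K) : ∃ v, z.1 (e (Sum.inr k)) = Sum.inr v := Sum.isRight_iff.1 <| by
    rw [← Sum.not_isLeft, hz, e.symm_apply_apply, Sum.isLeft_inr]
    exact Bool.false_ne_true
  choose x hx using hl
  choose y hy using hr
  have hxy : Sum.map x y = z.1 ∘ e := by
    ext1 (j | k)
    · exact (hx j).symm
    · exact (hy k).symm
  have hcd : Sum.elim (wordCount x) (wordCount y) = Sum.elim c d := by
    rw [← wordCount_sumMap, hxy, wordCount_comp_equiv, z.2]
  refine ⟨(⟨x, funext fun v => congrFun hcd (Sum.inl v)⟩,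
    ⟨y, funext fun v => congrFun hcd (Sum.inr v)⟩), Subtype.ext ?_⟩
  change Sum.map x y ∘ e.symm = z.1
  rw [hxy, Function.comp_assoc, e.self_comp_symm, Function.comp_id]

theorem card_isLeft_of_wordCount_eq (x : Fin n → G.V ⊕ H.V) (hx : wordCount x = Sum.elim c d) :
    #{i | (x i).isLeft} = ∑ v, c v := by
  have hc (v : G.V) : wordCount x (Sum.inl v) = c v := congrFun hx (Sum.inl v)
  simp only [← hc, wordCount_eq_sum, Finset.card_filter]
  rw [Finset.sum_comm]
  refine Finset.sum_congr rfl fun i _ => ?_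
  rcases x i with a | a <;> simp

theorem isLeft_finSumEquivOfFinset_symm {α : Type*} [Fintype α] [LinearOrder α] {s : Finset α}
    {m n : ℕ} (hm : #s = m) (hn : #sᶜ = n) (a : α) :
    ((finSumEquivOfFinset hm hn).symm a).isLeft ↔ a ∈ s := by
  obtain ⟨i, rfl⟩ := (finSumEquivOfFinset hm hn).surjective a
  rw [Equiv.symm_apply_apply]
  rcases i with i | i
  · exact iff_of_true rfl (s.orderEmbOfFin_mem hm i)
  · exact iff_of_false Bool.false_ne_true (Finset.mem_compl.1 (sᶜ.orderEmbOfFin_mem hn i))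

theorem typeGraphClass_disjUnion (G H : FinGraph) (c : G.V → ℕ) (d : H.V → ℕ) :
    typeGraphClass (G.disjUnion H) (Sum.elim c d) =
      ((∑ v, c v) + ∑ v, d v).choose (∑ v, c v) * (typeGraphClass G c * typeGraphClass H d) := by
  set n := ∑ v, c v with hn
  set m := ∑ v, d v with hm
  let K := {B : Finset (Fin (n + m)) // #B = n}
  have card_compl (B : K) : #B.1ᶜ = m := by
    rw [Finset.card_compl, Fintype.card_fin, B.2, Nat.add_sub_cancel_left]
  let e (B : K) : Fin n ⊕ Fin m ≃ Fin (n + m) := finSumEquivOfFinset B.2 (card_compl B)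
  have isLeft_symm (B : K) (i : Fin (n + m)) : ((e B).symm i).isLeft ↔ i ∈ B.1 :=
    isLeft_finSumEquivOfFinset_symm B.2 (card_compl B) i
  let j (p : K × ((wordGraph (Fin n) G c).strongProd (wordGraph (Fin m) H d)).V) :=
    shuffle (e p.1) p.2
  have fst_eq_of_adjEq {p q} (h : FinGraph.AdjEq _ (j p) (j q)) : p.1 = q.1 := by
    ext i
    have hi := (disjUnion_adjEq _ _).1 ((wordGraph_adjEq _ _).1 h i)
    rw [← isLeft_symm, ← isLeft_symm, ← isLeft_shuffle (e p.1) p.2, ← isLeft_shuffle (e q.1) q.2]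
    exact hi.isLeft_congr
  have j_bijective : Function.Bijective j := by
    refine ⟨fun ⟨B, x⟩ ⟨B', y⟩ h => ?_, fun z => ?_⟩
    · obtain rfl : B = B' := fst_eq_of_adjEq (Or.inl h)
      exact Prod.ext rfl (shuffle_injective (e B) h)
    · let B : K := ⟨({i | (z.1 i).isLeft} : Finset _), card_isLeft_of_wordCount_eq z.1 z.2⟩
      obtain ⟨x, hx⟩ := exists_shuffle_eq (e B) z fun i => by
        rw [Bool.eq_iff_iff, isLeft_symm, Finset.mem_filter_univ]
      exact ⟨(B, x), hx⟩
  have card_K : Fintype.card K = (n + m).choose n := by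
    rw [Fintype.card_finset_len, Fintype.card_fin]
  rw [← card_K, ← toClass_wordGraph (I := Fin (n + m)) (by simp [hn, hm]), typeGraphClass,
    typeGraphClass, ← hn, ← hm, ← toClass_strongProd, ← toClass_edgeless, ← toClass_strongProd]
  refine (toClass_eq (Equiv.ofBijective j j_bijective) ?_).symm
  rintro ⟨B, x⟩ ⟨B', y⟩
  rw [strongProd_adjEq, edgeless_adjEq]
  refine ⟨fun h => ?_, fun ⟨hB, h⟩ => ?_⟩
  · obtain rfl : B = B' := fst_eq_of_adjEq h
    exact ⟨rfl, (shuffle_adjEq _ x y).1 h⟩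
  · obtain rfl : B = B' := hB
    exact (shuffle_adjEq _ x y).2 h

theorem typeGraphClass_add_le (G : FinGraph) (c d : G.V → ℕ) :
    typeGraphClass G (c + d) ≤
      ((∑ v, c v) + ∑ v, d v).choose (∑ v, c v) * (typeGraphClass G c * typeGraphClass G d) := by
  rw [← typeGraphClass_disjUnion, ← pushCount_codiagonal]
  refine typeGraphClass_pushCount_le (H := G.disjUnion G) _ (fun x y h => ?_) _
  cases (disjUnion_adjEq x y).1 h <;> assumption

end DisjointUnion

/-! ## Coverings by translates -/

section Covering

variable {Γ X : Type*} [Group Γ] [MulAction Γ X]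

theorem card_mul_card_smul_eq [Fintype Γ] [Fintype X] [DecidableEq X]
    [MulAction.IsPretransitive Γ X] (b u : X) :
    Fintype.card X * #{σ : Γ | σ • b = u} = Fintype.card Γ := by
  have card_smul_eq (u' : X) : #{σ : Γ | σ • b = u'} = #{σ : Γ | σ • b = u} := by
    obtain ⟨τ, rfl⟩ := MulAction.exists_smul_eq Γ u u'
    refine (Finset.card_equiv (Equiv.mulLeft τ) fun σ => ?_).symm
    simp only [Finset.mem_filter_univ, Equiv.coe_mulLeft, mul_smul]
    exact (smul_left_cancel_iff τ).symm
  calc Fintype.card X * #{σ : Γ | σ • b = u} = ∑ u', #{σ : Γ | σ • b = u'} := by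
        simp only [card_smul_eq, Finset.sum_const, Finset.card_univ, smul_eq_mul]
    _ = Fintype.card Γ :=
      (Finset.card_eq_sum_card_fiberwise fun _ _ => Finset.mem_coe.2 (Finset.mem_univ _)).symm

theorem sum_card_filter_inv_smul_mem [Fintype Γ] [DecidableEq X] (B U : Finset X) :
    ∑ σ : Γ, #{u ∈ U | σ⁻¹ • u ∈ B} = ∑ u ∈ U, ∑ b ∈ B, #{σ : Γ | σ • b = u} := by
  have card_filter (σ : Γ) :
      #{u ∈ U | σ⁻¹ • u ∈ B} = ∑ u ∈ U, ∑ b ∈ B, if σ • b = u then 1 else 0 := by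
    simp only [Finset.card_filter, ← eq_inv_smul_iff (g := σ), Finset.sum_ite_eq']
  simp only [card_filter, Finset.card_filter]
  rw [Finset.sum_comm]
  exact Finset.sum_congr rfl fun u _ => Finset.sum_comm

section Pretransitive

variable [Finite Γ] [Fintype X] [MulAction.IsPretransitive Γ X]

variable (Γ) in
theorem exists_card_mul_card_le [DecidableEq X] (B U : Finset X) :
    ∃ σ : Γ, #B * #U ≤ Fintype.card X * #{u ∈ U | σ⁻¹ • u ∈ B} := by
  cases nonempty_fintype Γ
  have sum_eq : ∑ _σ : Γ, #B * #U = ∑ σ : Γ, Fintype.card X * #{u ∈ U | σ⁻¹ • u ∈ B} := by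
    rw [← Finset.mul_sum Finset.univ fun σ : Γ => #{u ∈ U | σ⁻¹ • u ∈ B},
      sum_card_filter_inv_smul_mem]
    simp only [Finset.mul_sum, card_mul_card_smul_eq, Finset.sum_const, Finset.card_univ,
      smul_eq_mul]
    ring
  obtain ⟨σ, -, hσ⟩ := Finset.exists_le_of_sum_le ⟨1, Finset.mem_univ _⟩ sum_eq.le
  exact ⟨σ, hσ⟩

variable (Γ) in
theorem exists_card_filter_inv_smul_notMem_le [DecidableEq X] {B : Finset X} {P : ℕ} (hP : 0 < P)
    (hB : Fintype.card X ≤ P * #B) (U : Finset X) :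
    ∃ σ : Γ, (#{u ∈ U | σ⁻¹ • u ∉ B} : ℝ) ≤ #U * Real.exp (-(1 / P)) := by
  obtain ⟨σ, hσ⟩ := exists_card_mul_card_le Γ B U
  refine ⟨σ, ?_⟩
  set p := #{u ∈ U | σ⁻¹ • u ∈ B}
  have hP' : (0 : ℝ) < P := Nat.cast_pos.2 hP
  have card_le : #U ≤ P * p := by
    obtain hB0 | hB0 := Nat.eq_zero_or_pos #B
    · rw [hB0, mul_zero] at hB
      exact (U.card_le_univ.trans hB).trans (Nat.zero_le _)
    · refine Nat.le_of_mul_le_mul_left (hσ.trans ?_) hB0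
      calc Fintype.card X * p ≤ P * #B * p := Nat.mul_le_mul_right p hB
        _ = #B * (P * p) := by ring
  have card_div_le : (#U : ℝ) / P ≤ p := (div_le_iff₀' hP').2 (mod_cast card_le)
  have card_split : (p : ℝ) + #{u ∈ U | σ⁻¹ • u ∉ B} = #U :=
    mod_cast Finset.card_filter_add_card_filter_not (s := U) (σ⁻¹ • · ∈ B)
  calc (#{u ∈ U | σ⁻¹ • u ∉ B} : ℝ) = #U - p := by linarith
    _ ≤ #U - #U / P := sub_le_sub_left card_div_le _
    _ = #U * (1 - 1 / P) := by ring
    _ ≤ #U * Real.exp (-(1 / P)) := by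
      gcongr
      exact Real.one_sub_le_exp_neg _

variable (Γ) in
theorem exists_card_filter_forall_notMem_le [DecidableEq X] {B : Finset X} {P : ℕ} (hP : 0 < P)
    (hB : Fintype.card X ≤ P * #B) (t : ℕ) :
    ∃ σ : Fin t → Γ, (#{x | ∀ i, (σ i)⁻¹ • x ∉ B} : ℝ) ≤
      Fintype.card X * Real.exp (-(t / P)) := by
  induction t with
  | zero => exact ⟨Fin.elim0, by simp⟩
  | succ t ih =>
    obtain ⟨σ, hσ⟩ := ih
    set U : Finset X := {x | ∀ i, (σ i)⁻¹ • x ∉ B} with hU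
    obtain ⟨τ, hτ⟩ := exists_card_filter_inv_smul_notMem_le Γ hP hB U
    have filter_cons :
        ({x | ∀ i, ((Fin.cons τ σ : Fin (t + 1) → Γ) i)⁻¹ • x ∉ B} : Finset X) =
          {u ∈ U | τ⁻¹ • u ∉ B} := by
      ext x
      simp only [hU, Fin.forall_fin_succ, Fin.cons_zero, Fin.cons_succ, Finset.mem_filter,
        Finset.mem_univ, true_and, and_comm]
    refine ⟨Fin.cons τ σ, ?_⟩
    rw [filter_cons]
    calc (#{u ∈ U | τ⁻¹ • u ∉ B} : ℝ) ≤ #U * Real.exp (-(1 / P)) := hτ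
      _ ≤ Fintype.card X * Real.exp (-(t / P)) * Real.exp (-(1 / P)) := by gcongr
      _ = Fintype.card X * Real.exp (-((t + 1 : ℕ) / P)) := by
        rw [mul_assoc, ← Real.exp_add]
        push_cast
        ring_nf

variable (Γ) in
theorem exists_covering {B : Finset X} {P L : ℕ} (hP : 0 < P) (hB : Fintype.card X ≤ P * #B)
    (hL : (Fintype.card X : ℝ) < Real.exp L) :
    ∃ σ : Fin (P * L) → Γ, ∀ x, ∃ i, ∃ b ∈ B, σ i • b = x := by
  classical
  obtain ⟨σ, hσ⟩ := exists_card_filter_forall_notMem_le Γ hP hB (P * L)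
  have hP' : (P : ℝ) ≠ 0 := Nat.cast_ne_zero.2 hP.ne'
  have card_lt_one : (#{x | ∀ i, (σ i)⁻¹ • x ∉ B} : ℝ) < 1 := by
    rw [Nat.cast_mul, mul_div_cancel_left₀ _ hP', Real.exp_neg, ← div_eq_mul_inv] at hσ
    exact hσ.trans_lt ((div_lt_one (Real.exp_pos _)).2 hL)
  refine ⟨σ, fun x => ?_⟩
  by_contra! hx
  refine card_lt_one.not_ge (Nat.one_le_cast.2 (Finset.card_pos.2 ⟨x, ?_⟩))
  exact (Finset.mem_filter_univ _).2 fun i hi => hx i _ hi (smul_inv_smul _ _)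

end Pretransitive

end Covering

/-! ## Vertex-transitive graphs -/

namespace FinGraph

/-- The automorphism group of a graph, as the permutations that preserve the relation `≃`. -/
def autGroup (X : FinGraph) : Subgroup (Equiv.Perm X.V) where
  carrier := {e | ∀ a b, X.AdjEq (e a) (e b) ↔ X.AdjEq a b}
  mul_mem' := fun he hf _ _ => (he _ _).trans (hf _ _)
  one_mem' := fun _ _ => Iff.rfl
  inv_mem' := fun {e} he a b => by
    rw [← he, Equiv.Perm.inv_def, e.apply_symm_apply, e.apply_symm_apply]

/-- A graph is vertex transitive if its automorphism group acts transitively on the vertices. -/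
def IsVertexTransitive (X : FinGraph) : Prop := MulAction.IsPretransitive X.autGroup X.V

theorem isVertexTransitive_iff {X : FinGraph} :
    X.IsVertexTransitive ↔ ∀ x y, ∃ e ∈ X.autGroup, e x = y :=
  ⟨fun h x y => let ⟨e, he⟩ := h.exists_smul_eq x y; ⟨e.1, e.2, he⟩,
    fun h => ⟨fun x y => let ⟨e, he, hxy⟩ := h x y; ⟨⟨e, he⟩, hxy⟩⟩⟩

theorem isVertexTransitive_wordGraph (I : Type) [Fintype I] [DecidableEq I] (G : FinGraph)
    (c : G.V → ℕ) : (wordGraph I G c).IsVertexTransitive := by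
  refine isVertexTransitive_iff.2 fun x y => ?_
  obtain ⟨σ, hσ⟩ := exists_perm_of_wordCount_eq (x.2.trans y.2.symm)
  refine ⟨(σ.symm.arrowCongr (Equiv.refl _)).subtypeEquiv fun z => ?_, fun a b => ?_,
    Subtype.ext hσ⟩
  · exact (congrArg (· = c) (wordCount_comp_equiv z σ)).symm.to_iff
  · rw [wordGraph_adjEq, wordGraph_adjEq]
    exact σ.forall_congr_right (q := fun i => G.AdjEq (a.1 i) (b.1 i))

theorem IsVertexTransitive.strongProd {X Y : FinGraph} (hX : X.IsVertexTransitive)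
    (hY : Y.IsVertexTransitive) : (X.strongProd Y).IsVertexTransitive := by
  rw [isVertexTransitive_iff] at hX hY ⊢
  rintro ⟨x, y⟩ ⟨x', y'⟩
  obtain ⟨e, he, hex⟩ := hX x x'
  obtain ⟨f, hf, hfy⟩ := hY y y'
  refine ⟨e.prodCongr f, fun a b => ?_, Prod.ext hex hfy⟩
  rw [strongProd_adjEq, strongProd_adjEq]
  exact and_congr (he _ _) (hf _ _)

theorem IsVertexTransitive.power {X : FinGraph} (hX : X.IsVertexTransitive) (J : Type) [Fintype J]
    [DecidableEq J] : (X.power J).IsVertexTransitive := by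
  rw [isVertexTransitive_iff] at hX ⊢
  intro x y
  choose e he hxy using fun i => hX (x i) (y i)
  refine ⟨Equiv.piCongrRight e, fun a b => ?_, funext hxy⟩
  rw [power_adjEq, power_adjEq]
  exact forall_congr' fun i => he i _ _

theorem exists_card_le_mul_card_fiber {α K : Type*} [Fintype α] [Nonempty α] [DecidableEq K]
    (κ : α → K) (T : Finset K) (hT : ∀ x, κ x ∈ T) :
    ∃ x, Fintype.card α ≤ #T * #{y | κ y = κ x} := by
  obtain ⟨k, -, hk⟩ : ∃ k ∈ T, Fintype.card α ≤ #T * #{y | κ y = k} := by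
    refine Finset.exists_le_of_sum_le ⟨_, hT (Classical.arbitrary α)⟩ ?_
    rw [← Finset.mul_sum, ← Finset.card_eq_sum_card_fiberwise fun x _ => Finset.mem_coe.2 (hT x),
      Finset.sum_const, smul_eq_mul, Finset.card_univ]
  obtain ⟨x, hx⟩ : ({y | κ y = k} : Finset α).Nonempty :=
    Finset.card_pos.1 (Nat.pos_of_mul_pos_left (Fintype.card_pos.trans_le hk))
  exact ⟨x, by rwa [(Finset.mem_filter_univ x).1 hx]⟩

theorem IsVertexTransitive.exists_le_fiber {X : FinGraph} (hX : X.IsVertexTransitive)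
    [Nonempty X.V] {K : Type*} [DecidableEq K] (κ : X.V → K) (T : Finset K) (hT : ∀ x, κ x ∈ T)
    {L : ℕ} (hL : (Fintype.card X.V : ℝ) < Real.exp L) :
    ∃ x, X.toClass ≤ (#T * L : ℕ) * (X.fiber κ (κ x)).toClass := by
  classical
  have : MulAction.IsPretransitive X.autGroup X.V := hX
  obtain ⟨x₀, hx₀⟩ := exists_card_le_mul_card_fiber κ T hT
  have hT_pos : 0 < #T := Finset.card_pos.2 ⟨_, hT (Classical.arbitrary X.V)⟩
  obtain ⟨σ, hσ⟩ := exists_covering X.autGroup hT_pos hx₀ hL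
  refine ⟨x₀, ?_⟩
  rw [← Fintype.card_fin (#T * L)]
  refine toClass_le_card_mul (fun i y => σ i • y.1)
    (fun i y y' h => ((σ i).2 _ _).2 ((fiber_adjEq _ _).1 h)) fun x => ?_
  obtain ⟨i, b, hb, h⟩ := hσ x
  exact ⟨i, ⟨b, (Finset.mem_filter_univ b).1 hb⟩, h⟩

end FinGraph

/-- A bound for the number of copies of the largest type graph that cover a vertex-transitive graph
on words of length `n` over `k` letters: there are at most `(n + 1) ^ k` types, and the logarithm
of the number of words is less than `k * n + 1`. -/
def coveringBound (k n : ℕ) : ℕ := (n + 1) ^ k * (k * n + 1)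

theorem pow_lt_exp (a n : ℕ) : ((a ^ n : ℕ) : ℝ) < Real.exp (a * n + 1 : ℕ) :=
  have le_exp : (a : ℝ) ≤ Real.exp a := (le_add_of_nonneg_right zero_le_one).trans
    (Real.add_one_le_exp _)
  calc ((a ^ n : ℕ) : ℝ) = (a : ℝ) ^ n := Nat.cast_pow a n
    _ ≤ Real.exp a ^ n := by gcongr
    _ = Real.exp (a * n) := by rw [← Real.exp_nat_mul, mul_comm]
    _ < Real.exp (a * n + 1 : ℕ) := Real.exp_lt_exp.2 (by push_cast; exact lt_add_one _)

theorem FinGraph.IsVertexTransitive.exists_le_typeGraphClass {X Y : FinGraph}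
    (hX : X.IsVertexTransitive) [Nonempty X.V] {n : ℕ} (w : X.V → Fin n → Y.V)
    (hw : Function.Injective w)
    (hadj : ∀ x y, (∀ i, Y.AdjEq (w x i) (w y i)) → X.AdjEq x y) :
    ∃ x, X.toClass ≤
      coveringBound (Fintype.card Y.V) n * typeGraphClass Y (wordCount (w x)) := by
  have card_lt : (Fintype.card X.V : ℝ) < Real.exp (Fintype.card Y.V * n + 1 : ℕ) := by
    refine lt_of_le_of_lt (Nat.cast_le.2 ?_) (pow_lt_exp _ n)
    exact (Fintype.card_le_of_injective w hw).trans_eq (by rw [Fintype.card_fun, Fintype.card_fin])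
  obtain ⟨x, hx⟩ := hX.exists_le_fiber (fun x => wordCount (w x))
    (Fintype.piFinset fun _ => Finset.range (n + 1)) (fun x => Fintype.mem_piFinset.2 fun v => by
      rw [Finset.mem_range, Nat.lt_succ_iff]
      exact (wordCount_le (w x) v).trans_eq (Fintype.card_fin n)) card_lt
  have fiber_le : (X.fiber (fun x => wordCount (w x)) (wordCount (w x))).toClass ≤
      typeGraphClass Y (wordCount (w x)) := by
    rw [← toClass_wordGraph (I := Fin n) (sum_wordCount _).symm, toClass_le_iff]
    exact ⟨fun y => ⟨w y.1, y.2⟩, fun y z h =>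
      (fiber_adjEq _ _).2 (hadj _ _ ((wordGraph_adjEq _ _).1 h))⟩
  refine ⟨x, hx.trans ?_⟩
  simp only [Fintype.card_piFinset, Finset.card_range, Finset.prod_const, Finset.card_univ]
  exact mul_le_mul_right fiber_le _

theorem exists_jointType (G H : FinGraph) {n : ℕ} (c : G.V → ℕ) (d : H.V → ℕ)
    (hc : ∑ v, c v = n) (hd : ∑ v, d v = n) :
    ∃ e : (G.strongProd H).V → ℕ, pushCount Prod.fst e = c ∧ pushCount Prod.snd e = d ∧
      typeGraphClass G c * typeGraphClass H d ≤
        coveringBound (Fintype.card (G.V × H.V)) n * typeGraphClass (G.strongProd H) e := by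
  obtain ⟨x₀, hx₀⟩ := exists_wordCount_eq (I := Fin n) c (by rw [Fintype.card_fin, hc])
  obtain ⟨y₀, hy₀⟩ := exists_wordCount_eq (I := Fin n) d (by rw [Fintype.card_fin, hd])
  set X := (wordGraph (Fin n) G c).strongProd (wordGraph (Fin n) H d)
  have : Nonempty X.V := ⟨(⟨x₀, hx₀⟩, ⟨y₀, hy₀⟩)⟩
  have hX : X.IsVertexTransitive :=
    (isVertexTransitive_wordGraph _ _ _).strongProd (isVertexTransitive_wordGraph _ _ _)
  let w (x : X.V) (i : Fin n) : (G.strongProd H).V := (x.1.1 i, x.2.1 i)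
  have w_injective : Function.Injective w := fun x y h =>
    Prod.ext (Subtype.ext (funext fun i => congrArg Prod.fst (congrFun h i)))
      (Subtype.ext (funext fun i => congrArg Prod.snd (congrFun h i)))
  obtain ⟨z, hz⟩ := hX.exists_le_typeGraphClass w w_injective fun x y h => by
    rw [strongProd_adjEq, wordGraph_adjEq, wordGraph_adjEq, ← forall_and]
    exact fun i => (strongProd_adjEq _ _).1 (h i)
  refine ⟨wordCount (w z), (wordCount_comp Prod.fst (w z)).symm.trans z.1.2,
    (wordCount_comp Prod.snd (w z)).symm.trans z.2.2, ?_⟩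
  rwa [← toClass_wordGraph (I := Fin n) (by rw [Fintype.card_fin, hc]),
    ← toClass_wordGraph (I := Fin n) (c := d) (by rw [Fintype.card_fin, hd]), ← toClass_strongProd]

theorem FinGraph.IsVertexTransitive.exists_pow_le_typeGraphClass {X : FinGraph}
    (hX : X.IsVertexTransitive) [Nonempty X.V] (m : ℕ) :
    ∃ k : X.V → ℕ, ∑ x, k x = m ∧
      X.toClass ^ m ≤ coveringBound (Fintype.card X.V) m * typeGraphClass X k := by
  obtain ⟨z, hz⟩ := (hX.power (Fin m)).exists_le_typeGraphClass id Function.injective_id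
    fun x y h => (power_adjEq x y).2 h
  rw [toClass_power_fin] at hz
  exact ⟨wordCount z, (sum_wordCount z).trans (Fintype.card_fin m), hz⟩

/-! ## Multiplicative functionals and their values -/

/-- A multiplicative functional on graph classes that is monotone and normalized on the edgeless
graphs. Elements of the asymptotic spectrum are such functionals, and unlike the spectrum, these
functionals are closed under geometric means. -/
structure IsNormalized (F : GraphClass →* ℝ≥0) : Prop where
  mono : Monotone F
  map_natCast : ∀ n : ℕ, F n = n

theorem isNormalized_of_mem {f : GraphClass →+* ℝ≥0} (hf : f ∈ asymptoticSpectrum GraphClass) :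
    IsNormalized (f : GraphClass →* ℝ≥0) :=
  ⟨hf, fun n => _root_.map_natCast f n⟩

/-- The weighted geometric mean of two multiplicative functionals. -/
noncomputable def geomMean (F F' : GraphClass →* ℝ≥0) (a b : ℝ) : GraphClass →* ℝ≥0 where
  toFun X := F X ^ a * F' X ^ b
  map_one' := by simp only [map_one, NNReal.one_rpow, mul_one]
  map_mul' X Y := by
    rw [map_mul, map_mul, NNReal.mul_rpow, NNReal.mul_rpow]
    exact mul_mul_mul_comm _ _ _ _

/-- The value of a functional on the type graph of `c`, with a weight on each letter. -/
noncomputable def typeValue (F : GraphClass →* ℝ≥0) (G : FinGraph) (w : G.V → ℝ≥0)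
    (c : G.V → ℕ) : ℝ≥0 :=
  F (typeGraphClass G c) * ∏ v, w v ^ c v

/-- The exponential growth rate of the values of a functional on the type graphs: the least `K` such
that types of length `n` have value at most `K ^ n`. For a semiring homomorphism and unit weights
this is the value on the graph, and for a geometric mean it replaces the missing additivity. -/
noncomputable def value (F : GraphClass →* ℝ≥0) (G : FinGraph) (w : G.V → ℝ≥0) : ℝ≥0 :=
  sInf {K | ∀ c, typeValue F G w c ≤ K ^ ∑ v, c v}

section Value

variable {F F' : GraphClass →* ℝ≥0} {G H : FinGraph} {w : G.V → ℝ≥0} {w' : H.V → ℝ≥0}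

theorem IsNormalized.geomMean (hF : IsNormalized F) (hF' : IsNormalized F') {a b : ℝ} (ha : 0 ≤ a)
    (hb : 0 ≤ b) (hab : a + b = 1) : IsNormalized (geomMean F F' a b) where
  mono _ _ h := mul_le_mul' (NNReal.rpow_le_rpow (hF.mono h) ha)
    (NNReal.rpow_le_rpow (hF'.mono h) hb)
  map_natCast n := by
    change F n ^ a * F' n ^ b = n
    rw [hF.map_natCast, hF'.map_natCast, ← NNReal.rpow_add_of_nonneg _ ha hb, hab,
      NNReal.rpow_one]

theorem IsNormalized.one_le_map_typeGraphClass (hF : IsNormalized F) (G : FinGraph)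
    (c : G.V → ℕ) : 1 ≤ F (typeGraphClass G c) := by
  rw [← map_one F]
  exact hF.mono (one_le_typeGraphClass G c)

theorem IsNormalized.map_typeGraphClass_le_pow (hF : IsNormalized F) (G : FinGraph)
    (c : G.V → ℕ) : F (typeGraphClass G c) ≤ (Fintype.card G.V : ℝ≥0) ^ ∑ v, c v := by
  have h := hF.mono (typeGraphClass_le_card_pow G c)
  rwa [hF.map_natCast, Nat.cast_pow] at h

theorem IsNormalized.map_typeGraphClass_mul_le (hF : IsNormalized F) (G : FinGraph)
    (c d : G.V → ℕ) :
    F (typeGraphClass G c) * F (typeGraphClass G d) ≤ F (typeGraphClass G (c + d)) := by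
  rw [← map_mul]
  exact hF.mono (typeGraphClass_mul_le G c d)

theorem one_le_typeValue (hF : IsNormalized F) (hw : ∀ v, 1 ≤ w v) (c : G.V → ℕ) :
    1 ≤ typeValue F G w c :=
  one_le_mul (hF.one_le_map_typeGraphClass G c) (Finset.one_le_prod' fun v _ => one_le_pow₀ (hw v))

theorem typeValue_le_pow (hF : IsNormalized F) (w : G.V → ℝ≥0) (c : G.V → ℕ) :
    typeValue F G w c ≤ (Fintype.card G.V * ∑ v, w v) ^ ∑ v, c v := by
  rw [mul_pow, ← Finset.prod_pow_eq_pow_sum _ _ (∑ v, w v)]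
  refine mul_le_mul' (hF.map_typeGraphClass_le_pow G c) (Finset.prod_le_prod' fun v _ => ?_)
  exact pow_le_pow_left' (Finset.single_le_sum (fun _ _ => zero_le) (Finset.mem_univ v)) _

theorem typeValue_zero (hF : IsNormalized F) (w : G.V → ℝ≥0) : typeValue F G w 0 = 1 := by
  refine le_antisymm ?_ ?_
  · simpa only [Pi.zero_apply, Finset.sum_const_zero, pow_zero] using typeValue_le_pow hF w 0
  · simpa only [typeValue, Pi.zero_apply, pow_zero, Finset.prod_const_one, mul_one]
      using hF.one_le_map_typeGraphClass G 0

theorem typeValue_mul_le (hF : IsNormalized F) (w : G.V → ℝ≥0) (c d : G.V → ℕ) :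
    typeValue F G w c * typeValue F G w d ≤ typeValue F G w (c + d) :=
  calc typeValue F G w c * typeValue F G w d
      = F (typeGraphClass G c) * F (typeGraphClass G d) * ∏ v, w v ^ (c + d) v := by
        simp only [typeValue, Pi.add_apply, pow_add, Finset.prod_mul_distrib]
        exact mul_mul_mul_comm _ _ _ _
    _ ≤ typeValue F G w (c + d) := mul_le_mul_left (hF.map_typeGraphClass_mul_le G c d) _

theorem typeValue_pow_le (hF : IsNormalized F) (w : G.V → ℝ≥0) (c : G.V → ℕ) (n : ℕ) :
    typeValue F G w c ^ n ≤ typeValue F G w (n • c) := by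
  induction n with
  | zero => rw [pow_zero, zero_smul, typeValue_zero hF]
  | succ n ih =>
    rw [pow_succ, succ_nsmul]
    exact (mul_le_mul_left ih _).trans (typeValue_mul_le hF w _ _)

theorem value_le {K : ℝ≥0} (h : ∀ c, typeValue F G w c ≤ K ^ ∑ v, c v) : value F G w ≤ K :=
  csInf_le (OrderBot.bddBelow _) h

theorem typeValue_le_value_pow (hF : IsNormalized F) (w : G.V → ℝ≥0) (c : G.V → ℕ) :
    typeValue F G w c ≤ value F G w ^ ∑ v, c v := by
  have isClosed_bounds : IsClosed {K : ℝ≥0 | ∀ c, typeValue F G w c ≤ K ^ ∑ v, c v} := by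
    simp only [Set.ofPred_forall]
    exact isClosed_iInter fun c => isClosed_le continuous_const (continuous_pow _)
  exact isClosed_bounds.csInf_mem ⟨_, typeValue_le_pow hF w⟩ (OrderBot.bddBelow _) c

theorem one_le_value (hF : IsNormalized F) [Nonempty G.V] (hw : ∀ v, 1 ≤ w v) :
    1 ≤ value F G w := by
  classical
  have h := typeValue_le_value_pow hF w (Pi.single (Classical.arbitrary G.V) 1)
  rw [Fintype.sum_pi_single', pow_one] at h
  exact (one_le_typeValue hF hw _).trans h

theorem exists_pow_lt_typeValue {K : ℝ≥0} (hK : K < value F G w) :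
    ∃ c, K ^ ∑ v, c v < typeValue F G w c := by
  by_contra! h
  exact hK.not_ge (value_le h)

theorem exists_mul_value_pow_le (hF : IsNormalized F) [Nonempty G.V] (hw : ∀ v, 1 ≤ w v) {a : ℝ≥0}
    (ha : a < 1) : ∃ C : ℝ≥0, ∀ n, ∃ c : G.V → ℕ, ∑ v, c v = n ∧
      (a * value F G w) ^ n ≤ C * typeValue F G w c := by
  classical
  set K := a * value F G w
  have hK : K < value F G w :=
    mul_lt_of_lt_one_left (zero_lt_one.trans_le (one_le_value hF hw)) ha
  obtain ⟨c, hc⟩ := exists_pow_lt_typeValue hK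
  set m := ∑ v, c v with hm
  have hm_pos : 0 < m := by
    refine Nat.pos_of_ne_zero fun hm0 => hc.ne ?_
    have c_eq_zero : c = 0 :=
      funext fun v => Finset.sum_eq_zero_iff.1 (hm.symm.trans hm0) v (Finset.mem_univ v)
    rw [hm0, c_eq_zero, pow_zero, typeValue_zero hF]
  refine ⟨max 1 K ^ m, fun n => ?_⟩
  set r : G.V → ℕ := Pi.single (Classical.arbitrary G.V) (n % m)
  refine ⟨(n / m) • c + r, ?_, ?_⟩
  · simp only [Pi.add_apply, Pi.smul_apply, smul_eq_mul, Finset.sum_add_distrib,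
      ← Finset.mul_sum, ← hm, r, Fintype.sum_pi_single', Nat.div_add_mod']
  · have le_max_pow : K ^ (n % m) ≤ max 1 K ^ m :=
      (pow_le_pow_left' (le_max_right 1 K) _).trans
        (pow_le_pow_right₀ (le_max_left 1 K) (Nat.mod_lt n hm_pos).le)
    have typeValue_le : typeValue F G w c ^ (n / m) ≤ typeValue F G w ((n / m) • c + r) :=
      (le_mul_of_le_of_one_le (typeValue_pow_le hF w c _) (one_le_typeValue hF hw r)).trans
        (typeValue_mul_le hF w _ _)
    calc K ^ n = K ^ (n % m) * (K ^ m) ^ (n / m) := by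
          rw [← pow_mul, ← pow_add, Nat.mod_add_div]
      _ ≤ max 1 K ^ m * typeValue F G w ((n / m) • c + r) :=
          mul_le_mul' le_max_pow ((pow_le_pow_left' hc.le _).trans typeValue_le)

theorem value_of_isEmpty (hF : IsNormalized F) [IsEmpty G.V] (w : G.V → ℝ≥0) :
    value F G w = 0 := by
  refine le_antisymm (value_le fun c => ?_) zero_le
  rw [Subsingleton.elim c 0, typeValue_zero hF]
  simp only [Finset.univ_eq_empty, Finset.sum_empty, pow_zero, le_refl]

theorem value_point (hF : IsNormalized F) (w : FinGraph.point.V → ℝ≥0) :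
    value F FinGraph.point w = w () := by
  have typeValue_point (c : FinGraph.point.V → ℕ) :
      typeValue F FinGraph.point w c = w () ^ ∑ v, c v := by
    have map_eq_one : F (typeGraphClass FinGraph.point c) = 1 :=
      le_antisymm (by simpa using hF.map_typeGraphClass_le_pow FinGraph.point c)
        (hF.one_le_map_typeGraphClass _ _)
    rw [typeValue, map_eq_one, one_mul]
    exact Finset.prod_pow_eq_pow_sum Finset.univ c (w ())
  refine le_antisymm (value_le fun c => (typeValue_point c).le) ?_
  simpa [typeValue_point] using typeValue_le_value_pow hF w 1

theorem value_mono (hF : IsNormalized F) (φ : G.V → H.V)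
    (h : ∀ c, typeValue F G w c ≤ typeValue F H w' (pushCount φ c)) :
    value F G w ≤ value F H w' := by
  refine value_le fun c => (h c).trans ?_
  rw [← sum_pushCount φ c]
  exact typeValue_le_value_pow hF w' _

theorem value_mono_of_hom (hF : IsNormalized F) (φ : G.V → H.V)
    (hφ : ∀ x y, H.AdjEq (φ x) (φ y) → G.AdjEq x y) (hw : ∀ x, w x ≤ w' (φ x)) :
    value F G w ≤ value F H w' := by
  refine value_mono hF φ fun c => ?_
  rw [typeValue, typeValue, prod_pow_pushCount]
  exact mul_le_mul' (hF.mono (typeGraphClass_map φ hφ c))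
    (Finset.prod_le_prod' fun v _ => pow_le_pow_left' (hw v) _)

theorem le_of_pow_le_poly_mul_pow {K L C : ℝ≥0} {k : ℕ}
    (h : ∀ n : ℕ, K ^ n ≤ C * (n + 1 : ℝ≥0) ^ k * L ^ n) : K ≤ L := by
  by_contra! hlt
  have hK : 0 < K := pos_of_gt hlt
  have abs_lt_one : |((L / K : ℝ≥0) : ℝ)| < 1 := by
    rw [NNReal.abs_eq]
    exact NNReal.coe_lt_one.2 ((div_lt_one hK).2 hlt)
  have tendsto_zero := (tendsto_pow_const_mul_const_pow_of_abs_lt_one k abs_lt_one).const_mul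
    (C * 2 ^ k : ℝ)
  rw [mul_zero] at tendsto_zero
  refine zero_lt_one.not_ge (ge_of_tendsto tendsto_zero ?_)
  filter_upwards [eventually_ge_atTop 1] with n hn
  have add_one_le : (n + 1 : ℝ≥0) ≤ 2 * n := by
    rw [two_mul]
    exact add_le_add_right (Nat.one_le_cast.2 hn) _
  have one_le : 1 ≤ C * 2 ^ k * ((n : ℝ≥0) ^ k * (L / K) ^ n) :=
    calc 1 ≤ C * (n + 1 : ℝ≥0) ^ k * L ^ n / K ^ n := (one_le_div (pow_pos hK n)).2 (h n)
      _ ≤ C * (2 * n) ^ k * L ^ n / K ^ n := by gcongr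
      _ = C * 2 ^ k * ((n : ℝ≥0) ^ k * (L / K) ^ n) := by rw [mul_pow, div_pow]; ring
  exact_mod_cast one_le

theorem coveringBound_le (k n : ℕ) :
    (coveringBound k n : ℝ≥0) ≤ (k + 1) * (n + 1) ^ (k + 1) := by
  have mul_add_one_le : k * n + 1 ≤ (k + 1) * (n + 1) := by nlinarith
  calc (coveringBound k n : ℝ≥0) = (n + 1) ^ k * (k * n + 1 : ℕ) := by
        rw [coveringBound, Nat.cast_mul, Nat.cast_pow, Nat.cast_add_one]
    _ ≤ (n + 1) ^ k * ((k + 1) * (n + 1) : ℕ) := by gcongr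
    _ = (k + 1) * (n + 1) ^ (k + 1) := by push_cast; ring

theorem typeValue_disjUnion (hF : IsNormalized F) (w : G.V → ℝ≥0) (w' : H.V → ℝ≥0) (c : G.V → ℕ)
    (d : H.V → ℕ) :
    typeValue F (G.disjUnion H) (Sum.elim w w') (Sum.elim c d) =
      ((∑ v, c v) + ∑ v, d v).choose (∑ v, c v) * (typeValue F G w c * typeValue F H w' d) := by
  rw [typeValue, typeGraphClass_disjUnion, map_mul, map_mul, hF.map_natCast, typeValue, typeValue]
  simp only [Fintype.prod_sum_type, Sum.elim_inl, Sum.elim_inr]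
  ring

theorem value_disjUnion_le (hF : IsNormalized F) (w : G.V → ℝ≥0) (w' : H.V → ℝ≥0) :
    value F (G.disjUnion H) (Sum.elim w w') ≤ value F G w + value F H w' := by
  refine value_le fun e => ?_
  obtain ⟨c, d, rfl⟩ : ∃ c d, e = Sum.elim c d := ⟨_, _, (Sum.elim_comp_inl_inr e).symm⟩
  rw [typeValue_disjUnion hF, (Fintype.sum_sum_type _ :
    ∑ v : (G.disjUnion H).V, Sum.elim c d v = (∑ v, c v) + ∑ v, d v)]
  set n := ∑ v, c v
  set m := ∑ v, d v
  calc ((n + m).choose n : ℝ≥0) * (typeValue F G w c * typeValue F H w' d)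
      ≤ (n + m).choose n * (value F G w ^ n * value F H w' ^ m) := by
        gcongr <;> exact typeValue_le_value_pow hF _ _
    _ = value F G w ^ n * value F H w' ^ (n + m - n) * (n + m).choose n := by
        rw [Nat.add_sub_cancel_left, mul_comm]
    _ ≤ (value F G w + value F H w') ^ (n + m) := by
        rw [add_pow]
        exact Finset.single_le_sum (f := fun k => value F G w ^ k * value F H w' ^ (n + m - k) *
          ((n + m).choose k : ℝ≥0)) (fun _ _ => zero_le)
          (Finset.mem_range.2 (Nat.lt_succ_of_le (Nat.le_add_right n m)))

theorem value_left_le_value_disjUnion (hF : IsNormalized F) (w : G.V → ℝ≥0) (w' : H.V → ℝ≥0) :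
    value F G w ≤ value F (G.disjUnion H) (Sum.elim w w') :=
  value_mono_of_hom hF Sum.inl (fun _ _ h => Sum.liftRel_inl_inl.1 ((disjUnion_adjEq _ _).1 h))
    fun _ => le_rfl

theorem value_right_le_value_disjUnion (hF : IsNormalized F) (w : G.V → ℝ≥0) (w' : H.V → ℝ≥0) :
    value F H w' ≤ value F (G.disjUnion H) (Sum.elim w w') :=
  value_mono_of_hom hF Sum.inr (fun _ _ h => Sum.liftRel_inr_inr.1 ((disjUnion_adjEq _ _).1 h))
    fun _ => le_rfl

theorem add_value_le_value_disjUnion (hF : IsNormalized F) [Nonempty G.V] [Nonempty H.V]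
    (hw : ∀ v, 1 ≤ w v) (hw' : ∀ v, 1 ≤ w' v) :
    value F G w + value F H w' ≤ value F (G.disjUnion H) (Sum.elim w w') := by
  refine NNReal.le_of_forall_lt_one_mul_le fun a ha => ?_
  obtain ⟨C, hC⟩ := exists_mul_value_pow_le hF hw ha
  obtain ⟨C', hC'⟩ := exists_mul_value_pow_le hF hw' ha
  set V := value F (G.disjUnion H) (Sum.elim w w')
  refine le_of_pow_le_poly_mul_pow (C := C * C') (k := 1) fun n => ?_
  have term_le {k : ℕ} (hk : k ∈ Finset.range (n + 1)) :
      (a * value F G w) ^ k * (a * value F H w') ^ (n - k) * n.choose k ≤ C * C' * V ^ n := by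
    have hkn : k + (n - k) = n := Nat.add_sub_cancel' (Finset.mem_range_succ_iff.1 hk)
    obtain ⟨c, hc, hcK⟩ := hC k
    obtain ⟨d, hd, hdK⟩ := hC' (n - k)
    have sum_eq : ∑ v : (G.disjUnion H).V, Sum.elim c d v = n :=
      (Fintype.sum_sum_type _).trans ((congrArg₂ (· + ·) hc hd).trans hkn)
    calc (a * value F G w) ^ k * (a * value F H w') ^ (n - k) * n.choose k
        ≤ C * typeValue F G w c * (C' * typeValue F H w' d) * n.choose k := by gcongr
      _ = C * C' * typeValue F (G.disjUnion H) (Sum.elim w w') (Sum.elim c d) := by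
        rw [typeValue_disjUnion hF, hc, hd, hkn]
        ring
      _ ≤ C * C' * V ^ n := by
        gcongr
        exact (typeValue_le_value_pow hF _ _).trans_eq (by rw [sum_eq])
  calc (a * (value F G w + value F H w')) ^ n
      ≤ ∑ _k ∈ Finset.range (n + 1), C * C' * V ^ n := by
        rw [mul_add, add_pow]
        exact Finset.sum_le_sum fun k hk => term_le hk
    _ = C * C' * (n + 1) ^ 1 * V ^ n := by
        rw [Finset.sum_const, Finset.card_range, nsmul_eq_mul, Nat.cast_add_one]
        ring

theorem value_disjUnion (hF : IsNormalized F) (hw : ∀ v, 1 ≤ w v) (hw' : ∀ v, 1 ≤ w' v) :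
    value F (G.disjUnion H) (Sum.elim w w') = value F G w + value F H w' := by
  refine (value_disjUnion_le hF w w').antisymm ?_
  cases isEmpty_or_nonempty G.V with
  | inl _ =>
    rw [value_of_isEmpty hF, zero_add]
    exact value_right_le_value_disjUnion hF w w'
  | inr _ =>
    cases isEmpty_or_nonempty H.V with
    | inl _ =>
      rw [value_of_isEmpty hF w', add_zero]
      exact value_left_le_value_disjUnion hF w w'
    | inr _ => exact add_value_le_value_disjUnion hF hw hw'

theorem prod_mul_pow_eq (w : G.V → ℝ≥0) (w' : H.V → ℝ≥0) (e : G.V × H.V → ℕ) :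
    ∏ v : G.V × H.V, (w v.1 * w' v.2) ^ e v =
      (∏ v, w v ^ pushCount Prod.fst e v) * ∏ v, w' v ^ pushCount Prod.snd e v := by
  rw [prod_pow_pushCount, prod_pow_pushCount, ← Finset.prod_mul_distrib]
  simp only [mul_pow]

theorem value_strongProd_le (hF : IsNormalized F) (w : G.V → ℝ≥0) (w' : H.V → ℝ≥0) :
    value F (G.strongProd H) (fun v => w v.1 * w' v.2) ≤ value F G w * value F H w' := by
  refine value_le fun e => ?_
  set c := pushCount Prod.fst e with hc
  set d := pushCount Prod.snd e with hd
  have map_le : F (typeGraphClass (G.strongProd H) e) ≤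
      F (typeGraphClass G c) * F (typeGraphClass H d) := by
    rw [← map_mul]
    exact hF.mono (typeGraphClass_strongProd_le G H e)
  calc typeValue F (G.strongProd H) (fun v => w v.1 * w' v.2) e
      = F (typeGraphClass (G.strongProd H) e) * ((∏ v, w v ^ c v) * ∏ v, w' v ^ d v) :=
        congrArg _ (prod_mul_pow_eq w w' e)
    _ ≤ F (typeGraphClass G c) * F (typeGraphClass H d) *
          ((∏ v, w v ^ c v) * ∏ v, w' v ^ d v) := by gcongr
    _ = typeValue F G w c * typeValue F H w' d := mul_mul_mul_comm _ _ _ _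
    _ ≤ value F G w ^ (∑ v, c v) * value F H w' ^ (∑ v, d v) :=
        mul_le_mul' (typeValue_le_value_pow hF w c) (typeValue_le_value_pow hF w' d)
    _ = (value F G w * value F H w') ^ ∑ v, e v := by
        rw [mul_pow, hc, hd, sum_pushCount, sum_pushCount]

theorem exists_typeValue_mul_le (hF : IsNormalized F) (w : G.V → ℝ≥0) (w' : H.V → ℝ≥0) {n : ℕ}
    {c : G.V → ℕ} {d : H.V → ℕ} (hc : ∑ v, c v = n) (hd : ∑ v, d v = n) :
    ∃ e : (G.strongProd H).V → ℕ, ∑ v, e v = n ∧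
      typeValue F G w c * typeValue F H w' d ≤ coveringBound (Fintype.card (G.V × H.V)) n *
        typeValue F (G.strongProd H) (fun v => w v.1 * w' v.2) e := by
  obtain ⟨e, rfl, rfl, he⟩ := exists_jointType G H c d hc hd
  refine ⟨e, (sum_pushCount Prod.fst e).symm.trans hc, ?_⟩
  have map_le := hF.mono he
  rw [map_mul, map_mul, hF.map_natCast] at map_le
  rw [typeValue, typeValue, mul_mul_mul_comm, ← prod_mul_pow_eq, typeValue, ← mul_assoc]
  exact mul_le_mul_left map_le _

theorem value_mul_value_le (hF : IsNormalized F) [Nonempty G.V] [Nonempty H.V]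
    (hw : ∀ v, 1 ≤ w v) (hw' : ∀ v, 1 ≤ w' v) :
    value F G w * value F H w' ≤ value F (G.strongProd H) (fun v => w v.1 * w' v.2) := by
  refine NNReal.le_of_forall_lt_one_mul_le fun a ha => ?_
  refine NNReal.le_of_forall_lt_one_mul_le fun b hb => ?_
  obtain ⟨C, hC⟩ := exists_mul_value_pow_le hF hw ha
  obtain ⟨C', hC'⟩ := exists_mul_value_pow_le hF hw' hb
  set V := value F (G.strongProd H) (fun v => w v.1 * w' v.2)
  set k := Fintype.card (G.V × H.V)
  refine le_of_pow_le_poly_mul_pow (C := C * C' * (k + 1)) (k := k + 1) fun n => ?_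
  obtain ⟨c, hc, hcK⟩ := hC n
  obtain ⟨d, hd, hdK⟩ := hC' n
  obtain ⟨e, rfl, he⟩ := exists_typeValue_mul_le hF w w' hc hd
  set n := ∑ v, e v
  calc (b * (a * (value F G w * value F H w'))) ^ n
      = (a * value F G w) ^ n * (b * value F H w') ^ n := by ring
    _ ≤ C * typeValue F G w c * (C' * typeValue F H w' d) := mul_le_mul' hcK hdK
    _ = C * C' * (typeValue F G w c * typeValue F H w' d) := mul_mul_mul_comm _ _ _ _
    _ ≤ C * C' * (coveringBound k n *
          typeValue F (G.strongProd H) (fun v => w v.1 * w' v.2) e) := by gcongr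
    _ ≤ C * C' * (((k + 1) * (n + 1) ^ (k + 1)) * V ^ n) := by
        gcongr
        · exact coveringBound_le k n
        · exact typeValue_le_value_pow hF _ e
    _ = C * C' * (k + 1) * (n + 1) ^ (k + 1) * V ^ n := by ring

theorem value_strongProd (hF : IsNormalized F) (hw : ∀ v, 1 ≤ w v) (hw' : ∀ v, 1 ≤ w' v) :
    value F (G.strongProd H) (fun v => w v.1 * w' v.2) = value F G w * value F H w' := by
  refine (value_strongProd_le hF w w').antisymm ?_
  cases isEmpty_or_nonempty G.V with
  | inl _ => rw [value_of_isEmpty hF w, zero_mul]; exact zero_le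
  | inr _ =>
    cases isEmpty_or_nonempty H.V with
    | inl _ => rw [value_of_isEmpty hF w', mul_zero]; exact zero_le
    | inr _ => exact value_mul_value_le hF hw hw'

end Value

/-! ## Growth rates along frequencies -/

section Types

variable {V : Type*} [Fintype V] {Q : V → ℝ}

/-- The relative frequencies of the letters in the words with the multiplicities `c`. -/
noncomputable def freq (c : V → ℕ) (v : V) : ℝ := c v / (∑ u, c u : ℕ)

/-- The filter along which the length of a type tends to infinity and its frequencies tend to
`Q`. -/
noncomputable def typeFilter (Q : V → ℝ) : Filter (V → ℕ) :=
  comap (fun c => ∑ v, c v) atTop ⊓ comap freq (𝓝 Q)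

theorem sum_nsmul (c : V → ℕ) (m : ℕ) : ∑ v, (m • c) v = m * ∑ v, c v := by
  simp only [Pi.smul_apply, smul_eq_mul, Finset.mul_sum]

theorem freq_mul_sum (c : V → ℕ) (v : V) : freq c v * (∑ u, c u : ℕ) = c v := by
  rcases eq_or_ne (∑ u, c u) 0 with h | h
  · rw [h, Nat.cast_zero, mul_zero, Finset.sum_eq_zero_iff.1 h v (Finset.mem_univ v),
      Nat.cast_zero]
  · exact div_mul_cancel₀ _ (Nat.cast_ne_zero.2 h)

theorem freq_nonneg (c : V → ℕ) (v : V) : 0 ≤ freq c v :=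
  div_nonneg (Nat.cast_nonneg _) (Nat.cast_nonneg _)

theorem freq_nsmul {m : ℕ} (hm : m ≠ 0) (c : V → ℕ) : freq (m • c) = freq c := by
  ext v
  rw [freq, freq, sum_nsmul, Pi.smul_apply, smul_eq_mul, Nat.cast_mul, Nat.cast_mul,
    mul_div_mul_left _ _ (Nat.cast_ne_zero.2 hm)]

theorem tendsto_sum_typeFilter : Tendsto (fun c => ∑ v, c v) (typeFilter Q) atTop :=
  tendsto_comap.mono_left inf_le_left

theorem tendsto_freq_typeFilter : Tendsto freq (typeFilter Q) (𝓝 Q) :=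
  tendsto_comap.mono_left inf_le_right

theorem tendsto_typeFilter {c : ℕ → V → ℕ} (hc : ∀ n, ∑ v, c n v = n)
    (hQ : ∀ v, Tendsto (fun n : ℕ => (c n v : ℝ) / n) atTop (𝓝 (Q v))) :
    Tendsto c atTop (typeFilter Q) := by
  refine tendsto_inf.2
    ⟨tendsto_comap_iff.2 ?_, tendsto_comap_iff.2 (tendsto_pi_nhds.2 fun v => ?_)⟩
  · simp only [Function.comp_def, hc]
    exact tendsto_id
  · simpa only [Function.comp_def, freq, hc] using hQ v

theorem exists_typeSequence (hQ : Q ∈ stdSimplex ℝ V) : ∃ c : ℕ → V → ℕ,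
    (∀ n, ∑ v, c n v = n) ∧
      ∀ v, Tendsto (fun n : ℕ => (c n v : ℝ) / n) atTop (𝓝 (Q v)) := by
  classical
  obtain ⟨v₀, -⟩ : (Finset.univ : Finset V).Nonempty :=
    Finset.nonempty_of_sum_ne_zero (hQ.2.trans_ne one_ne_zero)
  set a : ℕ → V → ℕ := fun n v => ⌊Q v * n⌋₊
  have sum_floor_le (n : ℕ) : ∑ v, a n v ≤ n := by
    have cast_le : ((∑ v, a n v : ℕ) : ℝ) ≤ n := by
      rw [Nat.cast_sum]
      calc ∑ v, (a n v : ℝ) ≤ ∑ v, Q v * n :=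
            Finset.sum_le_sum fun v _ => Nat.floor_le (mul_nonneg (hQ.1 v) (Nat.cast_nonneg n))
        _ = n := by rw [← Finset.sum_mul, hQ.2, one_mul]
    exact_mod_cast cast_le
  have tendsto_floor (v : V) : Tendsto (fun n : ℕ => (a n v : ℝ) / n) atTop (𝓝 (Q v)) :=
    (tendsto_nat_floor_mul_div_atTop (R := ℝ) (hQ.1 v)).comp tendsto_natCast_atTop_atTop
  have tendsto_remainder :
      Tendsto (fun n : ℕ => ((n - ∑ u, a n u : ℕ) : ℝ) / n) atTop (𝓝 0) := by
    have h := (tendsto_finsetSum Finset.univ fun u _ => tendsto_floor u).const_sub 1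
    rw [hQ.2, sub_self] at h
    refine h.congr' ?_
    filter_upwards [eventually_ne_atTop 0] with n hn
    rw [Nat.cast_sub (sum_floor_le n), ← Finset.sum_div, sub_div,
      div_self (Nat.cast_ne_zero.2 hn), Nat.cast_sum]
  refine ⟨fun n => a n + Pi.single v₀ (n - ∑ u, a n u), fun n => ?_, fun v => ?_⟩
  · simp only [Pi.add_apply, Finset.sum_add_distrib, Fintype.sum_pi_single',
      Nat.add_sub_cancel' (sum_floor_le n)]
  · rcases eq_or_ne v v₀ with rfl | hv
    · simpa only [Pi.add_apply, Pi.single_eq_same, Nat.cast_add, add_div, add_zero]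
        using (tendsto_floor v).add tendsto_remainder
    · simpa only [Pi.add_apply, Pi.single_eq_of_ne hv, add_zero] using tendsto_floor v

theorem typeFilter_neBot (hQ : Q ∈ stdSimplex ℝ V) : (typeFilter Q).NeBot :=
  let ⟨_, hc, hcQ⟩ := exists_typeSequence hQ
  (tendsto_typeFilter hc hcQ).neBot

theorem eventually_typeFilter_nsmul {p : (V → ℕ) → Prop} (h : ∀ᶠ c in typeFilter Q, p c) :
    ∀ᶠ c in typeFilter Q, ∀ m : ℕ, m ≠ 0 → p (m • c) := by
  obtain ⟨s, hs, t, ht, hst⟩ := eventually_inf.1 h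
  obtain ⟨s', hs', hss⟩ := mem_comap.1 hs
  obtain ⟨N, hN⟩ := mem_atTop_sets.1 hs'
  obtain ⟨t', ht', htt⟩ := mem_comap.1 ht
  filter_upwards [tendsto_sum_typeFilter.eventually (eventually_ge_atTop N),
    tendsto_freq_typeFilter.eventually ht'] with c hcN hct m hm
  refine hst _ ⟨hss (hN _ ?_), htt (show freq (m • c) ∈ t' by rwa [freq_nsmul hm])⟩
  change N ≤ ∑ v, (m • c) v
  rw [sum_nsmul]
  exact hcN.trans (Nat.le_mul_of_pos_left _ (Nat.pos_of_ne_zero hm))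

theorem tendsto_sum_abs_freq_sub :
    Tendsto (fun c => ∑ v, |freq c v - Q v|) (typeFilter Q) (𝓝 0) := by
  have h := tendsto_finsetSum Finset.univ fun v _ =>
    ((tendsto_pi_nhds.1 (tendsto_freq_typeFilter (Q := Q)) v).sub_const (Q v)).abs
  simpa only [sub_self, abs_zero, Finset.sum_const_zero] using h

theorem sum_nsmul_sub_le {c d : V → ℕ} {k : ℕ} (h : k * ∑ v, c v ≤ ∑ v, d v) :
    ((∑ v, (k • c - d) v : ℕ) : ℝ) ≤
      (k * ∑ v, c v : ℕ) * ∑ v, |freq c v - freq d v| := by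
  rw [Nat.cast_sum, Finset.mul_sum]
  refine Finset.sum_le_sum fun v _ => ?_
  have cast_nsmul : ((k * c v : ℕ) : ℝ) = (k * ∑ u, c u : ℕ) * freq c v := by
    rw [Nat.cast_mul, Nat.cast_mul, ← freq_mul_sum c v]
    ring
  have mul_freq_le : (k * ∑ u, c u : ℕ) * freq d v ≤ d v := by
    rw [← freq_mul_sum d v, mul_comm]
    exact mul_le_mul_of_nonneg_left (Nat.cast_le.2 h) (freq_nonneg d v)
  have abs_mul_nonneg : 0 ≤ (k * ∑ u, c u : ℕ) * |freq c v - freq d v| := by positivity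
  rcases le_total (k * c v) (d v) with hle | hle
  · rwa [Pi.sub_apply, Pi.smul_apply, smul_eq_mul, Nat.sub_eq_zero_of_le hle, Nat.cast_zero]
  · rw [Pi.sub_apply, Pi.smul_apply, smul_eq_mul, Nat.cast_sub hle, cast_nsmul]
    calc (k * ∑ u, c u : ℕ) * freq c v - d v
        ≤ (k * ∑ u, c u : ℕ) * (freq c v - freq d v) := by rw [mul_sub]; linarith
      _ ≤ (k * ∑ u, c u : ℕ) * |freq c v - freq d v| := by
        gcongr
        exact le_abs_self _

end Types

theorem choose_le_exp_binEntropy (N k : ℕ) :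
    (N.choose k : ℝ) ≤ Real.exp (N * Real.binEntropy (k / N)) := by
  rcases lt_or_ge N k with hNk | hk
  · rw [Nat.choose_eq_zero_of_lt hNk, Nat.cast_zero]
    exact (Real.exp_pos _).le
  set p : ℝ := k / N with hp
  have hp_nonneg : 0 ≤ p := by positivity
  have hp_le_one : 0 ≤ 1 - p := sub_nonneg.2 (div_le_one_of_le₀ (Nat.cast_le.2 hk) (by positivity))
  have mul_p : N * p = k := by
    rcases N.eq_zero_or_pos with rfl | hN
    · rw [Nat.le_zero.1 hk, Nat.cast_zero, zero_mul]
    · exact mul_div_cancel₀ _ (Nat.cast_ne_zero.2 hN.ne')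
  have mul_one_sub_p : N * (1 - p) = (N - k : ℕ) := by
    rw [mul_one_sub, mul_p, Nat.cast_sub hk]
  have pow_eq_exp {x : ℝ} {n : ℕ} (hx : 0 ≤ x) (hn : N * x = n) :
      x ^ n = Real.exp (n * Real.log x) := by
    rcases hx.eq_or_lt with rfl | hx
    · rw [mul_zero, eq_comm, Nat.cast_eq_zero] at hn
      rw [hn, pow_zero, Nat.cast_zero, zero_mul, Real.exp_zero]
    · rw [Real.exp_nat_mul, Real.exp_log hx]
  have prob_eq : p ^ k * (1 - p) ^ (N - k) = Real.exp (-(N * Real.binEntropy p)) := by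
    rw [pow_eq_exp hp_nonneg mul_p, pow_eq_exp hp_le_one mul_one_sub_p, ← Real.exp_add,
      Real.binEntropy_eq_negMulLog_add_negMulLog_one_sub, Real.negMulLog, Real.negMulLog,
      ← mul_p, ← mul_one_sub_p]
    ring_nf
  -- A single term of the binomial expansion of `(p + (1 - p)) ^ N = 1`.
  have term_le_one : p ^ k * (1 - p) ^ (N - k) * N.choose k ≤ 1 := by
    have h := add_pow p (1 - p) N
    rw [add_sub_cancel, one_pow] at h
    refine le_of_le_of_eq ?_ h.symm
    exact Finset.single_le_sum (f := fun i => p ^ i * (1 - p) ^ (N - i) * (N.choose i : ℝ))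
      (fun i _ => by positivity) (Finset.mem_range.2 (Nat.lt_succ_of_le hk))
  rwa [prob_eq, Real.exp_neg, inv_mul_eq_div, div_le_one (Real.exp_pos _)] at term_le_one

/-- The exponential growth rate of a bound on the number of ways to insert a fraction `x` of letters
from an alphabet of size `A` into a word. -/
noncomputable def insertionRate (A : ℕ) (x : ℝ) : ℝ := x * Real.log A + Real.binEntropy x

theorem insertionRate_zero (A : ℕ) : insertionRate A 0 = 0 := by
  rw [insertionRate, zero_mul, Real.binEntropy_zero, add_zero]

theorem exists_insertionRate_le (A : ℕ) {ε : ℝ} (hε : 0 < ε) :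
    ∃ δ > 0, ∀ x, 0 ≤ x → x ≤ δ → insertionRate A x ≤ ε := by
  have continuous_insertionRate : Continuous (insertionRate A) :=
    (continuous_id.mul continuous_const).add Real.binEntropy_continuous
  obtain ⟨δ, hδ, h⟩ :=
    Metric.continuousAt_iff.1 (continuous_insertionRate.continuousAt (x := 0)) ε hε
  refine ⟨δ / 2, half_pos hδ, fun x hx hxδ => ?_⟩
  have dist_lt : dist x 0 < δ := by
    rw [Real.dist_0_eq_abs, abs_of_nonneg hx]
    exact hxδ.trans_lt (half_lt_self hδ)
  have abs_lt := h dist_lt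
  rw [insertionRate_zero, Real.dist_0_eq_abs] at abs_lt
  exact (le_abs_self _).trans abs_lt.le

/-- The logarithm of the value of a functional on the type graph of `c`. -/
noncomputable def logType (F : GraphClass →* ℝ≥0) (G : FinGraph) (c : G.V → ℕ) : ℝ :=
  Real.log (F (typeGraphClass G c))

/-- The logarithm, normalized by the word length, of the value of a functional on a type graph. -/
noncomputable def typeRate (F : GraphClass →* ℝ≥0) (G : FinGraph) (c : G.V → ℕ) : ℝ :=
  logType F G c / (∑ v, c v : ℕ)

/-- The values on the type graphs with frequencies close to `Q` grow exponentially at the rate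
`L`. -/
def HasLogRate (F : GraphClass →* ℝ≥0) (G : FinGraph) (Q : G.V → ℝ) (L : ℝ) : Prop :=
  Tendsto (typeRate F G) (typeFilter Q) (𝓝 L)

section LogRate

variable {F F' : GraphClass →* ℝ≥0} {G : FinGraph} {Q : G.V → ℝ} {L L' : ℝ}

theorem IsNormalized.map_typeGraphClass_pos (hF : IsNormalized F) (G : FinGraph)
    (c : G.V → ℕ) : (0 : ℝ) < F (typeGraphClass G c) :=
  NNReal.coe_pos.2 (zero_lt_one.trans_le (hF.one_le_map_typeGraphClass G c))

theorem logType_nonneg (hF : IsNormalized F) (c : G.V → ℕ) : 0 ≤ logType F G c :=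
  Real.log_nonneg (NNReal.one_le_coe.2 (hF.one_le_map_typeGraphClass G c))

theorem logType_le (hF : IsNormalized F) (c : G.V → ℕ) :
    logType F G c ≤ (∑ v, c v : ℕ) * Real.log (Fintype.card G.V) := by
  rw [← Real.log_pow]
  exact Real.log_le_log (hF.map_typeGraphClass_pos G c)
    (by exact_mod_cast hF.map_typeGraphClass_le_pow G c)

theorem logType_add_logType_le (hF : IsNormalized F) (c d : G.V → ℕ) :
    logType F G c + logType F G d ≤ logType F G (c + d) := by
  have hc := hF.map_typeGraphClass_pos G c
  have hd := hF.map_typeGraphClass_pos G d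
  rw [logType, logType, ← Real.log_mul hc.ne' hd.ne']
  exact Real.log_le_log (mul_pos hc hd) (by exact_mod_cast hF.map_typeGraphClass_mul_le G c d)

theorem logType_mono (hF : IsNormalized F) : Monotone (logType F G) := fun c d h =>
  calc logType F G c ≤ logType F G c + logType F G (d - c) :=
        le_add_of_nonneg_right (logType_nonneg hF _)
    _ ≤ logType F G (c + (d - c)) := logType_add_logType_le hF _ _
    _ = logType F G d := by rw [add_tsub_cancel_of_le h]

theorem nsmul_logType_le (hF : IsNormalized F) (c : G.V → ℕ) (k : ℕ) :
    k * logType F G c ≤ logType F G (k • c) := by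
  induction k with
  | zero =>
    rw [Nat.cast_zero, zero_mul]
    exact logType_nonneg hF _
  | succ k ih =>
    rw [succ_nsmul, Nat.cast_succ, add_one_mul]
    exact (add_le_add_left ih _).trans (logType_add_logType_le hF _ _)

theorem logType_add_le (hF : IsNormalized F) (c d : G.V → ℕ) :
    logType F G (c + d) ≤ logType F G c + (∑ v, (c + d) v : ℕ) *
      insertionRate (Fintype.card G.V) ((∑ v, d v : ℕ) / (∑ v, (c + d) v : ℕ)) := by
  have hc := hF.map_typeGraphClass_pos G c
  have hd := hF.map_typeGraphClass_pos G d
  have sum_add : ∑ v, (c + d) v = ∑ v, d v + ∑ v, c v :=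
    Finset.sum_add_distrib.trans (add_comm _ _)
  have map_le := hF.mono (typeGraphClass_add_le G d c)
  rw [map_mul, map_mul, hF.map_natCast, add_comm d c, ← sum_add] at map_le
  set N := ∑ v, (c + d) v
  set k := ∑ v, d v
  have map_le_exp : (F (typeGraphClass G (c + d)) : ℝ) ≤
      Real.exp (N * Real.binEntropy (k / N)) *
        (F (typeGraphClass G d) * F (typeGraphClass G c)) :=
    le_trans (by exact_mod_cast map_le)
      (mul_le_mul_of_nonneg_right (choose_le_exp_binEntropy N k) (mul_pos hd hc).le)
  have log_le := Real.log_le_log (hF.map_typeGraphClass_pos G _) map_le_exp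
  rw [Real.log_mul (Real.exp_pos _).ne' (mul_pos hd hc).ne', Real.log_exp,
    Real.log_mul hd.ne' hc.ne'] at log_le
  have mul_div_self : (N : ℝ) * (k / N) = k := by
    rcases eq_or_ne N 0 with hN | hN
    · have hk : k = 0 := by omega
      rw [hN, hk, Nat.cast_zero, zero_mul]
    · exact mul_div_cancel₀ _ (Nat.cast_ne_zero.2 hN)
  have := logType_le hF d
  rw [insertionRate, mul_add, ← mul_assoc, mul_div_self]
  simp only [logType] at *
  linarith

theorem logType_le_add (hF : IsNormalized F) (c d : G.V → ℕ) :
    logType F G c ≤ logType F G d + (∑ v, c v : ℕ) *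
      insertionRate (Fintype.card G.V) ((∑ v, (c - d) v : ℕ) / (∑ v, c v : ℕ)) := by
  have inf_add_sub : c ⊓ d + (c - d) = c :=
    funext fun v => (add_comm _ _).trans tsub_add_min
  have h := logType_add_le hF (c ⊓ d) (c - d)
  rw [inf_add_sub] at h
  exact h.trans (add_le_add_left (logType_mono hF inf_le_right) _)

theorem typeRate_le_add (hF : IsNormalized F) {δ ε : ℝ}
    (hδ : ∀ x, 0 ≤ x → x ≤ δ → insertionRate (Fintype.card G.V) x ≤ ε) {c d : G.V → ℕ}
    (hc : 0 < ∑ v, c v) (hcd : ∑ v, c v ≤ ∑ v, d v)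
    (hfreq : ∑ v, |freq c v - freq d v| ≤ δ) :
    typeRate F G c ≤ typeRate F G d + ε +
      (∑ v, c v : ℕ) / (∑ v, d v : ℕ) * Real.log (Fintype.card G.V) := by
  rw [typeRate, typeRate]
  have sum_sub_le (k : ℕ) := sum_nsmul_sub_le (c := c) (d := d) (k := k)
  have le_logType_nsmul := nsmul_logType_le hF c
  have logType_nsmul_le (k : ℕ) := logType_le_add hF (k • c) d
  have a_le := logType_le hF c
  simp only [sum_nsmul] at logType_nsmul_le
  set m := ∑ v, c v
  set n := ∑ v, d v
  set a := logType F G c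
  set b := logType F G d
  set A := Real.log (Fintype.card G.V)
  set k := n / m
  have hm : (0 : ℝ) < m := Nat.cast_pos.2 hc
  have hn : (0 : ℝ) < n := Nat.cast_pos.2 (hc.trans_le hcd)
  have hk : 0 < k := Nat.div_pos hcd hc
  have km_pos : (0 : ℝ) < (k * m : ℕ) := Nat.cast_pos.2 (Nat.mul_pos hk hc)
  have km_le : k * m ≤ n := Nat.div_mul_le_self n m
  have n_le : (n : ℝ) ≤ (k + 1) * m := by
    exact_mod_cast (Nat.lt_mul_of_div_lt (Nat.lt_succ_self k) hc).le
  have rate_le := hδ _ (by positivity)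
    (((div_le_iff₀' km_pos).2 (sum_sub_le k km_le)).trans hfreq)
  have ε_nonneg : 0 ≤ ε := by
    rw [← insertionRate_zero (Fintype.card G.V)]
    exact hδ 0 le_rfl ((Finset.sum_nonneg fun _ _ => abs_nonneg _).trans hfreq)
  have ka_le : k * a ≤ b + n * ε :=
    calc k * a ≤ b + (k * m : ℕ) * _ := (le_logType_nsmul k).trans (logType_nsmul_le k)
      _ ≤ b + (k * m : ℕ) * ε := by gcongr
      _ ≤ b + n * ε := by gcongr
  calc a / m = n * (a / m) / n := (mul_div_cancel_left₀ _ hn.ne').symm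
    _ ≤ (k + 1) * m * (a / m) / n := by
      gcongr
      exact div_nonneg (logType_nonneg hF c) hm.le
    _ = (k * a + a) / n := by
      rw [mul_assoc, mul_div_cancel₀ _ hm.ne', add_one_mul]
    _ ≤ (b + n * ε + m * A) / n := by gcongr
    _ = b / n + ε + m / n * A := by field_simp

theorem exists_tendsto_of_eventually_sub_lt {α : Type*} {l : Filter α} {x : α → ℝ}
    (h_le : IsBoundedUnder (· ≤ ·) l x) (h_cobdd : IsCoboundedUnder (· ≤ ·) l x)
    (h : ∀ ε > 0, ∀ᶠ a in l, ∀ᶠ b in l, x a - ε < x b) : ∃ L, Tendsto x l (𝓝 L) := by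
  refine ⟨limsup x l,
    tendsto_order.2 ⟨fun y hy => ?_, fun y hy => eventually_lt_of_limsup_lt hy h_le⟩⟩
  obtain ⟨z, hyz, hz⟩ := exists_between hy
  obtain ⟨a, hza, ha⟩ := ((frequently_lt_of_lt_limsup h_cobdd hz).and_eventually
    (h (z - y) (sub_pos.2 hyz))).exists
  filter_upwards [ha] with b hb
  linarith

theorem eventually_typeRate_sub_lt (hF : IsNormalized F) (Q : G.V → ℝ) {ε : ℝ} (hε : 0 < ε) :
    ∀ᶠ c in typeFilter Q, ∀ᶠ d in typeFilter Q, typeRate F G c - ε < typeRate F G d := by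
  obtain ⟨δ, hδ, h⟩ := exists_insertionRate_le (Fintype.card G.V) (half_pos hε)
  have eventually_close : ∀ᶠ c in typeFilter Q, ∑ v, |freq c v - Q v| < δ / 2 :=
    tendsto_sum_abs_freq_sub.eventually (gt_mem_nhds (half_pos hδ))
  filter_upwards [eventually_close, tendsto_sum_typeFilter.eventually (eventually_gt_atTop 0)]
    with c hcδ hc
  have tendsto_zero : Tendsto (fun d : G.V → ℕ =>
      ((∑ v, c v : ℕ) : ℝ) / (∑ v, d v : ℕ) * Real.log (Fintype.card G.V))
      (typeFilter Q) (𝓝 0) := by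
    rw [← zero_mul (Real.log (Fintype.card G.V))]
    exact (((tendsto_natCast_atTop_atTop (R := ℝ)).comp
      tendsto_sum_typeFilter).const_div_atTop _).mul_const _
  filter_upwards [eventually_close,
    tendsto_sum_typeFilter.eventually (eventually_ge_atTop (∑ v, c v)),
    tendsto_zero.eventually (gt_mem_nhds (half_pos hε))] with d hdδ hcd hdε
  have freq_close : ∑ v, |freq c v - freq d v| ≤ δ :=
    calc ∑ v, |freq c v - freq d v|
        ≤ ∑ v, (|freq c v - Q v| + |freq d v - Q v|) :=
          Finset.sum_le_sum fun v _ => by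
            rw [abs_sub_comm (freq d v)]
            exact abs_sub_le _ _ _
      _ ≤ δ := by
          rw [Finset.sum_add_distrib]
          linarith
  have := typeRate_le_add hF h hc hcd freq_close
  linarith

theorem exists_hasLogRate (hF : IsNormalized F) (hQ : Q ∈ stdSimplex ℝ G.V) :
    ∃ L, HasLogRate F G Q L := by
  have := typeFilter_neBot hQ
  have typeRate_nonneg (c : G.V → ℕ) : 0 ≤ typeRate F G c :=
    div_nonneg (logType_nonneg hF c) (Nat.cast_nonneg _)
  have typeRate_le (c : G.V → ℕ) : typeRate F G c ≤ Real.log (Fintype.card G.V) :=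
    div_le_of_le_mul₀ (Nat.cast_nonneg _) (Real.log_natCast_nonneg _)
      ((logType_le hF c).trans_eq (mul_comm _ _))
  exact exists_tendsto_of_eventually_sub_lt (isBoundedUnder_of ⟨_, typeRate_le⟩)
    (isBoundedUnder_of (r := (· ≥ ·)) ⟨0, typeRate_nonneg⟩).isCoboundedUnder_le
    fun _ => eventually_typeRate_sub_lt hF Q

theorem isRefinementValue_of_hasLogRate {f : GraphClass →+* ℝ≥0}
    (hf : f ∈ asymptoticSpectrum GraphClass) (h : HasLogRate (f : GraphClass →* ℝ≥0) G Q L) :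
    IsRefinementValue f G Q (Real.exp L) := by
  intro c hc hcQ
  refine ((Real.continuous_exp.tendsto L).comp (h.comp (tendsto_typeFilter hc hcQ))).congr
    fun n => ?_
  have typeGraphClass_eq : typeGraphClass G (c n) = (typeGraph G n (c n)).toClass := by
    rw [toClass_typeGraph]
    exact (toClass_wordGraph (by rw [Fintype.card_fin, hc])).symm
  have hpos : (0 : ℝ) < f (typeGraphClass G (c n)) :=
    (isNormalized_of_mem hf).map_typeGraphClass_pos G (c n)
  rw [← typeGraphClass_eq, Real.rpow_def_of_pos hpos, mul_one_div]
  simp only [Function.comp_apply, typeRate, hc]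
  rfl

theorem probRefinement_eq_exp {f : GraphClass →+* ℝ≥0}
    (hf : f ∈ asymptoticSpectrum GraphClass) (hQ : Q ∈ stdSimplex ℝ G.V)
    (h : HasLogRate (f : GraphClass →* ℝ≥0) G Q L) : probRefinement f G Q = Real.exp L := by
  have h_exp := isRefinementValue_of_hasLogRate hf h
  have h_prob : IsRefinementValue f G Q (probRefinement f G Q) :=
    Classical.epsilon_spec ⟨_, h_exp⟩
  obtain ⟨c, hc, hcQ⟩ := exists_typeSequence hQ
  exact tendsto_nhds_unique (h_prob c hc hcQ) (h_exp c hc hcQ)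

theorem HasLogRate.geomMean (hF : IsNormalized F) (hF' : IsNormalized F') (a b : ℝ)
    (h : HasLogRate F G Q L) (h' : HasLogRate F' G Q L') :
    HasLogRate (geomMean F F' a b) G Q (a * L + b * L') := by
  refine ((h.const_mul a).add (h'.const_mul b)).congr fun c => ?_
  have hpos := hF.map_typeGraphClass_pos G c
  have hpos' := hF'.map_typeGraphClass_pos G c
  have logType_geomMean : logType (ZeroError.geomMean F F' a b) G c =
      a * logType F G c + b * logType F' G c := by
    rw [logType, logType, logType, ← Real.log_rpow hpos, ← Real.log_rpow hpos',
      ← Real.log_mul (Real.rpow_pos_of_pos hpos a).ne' (Real.rpow_pos_of_pos hpos' b).ne']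
    rfl
  rw [typeRate, typeRate, typeRate, logType_geomMean]
  ring

theorem typeValue_one (F : GraphClass →* ℝ≥0) (G : FinGraph) (c : G.V → ℕ) :
    typeValue F G 1 c = F (typeGraphClass G c) := by
  simp only [typeValue, Pi.one_apply, one_pow, Finset.prod_const_one, mul_one]

theorem map_typeGraphClass_le_value (hF : IsNormalized F) (G : FinGraph) (c : G.V → ℕ) :
    F (typeGraphClass G c) ≤ value F (wordGraph (Fin (∑ v, c v)) G c) 1 := by
  set X := wordGraph (Fin (∑ v, c v)) G c
  have toClass_X : X.toClass = typeGraphClass G c := toClass_wordGraph (Fintype.card_fin _)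
  have X_transitive : X.IsVertexTransitive := isVertexTransitive_wordGraph _ G c
  obtain ⟨x, hx⟩ := exists_wordCount_eq (I := Fin (∑ v, c v)) c (Fintype.card_fin _)
  have : Nonempty X.V := ⟨⟨x, hx⟩⟩
  refine le_of_pow_le_poly_mul_pow (C := Fintype.card X.V + 1) (k := Fintype.card X.V + 1)
    fun m => ?_
  obtain ⟨k, hk, h⟩ := X_transitive.exists_pow_le_typeGraphClass m
  have map_le := hF.mono h
  rw [toClass_X, map_mul, map_pow, hF.map_natCast] at map_le
  refine map_le.trans (mul_le_mul' (coveringBound_le _ m) ?_)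
  rw [← typeValue_one, ← hk]
  exact typeValue_le_value_pow hF 1 k

theorem value_wordGraph_le (hF : IsNormalized F) {c : G.V → ℕ} {K : ℝ≥0}
    (h : ∀ m ≠ 0, F (typeGraphClass G (m • c)) ≤ K ^ ∑ v, (m • c) v) :
    value F (wordGraph (Fin (∑ v, c v)) G c) 1 ≤ K ^ ∑ v, c v := by
  refine value_le fun k => ?_
  rcases eq_or_ne (∑ v, k v) 0 with hk | hk
  · rw [hk, pow_zero, show k = 0 from
      funext fun v => Finset.sum_eq_zero_iff.1 hk v (Finset.mem_univ v), typeValue_zero hF]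
  · rw [typeValue_one, ← pow_mul, mul_comm, ← sum_nsmul]
    exact (hF.mono (typeGraphClass_wordGraph_le (Fintype.card_fin _) k)).trans (h _ hk)

theorem typeRate_le_iff {c : G.V → ℕ} (hpos : (0 : ℝ) < F (typeGraphClass G c))
    (hc : ∑ v, c v ≠ 0) {z : ℝ} :
    typeRate F G c ≤ z ↔ F (typeGraphClass G c) ≤ (Real.exp z).toNNReal ^ ∑ v, c v := by
  rw [typeRate, logType, div_le_iff₀' (Nat.cast_pos.2 (Nat.pos_of_ne_zero hc)),
    Real.log_le_iff_le_exp hpos, Real.exp_nat_mul, ← NNReal.coe_le_coe, NNReal.coe_pow,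
    Real.coe_toNNReal _ (Real.exp_pos z).le]

theorem HasLogRate.of_value (hF : IsNormalized F) (h : HasLogRate F G Q L)
    (hF' : ∀ G : FinGraph, F' G.toClass = value F G 1) : HasLogRate F' G Q L := by
  have map_le (c : G.V → ℕ) : F (typeGraphClass G c) ≤ F' (typeGraphClass G c) :=
    (map_typeGraphClass_le_value hF G c).trans_eq (hF' _).symm
  have hpos' (c : G.V → ℕ) : (0 : ℝ) < F' (typeGraphClass G c) :=
    (hF.map_typeGraphClass_pos G c).trans_le (NNReal.coe_le_coe.2 (map_le c))
  refine tendsto_order.2 ⟨fun y hy => ?_, fun y hy => ?_⟩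
  · filter_upwards [h.eventually (lt_mem_nhds hy)] with c hc
    exact hc.trans_le (div_le_div_of_nonneg_right (Real.log_le_log (hF.map_typeGraphClass_pos G c)
      (NNReal.coe_le_coe.2 (map_le c))) (Nat.cast_nonneg _))
  · obtain ⟨z, hLz, hzy⟩ := exists_between hy
    filter_upwards [eventually_typeFilter_nsmul (h.eventually (gt_mem_nhds hLz)),
      tendsto_sum_typeFilter.eventually (eventually_ne_atTop 0)] with c hlt hc
    refine ((typeRate_le_iff (hpos' c) hc).2 ?_).trans_lt hzy
    rw [typeGraphClass, hF']
    refine value_wordGraph_le hF fun m hm => ?_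
    refine (typeRate_le_iff (hF.map_typeGraphClass_pos G _) ?_).1 (hlt m hm).le
    rw [sum_nsmul]
    exact mul_ne_zero hm hc

end LogRate

/-! ## Graphs with a dimension at each vertex -/

theorem mem_ofGraph {G : FinGraph} {A : Matrix G.V G.V ℂ} :
    A ∈ (ofGraph G).space ↔ ∀ x y, ¬ G.AdjEq x y → A x y = 0 := by
  constructor
  · intro h x y hxy
    induction h using Submodule.span_induction with
    | mem M h =>
      obtain ⟨x', y', h', rfl⟩ := h
      exact Matrix.single_apply_of_ne _ _ _ _ _ (by rintro ⟨rfl, rfl⟩; exact hxy h')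
    | zero => rfl
    | add M N _ _ hM hN => rw [Matrix.add_apply, hM, hN, add_zero]
    | smul c M _ hM => rw [Matrix.smul_apply, hM, smul_zero]
  · intro h
    rw [Matrix.matrix_eq_sum_single A]
    refine Submodule.sum_mem _ fun x _ => Submodule.sum_mem _ fun y _ => ?_
    by_cases hxy : G.AdjEq x y
    · rw [← mul_one (A x y), ← smul_eq_mul, ← Matrix.smul_single]
      exact Submodule.smul_mem _ _ (Submodule.subset_span ⟨x, y, hxy, rfl⟩)
    · rw [h x y hxy, Matrix.single_zero]
      exact Submodule.zero_mem _

theorem single_mem_ofGraph {G : FinGraph} {x y : G.V} (h : G.AdjEq x y) :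
    Matrix.single x y 1 ∈ (ofGraph G).space :=
  Submodule.subset_span ⟨x, y, h, rfl⟩

theorem ofGraph_disjUnion_space (G H : FinGraph) :
    (ofGraph (G.disjUnion H)).space = ((ofGraph G).directSum (ofGraph H)).space := by
  ext A
  constructor
  · intro hA
    rw [mem_ofGraph] at hA
    refine ⟨A.toBlocks₁₁, mem_ofGraph.2 fun x y h => hA _ _ ?_,
      A.toBlocks₂₂, mem_ofGraph.2 fun x y h => hA _ _ ?_, ?_⟩
    · rwa [disjUnion_adjEq, Sum.liftRel_inl_inl]
    · rwa [disjUnion_adjEq, Sum.liftRel_inr_inr]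
    · ext (x | x) (y | y) <;> first | rfl | exact hA _ _ (by simp [disjUnion_adjEq])
  · rintro ⟨A, hA, B, hB, rfl⟩
    rw [mem_ofGraph] at hA hB ⊢
    rintro (x | x) (y | y) h <;> rw [disjUnion_adjEq] at h
    exacts [hA x y (h <| .inl ·), rfl, rfl, hB x y (h <| .inr ·)]

theorem ofGraph_strongProd_space (G H : FinGraph) :
    (ofGraph (G.strongProd H)).space = ((ofGraph G).tensor (ofGraph H)).space := by
  refine le_antisymm (Submodule.span_le.2 ?_) (Submodule.span_le.2 ?_)
  · rintro _ ⟨⟨x, y⟩, ⟨x', y'⟩, h, rfl⟩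
    rw [strongProd_adjEq] at h
    rw [← mul_one (1 : ℂ), ← Matrix.single_kronecker_single]
    exact kron_mem (single_mem_ofGraph h.1) (single_mem_ofGraph h.2)
  · rintro _ ⟨A, hA, B, hB, rfl⟩
    refine mem_ofGraph.2 fun v w h => ?_
    rw [strongProd_adjEq, not_and_or] at h
    rw [Matrix.kroneckerMap_apply]
    rcases h with h | h
    · rw [mem_ofGraph.1 hA _ _ h, zero_mul]
    · rw [mem_ofGraph.1 hB _ _ h, mul_zero]

/-- A graph whose vertices carry positive dimensions that are constant on connected components,
i.e. `⨁ d, G d ⊗ ℂ I_d` where `G d` is the induced subgraph on the vertices of dimension `d`.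
In this form sums and products need no reindexing by the dimension. -/
structure DimGraph : Type 1 where
  graph : FinGraph
  dim : graph.V → ℕ
  dim_pos : ∀ v, 0 < dim v
  dim_eq : ∀ x y, graph.AdjEq x y → dim x = dim y

namespace DimGraph

/-- The operator with the block `m x y • I` at `(x, y)`, for dimensions that agree along the support
of `m`. The bases at `x` and `y` are matched by the values of their indices, which avoids a
cast between `Fin (dim x)` and `Fin (dim y)`. -/
def amplify (W : DimGraph) : Matrix W.graph.V W.graph.V ℂ →ₗ[ℂ]
    Matrix (Σ x, Fin (W.dim x)) (Σ x, Fin (W.dim x)) ℂ where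
  toFun m := Matrix.of fun p q => if p.2.val = q.2.val then m p.1 q.1 else 0
  map_add' m m' := by
    ext p q
    exact ite_add_zero
  map_smul' c m := by
    ext p q
    exact (mul_ite_zero _ _ _).symm

theorem amplify_apply (W : DimGraph) (m : Matrix W.graph.V W.graph.V ℂ)
    (p q : Σ x, Fin (W.dim x)) :
    W.amplify m p q = if p.2.val = q.2.val then m p.1 q.1 else 0 := rfl

theorem amplify_one (W : DimGraph) : W.amplify 1 = 1 := by
  ext ⟨x, a⟩ ⟨y, b⟩
  rw [amplify_apply]
  obtain rfl | h := eq_or_ne x y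
  · simp [Matrix.one_apply, Fin.ext_iff]
  · simp [h]

theorem conjTranspose_amplify (W : DimGraph) (m : Matrix W.graph.V W.graph.V ℂ) :
    (W.amplify m)ᴴ = W.amplify mᴴ := by
  ext p q
  rw [Matrix.conjTranspose_apply, amplify_apply, amplify_apply, Matrix.conjTranspose_apply,
    apply_ite star, star_zero]
  simp only [eq_comm]

/-- The noncommutative graph in which the vertex `x` is replaced with a space of dimension
`dim x`. -/
abbrev toNC (W : DimGraph) : NCGraph where
  ι := Σ x : W.graph.V, Fin (W.dim x)
  space := (ofGraph W.graph).space.map W.amplify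
  one_mem := ⟨1, (ofGraph W.graph).one_mem, W.amplify_one⟩
  star_mem := by
    rintro _ ⟨m, hm, rfl⟩
    exact ⟨mᴴ, (ofGraph W.graph).star_mem m hm, (W.conjTranspose_amplify m).symm⟩

/-- The disjoint union, which realizes the direct sum of noncommutative graphs. -/
abbrev disjUnion (W W' : DimGraph) : DimGraph where
  graph := W.graph.disjUnion W'.graph
  dim := Sum.elim W.dim W'.dim
  dim_pos := by rintro (v | v) <;> [exact W.dim_pos v; exact W'.dim_pos v]
  dim_eq := by
    intro x y h
    rw [disjUnion_adjEq] at h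
    cases h with
    | inl h => exact W.dim_eq _ _ h
    | inr h => exact W'.dim_eq _ _ h

/-- The strong product, which realizes the tensor product of noncommutative graphs. -/
abbrev strongProd (W W' : DimGraph) : DimGraph where
  graph := W.graph.strongProd W'.graph
  dim v := W.dim v.1 * W'.dim v.2
  dim_pos v := Nat.mul_pos (W.dim_pos _) (W'.dim_pos _)
  dim_eq x y h := by
    rw [strongProd_adjEq] at h
    rw [W.dim_eq _ _ h.1, W'.dim_eq _ _ h.2]

/-- The graph `G` with the dimension `d` at each vertex, which stands for `G ⊗ ℂ I_d`. -/
abbrev const (G : FinGraph) (d : ℕ) (hd : 0 < d) : DimGraph :=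
  ⟨G, fun _ => d, fun _ => hd, fun _ _ _ => rfl⟩

theorem toClass_toNC_disjUnion (W W' : DimGraph) :
    (W.disjUnion W').toNC.toClass = W.toNC.toClass + W'.toNC.toClass := by
  let e : (Σ v, Fin ((W.disjUnion W').dim v)) ≃ (Σ x, Fin (W.dim x)) ⊕ (Σ y, Fin (W'.dim y)) :=
    Equiv.sumSigmaDistrib _
  have amplify_fromBlocks (A : Matrix W.graph.V W.graph.V ℂ) (B : Matrix W'.graph.V W'.graph.V ℂ) :
      (W.disjUnion W').amplify (fromBlocks A 0 0 B) =
        (fromBlocks (W.amplify A) 0 0 (W'.amplify B)).submatrix e e := by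
    ext ⟨x | x, a⟩ ⟨y | y, b⟩
    exacts [rfl, ite_self _, ite_self _, rfl]
  refine Quotient.sound (iso_of_equiv (S := (W.disjUnion W').toNC)
    (T := W.toNC.directSum W'.toNC) e ?_ ?_)
  · rintro _ ⟨m, hm, rfl⟩
    rw [SetLike.mem_coe, ofGraph_disjUnion_space] at hm
    obtain ⟨A, hA, B, hB, rfl⟩ := hm
    refine ⟨_, ⟨A, hA, rfl⟩, _, ⟨B, hB, rfl⟩, ?_⟩
    rw [amplify_fromBlocks, Matrix.submatrix_submatrix, e.self_comp_symm, Matrix.submatrix_id_id]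
  · rintro _ ⟨_, ⟨A, hA, rfl⟩, _, ⟨B, hB, rfl⟩, rfl⟩
    refine ⟨fromBlocks A 0 0 B, ?_, amplify_fromBlocks A B⟩
    rw [SetLike.mem_coe, ofGraph_disjUnion_space]
    exact ⟨A, hA, B, hB, rfl⟩

theorem finProdFinEquiv_val_eq_iff {m n m' n' : ℕ} (hm : m = m') (hn : n = n') (a : Fin m)
    (b : Fin n) (a' : Fin m') (b' : Fin n') :
    (finProdFinEquiv (a, b)).val = (finProdFinEquiv (a', b')).val ↔
      a.val = a'.val ∧ b.val = b'.val := by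
  subst hm hn
  rw [← Fin.ext_iff, finProdFinEquiv.injective.eq_iff, Prod.mk.injEq, Fin.ext_iff, Fin.ext_iff]

/-- The basis of the strong product as the product of the bases. -/
def prodEquiv (W W' : DimGraph) :
    (Σ v : W.graph.V × W'.graph.V, Fin (W.dim v.1 * W'.dim v.2)) ≃
      (Σ x : W.graph.V, Fin (W.dim x)) × (Σ y : W'.graph.V, Fin (W'.dim y)) where
  toFun p := (⟨p.1.1, (finProdFinEquiv.symm p.2).1⟩, ⟨p.1.2, (finProdFinEquiv.symm p.2).2⟩)
  invFun p := ⟨(p.1.1, p.2.1), finProdFinEquiv (p.1.2, p.2.2)⟩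
  left_inv p := by
    obtain ⟨v, k⟩ := p
    obtain ⟨k, rfl⟩ := finProdFinEquiv.surjective k
    simp only [Equiv.symm_apply_apply]
  right_inv p := by simp

theorem amplify_kronecker {W W' : DimGraph} {A : Matrix W.graph.V W.graph.V ℂ}
    {B : Matrix W'.graph.V W'.graph.V ℂ} (hA : A ∈ (ofGraph W.graph).space)
    (hB : B ∈ (ofGraph W'.graph).space) :
    ((W.strongProd W').amplify (A ⊗ₖ B)).submatrix (prodEquiv W W').symm (prodEquiv W W').symm =
      W.amplify A ⊗ₖ W'.amplify B := by
  ext ⟨⟨x, a⟩, ⟨y, b⟩⟩ ⟨⟨x', a'⟩, ⟨y', b'⟩⟩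
  change (if (finProdFinEquiv (a, b)).val = (finProdFinEquiv (a', b')).val
    then A x x' * B y y' else 0) =
      (if a.val = a'.val then A x x' else 0) * (if b.val = b'.val then B y y' else 0)
  by_cases hx : W.graph.AdjEq x x'
  · by_cases hy : W'.graph.AdjEq y y'
    · simp only [finProdFinEquiv_val_eq_iff (W.dim_eq _ _ hx) (W'.dim_eq _ _ hy),
        ite_zero_mul_ite_zero]
    · simp only [mem_ofGraph.1 hB _ _ hy, mul_zero, ite_self]
  · simp only [mem_ofGraph.1 hA _ _ hx, zero_mul, ite_self]

theorem toClass_toNC_strongProd (W W' : DimGraph) :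
    (W.strongProd W').toNC.toClass = W.toNC.toClass * W'.toNC.toClass := by
  refine Quotient.sound (iso_of_equiv (S := (W.strongProd W').toNC)
    (T := W.toNC.tensor W'.toNC) (prodEquiv W W') ?_ ?_)
  · rintro _ ⟨m, hm, rfl⟩
    rw [SetLike.mem_coe, ofGraph_strongProd_space] at hm
    refine tensor_mem (S := ofGraph W.graph) (T := ofGraph W'.graph)
      ((submatrixL (prodEquiv W W').symm).comp (W.strongProd W').amplify) (fun A hA B hB => ?_) m hm
    change ((W.strongProd W').amplify (A ⊗ₖ B)).submatrix _ _ ∈ _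
    rw [amplify_kronecker hA hB]
    exact kron_mem (S := W.toNC) (T := W'.toNC) ⟨A, hA, rfl⟩ ⟨B, hB, rfl⟩
  · refine tensor_mem (S := W.toNC) (T := W'.toNC) (submatrixL (prodEquiv W W')) ?_
    rintro _ ⟨A, hA, rfl⟩ _ ⟨B, hB, rfl⟩
    refine ⟨A ⊗ₖ B, ?_, ?_⟩
    · rw [SetLike.mem_coe, ofGraph_strongProd_space]
      exact kron_mem (S := ofGraph W.graph) (T := ofGraph W'.graph) hA hB
    · rw [← amplify_kronecker hA hB]
      change _ = (Matrix.submatrix _ _ _).submatrix _ _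
      rw [Matrix.submatrix_submatrix, Equiv.symm_comp_self, Matrix.submatrix_id_id]

theorem toClass_toNC_const_one (G : FinGraph) :
    (const G 1 one_pos).toNC.toClass = NCClass.ofGraphClass G.toClass := by
  let e := Equiv.sigmaUnique G.V fun _ => Fin 1
  have amplify_eq (A : Matrix G.V G.V ℂ) :
      (const G 1 one_pos).amplify A = A.submatrix e e := by
    ext ⟨x, a⟩ ⟨y, b⟩
    exact if_pos (congrArg Fin.val (Subsingleton.elim a b))
  refine Quotient.sound (iso_of_equiv (S := (const G 1 one_pos).toNC) (T := ofGraph G) e ?_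
    fun B hB => ⟨B, hB, amplify_eq B⟩)
  rintro _ ⟨A, hA, rfl⟩
  rwa [amplify_eq, Matrix.submatrix_submatrix, e.self_comp_symm, Matrix.submatrix_id_id]

theorem toClass_toNC_const_point (d : ℕ) (hd : 0 < d) :
    (const FinGraph.point d hd).toNC.toClass = (idealQuantum d).toClass := by
  let e := Equiv.uniqueSigma fun _ : PUnit => Fin d
  have amplify_eq (A : Matrix PUnit PUnit ℂ) : (const FinGraph.point d hd).amplify A =
      (A PUnit.unit PUnit.unit • (1 : Matrix (Fin d) (Fin d) ℂ)).submatrix e e := by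
    ext ⟨x, a⟩ ⟨y, b⟩
    change (if a.val = b.val then A x y else 0) = A _ _ * (1 : Matrix (Fin d) (Fin d) ℂ) a b
    rw [Matrix.one_apply, mul_ite, mul_one, mul_zero]
    simp only [Fin.ext_iff]
  refine Quotient.sound (iso_of_equiv (S := (const FinGraph.point d hd).toNC)
    (T := idealQuantum d) e ?_ ?_)
  · rintro _ ⟨A, -, rfl⟩
    rw [amplify_eq, Matrix.submatrix_submatrix, e.self_comp_symm, Matrix.submatrix_id_id]
    exact Submodule.smul_mem _ _ (idealQuantum d).one_mem
  · intro B hB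
    obtain ⟨c, rfl⟩ := Submodule.mem_span_singleton.1 hB
    exact ⟨fun _ _ => c, mem_ofGraph.2 fun x y h => absurd (Or.inl rfl) h, amplify_eq _⟩

end DimGraph

theorem NCGraph.toClass_eq_of_isEmpty {S T : NCGraph} [IsEmpty S.ι] [IsEmpty T.ι] :
    S.toClass = T.toClass := by
  refine Quotient.sound (iso_of_equiv (Equiv.equivOfIsEmpty S.ι T.ι) (fun A _ => ?_) fun B _ => ?_)
  all_goals
    convert Submodule.zero_mem _
    exact Subsingleton.elim _ _

theorem NCGraph.toClass_scalars_congr {ι κ : Type} [Fintype ι] [DecidableEq ι] [Fintype κ]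
    [DecidableEq κ] (e : ι ≃ κ) : (scalars ι).toClass = (scalars κ).toClass := by
  refine Quotient.sound (iso_of_equiv (S := scalars ι) (T := scalars κ) e ?_ ?_) <;>
  · intro A hA
    obtain ⟨c, rfl⟩ := Submodule.mem_span_singleton.1 hA
    exact Submodule.mem_span_singleton.2 ⟨c, congrArg (c • ·) (Matrix.submatrix_one_equiv _).symm⟩

theorem exists_dimGraph (a : algA) : ∃ W : DimGraph, W.toNC.toClass = a.1 := by
  obtain ⟨a, ha⟩ := a
  have exists_of_isEmpty (S : NCGraph) [IsEmpty S.ι] : ∃ W : DimGraph, W.toNC.toClass = S.toClass :=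
    have : IsEmpty (DimGraph.const FinGraph.empty 1 one_pos).toNC.ι := ⟨fun p => p.1.elim⟩
    ⟨DimGraph.const FinGraph.empty 1 one_pos, NCGraph.toClass_eq_of_isEmpty⟩
  change ∃ W : DimGraph, W.toNC.toClass = a
  induction ha using Subsemiring.closure_induction with
  | mem a ha =>
    rcases ha with ⟨X, rfl⟩ | ⟨d, rfl⟩
    · induction X using Quotient.inductionOn with
      | h G => exact ⟨DimGraph.const G 1 one_pos, DimGraph.toClass_toNC_const_one G⟩
    · obtain rfl | hd := Nat.eq_zero_or_pos d
      · exact exists_of_isEmpty (idealQuantum 0)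
      · exact ⟨DimGraph.const FinGraph.point d hd, DimGraph.toClass_toNC_const_point d hd⟩
  | zero => exact exists_of_isEmpty NCGraph.zero
  | one => exact ⟨DimGraph.const FinGraph.point 1 one_pos,
      (DimGraph.toClass_toNC_const_point 1 one_pos).trans
        (NCGraph.toClass_scalars_congr (Equiv.ofUnique (Fin 1) PUnit))⟩
  | add a b _ _ ha hb =>
    obtain ⟨W, rfl⟩ := ha
    obtain ⟨W', rfl⟩ := hb
    exact ⟨W.disjUnion W', DimGraph.toClass_toNC_disjUnion W W'⟩
  | mul a b _ _ ha hb =>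
    obtain ⟨W, rfl⟩ := ha
    obtain ⟨W', rfl⟩ := hb
    exact ⟨W.strongProd W', DimGraph.toClass_toNC_strongProd W W'⟩

/-! ## Cohomomorphisms between graphs with dimensions -/

theorem NCGraph.cohomLE_of_fintype {S T : NCGraph} {K : Type} [Fintype K]
    (E : K → Matrix S.ι T.ι ℂ) (hE : ∑ i, (E i)ᴴ * E i = 1)
    (hS : ∀ i j, ∀ A ∈ S.space, (E i)ᴴ * A * E j ∈ T.space) : T.CohomLE S :=
  ⟨Fintype.card K, fun i => E ((Fintype.equivFin K).symm i), by
    rw [Equiv.sum_comp (Fintype.equivFin K).symm fun i => (E i)ᴴ * E i, hE], fun _ _ => hS _ _⟩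

theorem NCGraph.cohomLE_tensor_of_isometries {G G' : FinGraph} {S S' : NCGraph} (φ : G.V → G'.V)
    (v : G.V → Matrix S'.ι S.ι ℂ) (hv : ∀ x, (v x)ᴴ * v x = 1)
    (hφ : ∀ x y, G'.AdjEq (φ x) (φ y) → ∀ B ∈ S'.space,
      (v x)ᴴ * B * v y ∈ S.space ∧ (¬ G.AdjEq x y → (v x)ᴴ * B * v y = 0)) :
    ((ofGraph G).tensor S).CohomLE ((ofGraph G').tensor S') := by
  let E (x : G.V) : Matrix (G'.V × S'.ι) (G.V × S.ι) ℂ := Matrix.single (φ x) x 1 ⊗ₖ v x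
  have sandwich_kronecker (x y : G.V) (A : Matrix G'.V G'.V ℂ) (B : Matrix S'.ι S'.ι ℂ) :
      (E x)ᴴ * (A ⊗ₖ B) * E y = Matrix.single x y (A (φ x) (φ y)) ⊗ₖ ((v x)ᴴ * B * v y) := by
    rw [conjTranspose_kronecker, conjTranspose_single, star_one, ← mul_kronecker_mul,
      ← mul_kronecker_mul, Matrix.single_mul_mul_single, one_mul, mul_one]
  refine cohomLE_of_fintype (S := (ofGraph G').tensor S') (T := (ofGraph G).tensor S) E ?_ ?_
  · have (x : G.V) : (E x)ᴴ * E x = Matrix.single x x 1 ⊗ₖ (1 : Matrix S.ι S.ι ℂ) := by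
      rw [← hv x, conjTranspose_kronecker, conjTranspose_single, star_one, ← mul_kronecker_mul,
        Matrix.single_mul_single_same, one_mul]
    simp only [this]
    ext ⟨x, a⟩ ⟨y, b⟩
    rw [Matrix.sum_apply, Finset.sum_eq_single x]
    · simp [Matrix.single_apply, Matrix.one_apply, ← ite_and, and_comm]
    · intro z _ hz
      simp [hz]
    · simp
  · intro x y
    refine tensor_mem (S := ofGraph G') (T := S') (P := ((ofGraph G).tensor S).space)
      (sandwich (E x)ᴴ (E y)) fun A hA B hB => ?_
    change (E x)ᴴ * (A ⊗ₖ B) * E y ∈ _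
    rw [sandwich_kronecker]
    by_cases hxy' : G'.AdjEq (φ x) (φ y)
    · obtain ⟨hB_mem, hB_zero⟩ := hφ x y hxy' B hB
      by_cases hxy : G.AdjEq x y
      · rw [← mul_one (A (φ x) (φ y)), ← smul_eq_mul, ← Matrix.smul_single]
        exact kron_mem (Submodule.smul_mem _ _ (single_mem_ofGraph hxy)) hB_mem
      · rw [hB_zero hxy, kronecker_zero]
        exact Submodule.zero_mem _
    · rw [mem_ofGraph.1 hA _ _ hxy', Matrix.single_zero, zero_kronecker]
      exact Submodule.zero_mem _

section HasGram

/-- `v* w = m • I` for the upper left corners of `v` and `w` with the sizes `d' × d₁` and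
`d' × d₂`. Matrices over `ℕ` stand for the blocks of operators, so that blocks between
propositionally equal dimensions are matrices of the same type. -/
def HasGram (d' d₁ d₂ : ℕ) (v w : Matrix ℕ ℕ ℂ) (m : ℂ) : Prop :=
  ∀ a < d₁, ∀ b < d₂, ∑ k ∈ Finset.range d', star (v k a) * w k b = if a = b then m else 0

variable {d' d₁ d₂ : ℕ} {v w : Matrix ℕ ℕ ℂ} {m : ℂ}

theorem HasGram.smul (h : HasGram d' d₁ d₂ v w m) (s t : ℂ) :
    HasGram d' d₁ d₂ (s • v) (t • w) (star s * t * m) := by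
  intro a ha b hb
  rw [← mul_ite_zero, ← h a ha b hb, Finset.mul_sum]
  refine Finset.sum_congr rfl fun k _ => ?_
  rw [Matrix.smul_apply, Matrix.smul_apply, smul_eq_mul, smul_eq_mul, star_mul']
  ring

theorem HasGram.exists_normalization (h : HasGram d' d₁ d₁ v v m) (hd : 0 < d₁) {k : ℕ}
    (hk : k < d') (hv : v k 0 ≠ 0) : ∃ s : ℂ, HasGram d' d₁ d₁ (s • v) (s • v) 1 := by
  set r : ℝ := ∑ k ∈ Finset.range d', ‖v k 0‖ ^ 2
  have hr : 0 < r := Finset.sum_pos' (fun _ _ => sq_nonneg _)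
    ⟨k, Finset.mem_range.2 hk, pow_pos (norm_pos_iff.2 hv) 2⟩
  have hm : m = r := by
    rw [← if_pos (c := (0 : ℕ) = 0) (t := m) (e := 0) rfl, ← h 0 hd 0 hd, Complex.ofReal_sum]
    exact Finset.sum_congr rfl fun k _ => (Complex.conj_mul' _).trans (Complex.ofReal_pow _ _).symm
  refine ⟨((√r)⁻¹ : ℝ), ?_⟩
  convert h.smul _ _
  rw [hm, Complex.star_def, Complex.conj_ofReal, ← Complex.ofReal_mul, ← Complex.ofReal_mul,
    ← mul_inv, Real.mul_self_sqrt hr.le, inv_mul_cancel₀ hr.ne', Complex.ofReal_one]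

end HasGram

section Blocks

variable {W W' : DimGraph}

/-- The block of an operator from the space at `x` to the space at `y`, extended by zero to a
matrix over `ℕ`. -/
def natBlock (E : Matrix W'.toNC.ι W.toNC.ι ℂ) (y : W'.graph.V) (x : W.graph.V) :
    Matrix ℕ ℕ ℂ :=
  Matrix.of fun k a => if h : k < W'.dim y ∧ a < W.dim x then E ⟨y, k, h.1⟩ ⟨x, a, h.2⟩ else 0

theorem natBlock_val (E : Matrix W'.toNC.ι W.toNC.ι ℂ) (p : W'.toNC.ι) (q : W.toNC.ι) :
    natBlock E p.1 q.1 p.2 q.2 = E p q :=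
  dif_pos ⟨p.2.2, q.2.2⟩

theorem conjTranspose_mul_amplify_single (E : Matrix W'.toNC.ι W.toNC.ι ℂ) {y y' : W'.graph.V}
    (hy : W'.dim y = W'.dim y') (p : W.toNC.ι) (k : Fin (W'.dim y')) :
    (Eᴴ * W'.amplify (Matrix.single y y' 1)) p ⟨y', k⟩ = star (natBlock E y p.1 k p.2) := by
  have hk : k.val < W'.dim y := k.2.trans_eq hy.symm
  rw [Matrix.mul_apply, Finset.sum_eq_single ⟨y, k, hk⟩]
  · rw [Matrix.conjTranspose_apply, DimGraph.amplify_apply, if_pos rfl, Matrix.single_apply_same,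
      mul_one]
    exact congrArg star (natBlock_val E ⟨y, k, hk⟩ p).symm
  · rintro ⟨z, l⟩ - hz
    rw [DimGraph.amplify_apply]
    split_ifs with hl
    · have hzy : y ≠ z := by
        rintro rfl
        exact hz (congrArg (Sigma.mk y) (Fin.ext hl))
      rw [Matrix.single_apply_of_row_ne hzy, mul_zero]
    · rw [mul_zero]
  · simp

theorem conjTranspose_mul_amplify_single_mul (E E' : Matrix W'.toNC.ι W.toNC.ι ℂ)
    {y y' : W'.graph.V} (hy : W'.dim y = W'.dim y') (p q : W.toNC.ι) :
    (Eᴴ * W'.amplify (Matrix.single y y' 1) * E') p q = ∑ k ∈ Finset.range (W'.dim y),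
      star (natBlock E y p.1 k p.2) * natBlock E' y' q.1 k q.2 := by
  rw [Matrix.mul_apply, Fintype.sum_sigma, Finset.sum_eq_single y', hy, Finset.sum_range]
  · refine Finset.sum_congr rfl fun k _ => ?_
    rw [conjTranspose_mul_amplify_single E hy]
    exact congrArg _ (natBlock_val E' ⟨y', k⟩ q).symm
  · intro z _ hz
    refine Finset.sum_eq_zero fun k _ => ?_
    rw [Matrix.mul_apply, Finset.sum_eq_zero, zero_mul]
    intro s _
    rw [DimGraph.amplify_apply, Matrix.single_apply_of_col_ne _ _ hz.symm, ite_self, mul_zero]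
  · simp

theorem exists_hasGram_natBlock {E E' : Matrix W'.toNC.ι W.toNC.ι ℂ}
    (hE : ∀ A ∈ W'.toNC.space, Eᴴ * A * E' ∈ W.toNC.space) {y y' : W'.graph.V}
    (hy : W'.graph.AdjEq y y') (x x' : W.graph.V) :
    ∃ m : ℂ, (¬ W.graph.AdjEq x x' → m = 0) ∧
      HasGram (W'.dim y) (W.dim x) (W.dim x') (natBlock E y x) (natBlock E' y' x') m := by
  obtain ⟨m, hm, hEm⟩ := hE _ ⟨_, single_mem_ofGraph hy, rfl⟩
  refine ⟨m x x', mem_ofGraph.1 hm x x', fun a ha b hb => ?_⟩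
  exact (conjTranspose_mul_amplify_single_mul E E' (W'.dim_eq _ _ hy) ⟨x, a, ha⟩
    ⟨x', b, hb⟩).symm.trans (congrFun (congrFun hEm.symm _) _)

theorem exists_natBlock_ne_zero {K : Type*} [Fintype K] {E : K → Matrix W'.toNC.ι W.toNC.ι ℂ}
    (hE : ∑ i, (E i)ᴴ * E i = 1) (x : W.graph.V) :
    ∃ i y, ∃ k < W'.dim y, natBlock (E i) y x k 0 ≠ 0 := by
  by_contra! h
  let p : W.toNC.ι := ⟨x, 0, W.dim_pos x⟩
  refine zero_ne_one (α := ℂ) ?_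
  calc (0 : ℂ) = (∑ i, (E i)ᴴ * E i) p p := by
        simp only [Matrix.sum_apply, Matrix.mul_apply]
        refine (Finset.sum_eq_zero fun i _ => Finset.sum_eq_zero fun q _ => ?_).symm
        rw [← natBlock_val (E i), h i q.1 q.2 q.2.2, mul_zero]
    _ = 1 := by rw [hE, Matrix.one_apply_eq]

theorem exists_isometries (h : W.toNC.CohomLE W'.toNC) :
    ∃ (φ : W.graph.V → W'.graph.V) (v : W.graph.V → Matrix ℕ ℕ ℂ),
      (∀ x, HasGram (W'.dim (φ x)) (W.dim x) (W.dim x) (v x) (v x) 1) ∧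
      ∀ x y, W'.graph.AdjEq (φ x) (φ y) → ∃ m : ℂ, (¬ W.graph.AdjEq x y → m = 0) ∧
        HasGram (W'.dim (φ x)) (W.dim x) (W.dim y) (v x) (v y) m := by
  obtain ⟨n, E, hE, hES⟩ := h
  choose i φ k hk hne using exists_natBlock_ne_zero hE
  have hgram (x y) (hxy : W'.graph.AdjEq (φ x) (φ y)) :=
    exists_hasGram_natBlock (hES (i x) (i y)) hxy x y
  have hnorm (x) : ∃ s : ℂ, HasGram (W'.dim (φ x)) (W.dim x) (W.dim x)
      (s • natBlock (E (i x)) (φ x) x) (s • natBlock (E (i x)) (φ x) x) 1 :=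
    let ⟨_, _, hm⟩ := hgram x x (AdjEq.refl _)
    hm.exists_normalization (W.dim_pos x) (hk x) (hne x)
  choose s hs using hnorm
  refine ⟨φ, fun x => s x • natBlock (E (i x)) (φ x) x, hs, fun x y hxy => ?_⟩
  obtain ⟨m, hm_zero, hm⟩ := hgram x y hxy
  exact ⟨_, fun h => by rw [hm_zero h, mul_zero], hm.smul (s x) (s y)⟩

end Blocks

section TensorMatrix

variable {I : Type} [Fintype I]

/-- The coordinates of the elements of `Fin D` for `D = ∏ i, δ i`, under an enumeration of the
vectors `a` with `a i < δ i`. The value of `D` is a parameter so that all dimension vectors with the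
same product enumerate the same type. -/
noncomputable def digitsEquiv [DecidableEq I] {δ : I → ℕ} {D : ℕ} (h : ∏ i, δ i = D) :
    Fin D ≃ ∀ i, Fin (δ i) :=
  Fintype.equivOfCardEq (by simp [h])

variable [DecidableEq I] {δ δ₁ δ₂ δ₁' δ₂' : I → ℕ} {D D' : ℕ}

theorem sum_prod_digitsEquiv (h : ∏ i, δ i = D) (g : I → ℕ → ℂ) :
    ∑ A : Fin D, ∏ i, g i (digitsEquiv h A i) = ∏ i, ∑ k ∈ Finset.range (δ i), g i k := by
  rw [(digitsEquiv h).sum_comp fun a => ∏ i, g i (a i)]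
  simp only [Finset.sum_range]
  rw [Finset.prod_univ_sum, Fintype.piFinset_univ]

/-- The tensor product of the upper left corners of the matrices `v i` with the sizes
`δ' i × δ i`. -/
noncomputable def tensorMatrix {δ' : I → ℕ} (h' : ∏ i, δ' i = D') (h : ∏ i, δ i = D)
    (v : I → Matrix ℕ ℕ ℂ) : Matrix (Fin D') (Fin D) ℂ :=
  Matrix.of fun B A => ∏ i, v i (digitsEquiv h' B i) (digitsEquiv h A i)

theorem prod_ite_digitsEquiv (h₁ : ∏ i, δ₁ i = D) (h₂ : ∏ i, δ₂ i = D) {m : I → ℂ}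
    (hm : ∀ i, δ₁ i ≠ δ₂ i → m i = 0) (A B : Fin D) :
    (∏ i, if (digitsEquiv h₁ A i : ℕ) = digitsEquiv h₂ B i then m i else 0) =
      if A = B then ∏ i, m i else 0 := by
  by_cases hδ : ∃ i, δ₁ i ≠ δ₂ i
  · obtain ⟨i, hi⟩ := hδ
    rw [Finset.prod_eq_zero (Finset.mem_univ i) (by rw [hm i hi, ite_self]),
      Finset.prod_eq_zero (Finset.mem_univ i) (hm i hi), ite_self]
  · push Not at hδ
    obtain rfl := funext hδ
    obtain rfl | hAB := eq_or_ne A B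
    · simp only [if_true]
    · obtain ⟨i, hi⟩ := Function.ne_iff.1 ((digitsEquiv h₁).injective.ne hAB)
      rw [if_neg hAB]
      exact Finset.prod_eq_zero (Finset.mem_univ i) (if_neg fun h => hi (Fin.ext h))

theorem conjTranspose_tensorMatrix_mul {v w : I → Matrix ℕ ℕ ℂ} {m : I → ℂ}
    (h₁' : ∏ i, δ₁' i = D') (h₂' : ∏ i, δ₂' i = D') (h₁ : ∏ i, δ₁ i = D) (h₂ : ∏ i, δ₂ i = D)
    (hδ' : δ₁' = δ₂') (hm : ∀ i, δ₁ i ≠ δ₂ i → m i = 0)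
    (hvw : ∀ i, HasGram (δ₁' i) (δ₁ i) (δ₂ i) (v i) (w i) (m i)) :
    (tensorMatrix h₁' h₁ v)ᴴ * tensorMatrix h₂' h₂ w = (∏ i, m i) • 1 := by
  subst hδ'
  ext A B
  calc ((tensorMatrix h₁' h₁ v)ᴴ * tensorMatrix h₂' h₂ w) A B
      = ∑ C, ∏ i, star (v i (digitsEquiv h₁' C i) (digitsEquiv h₁ A i)) *
          w i (digitsEquiv h₁' C i) (digitsEquiv h₂ B i) := by
        rw [Matrix.mul_apply]
        simp only [Matrix.conjTranspose_apply, tensorMatrix, Matrix.of_apply, star_prod,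
          Finset.prod_mul_distrib]
    _ = ∏ i, ∑ k ∈ Finset.range (δ₁' i),
          star (v i k (digitsEquiv h₁ A i)) * w i k (digitsEquiv h₂ B i) :=
        sum_prod_digitsEquiv h₁' fun i k =>
          star (v i k (digitsEquiv h₁ A i)) * w i k (digitsEquiv h₂ B i)
    _ = ∏ i, if (digitsEquiv h₁ A i : ℕ) = digitsEquiv h₂ B i then m i else 0 :=
        Finset.prod_congr rfl fun i _ =>
          hvw i _ (digitsEquiv h₁ A i).2 _ (digitsEquiv h₂ B i).2
    _ = ((∏ i, m i) • (1 : Matrix (Fin D) (Fin D) ℂ)) A B := by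
        rw [prod_ite_digitsEquiv h₁ h₂ hm, Matrix.smul_apply, Matrix.one_apply, smul_eq_mul,
          mul_ite, mul_one, mul_zero]

end TensorMatrix

theorem exists_map_typeGraphClass {W W' : DimGraph} (h : W.toNC.CohomLE W'.toNC) :
    ∃ φ : W.graph.V → W'.graph.V, ∀ c : W.graph.V → ℕ,
      NCClass.ofGraphClass (typeGraphClass W.graph c) *
          (idealQuantum (∏ v, W.dim v ^ c v)).toClass ≤
        NCClass.ofGraphClass (typeGraphClass W'.graph (pushCount φ c)) *
          (idealQuantum (∏ v, W'.dim v ^ pushCount φ c v)).toClass := by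
  obtain ⟨φ, v, hv, hφ⟩ := exists_isometries h
  refine ⟨φ, fun c => ?_⟩
  rw [← toClass_wordGraph (I := Fin (∑ v, c v)) (c := pushCount φ c)
    (by rw [sum_pushCount, Fintype.card_fin])]
  set I := Fin (∑ v, c v)
  let Φ (x : (wordGraph I W.graph c).V) : (wordGraph I W'.graph (pushCount φ c)).V :=
    ⟨φ ∘ x.1, by rw [wordCount_comp, x.2]⟩
  have hd (x : (wordGraph I W.graph c).V) : ∏ i, W.dim (x.1 i) = ∏ v, W.dim v ^ c v := by
    rw [← prod_pow_wordCount, x.2]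
  have hd' (x : (wordGraph I W'.graph (pushCount φ c)).V) :
      ∏ i, W'.dim (x.1 i) = ∏ v, W'.dim v ^ pushCount φ c v := by
    rw [← prod_pow_wordCount, x.2]
  refine cohomLE_tensor_of_isometries Φ
    (fun x => tensorMatrix (hd' (Φ x)) (hd x) fun i => v (x.1 i)) (fun x => ?_)
    fun x y hxy B hB => ?_
  · rw [conjTranspose_tensorMatrix_mul (m := 1) _ _ _ _ rfl (fun i h => absurd rfl h)
      fun i => hv (x.1 i)]
    simp only [Pi.one_apply, Finset.prod_const_one, one_smul]
  · rw [wordGraph_adjEq] at hxy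
    obtain ⟨r, rfl⟩ := Submodule.mem_span_singleton.1 hB
    choose m hm_zero hm using fun i => hφ _ _ (hxy i)
    rw [Matrix.mul_smul, Matrix.mul_one, Matrix.smul_mul, conjTranspose_tensorMatrix_mul _ _ _ _
      (funext fun i => W'.dim_eq _ _ (hxy i))
      (fun i hi => hm_zero i fun hadj => hi (W.dim_eq _ _ hadj)) hm]
    refine ⟨Submodule.smul_mem _ _ (Submodule.smul_mem _ _ (idealQuantum _).one_mem), fun hn => ?_⟩
    rw [wordGraph_adjEq, not_forall] at hn
    obtain ⟨i, hi⟩ := hn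
    rw [Finset.prod_eq_zero (Finset.mem_univ i) (hm_zero i hi), zero_smul, smul_zero]

/-! ## Admissible pairs and their geometric means -/

theorem graphA_empty : graphA FinGraph.empty = 0 :=
  Subtype.ext (NCGraph.toClass_eq_of_isEmpty (S := ofGraph FinGraph.empty) (T := NCGraph.zero))

theorem IsFAlpha.apply_graphA_mul_quantumA {f : GraphClass →+* ℝ≥0} {α : ℝ} {φ : algA →+* ℝ≥0}
    (h : IsFAlpha f α φ) (G : FinGraph) {d : ℕ} (hd : 0 < d) :
    φ (graphA G * quantumA d) = f G.toClass * (d : ℝ≥0) ^ α := by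
  obtain ⟨k, rfl⟩ := Nat.exists_eq_succ_of_ne_zero hd.ne'
  have sum_eq := h (k + 1) fun i => if i = Fin.last k then G else FinGraph.empty
  have map_empty : f FinGraph.empty.toClass = 0 := map_zero f
  rw [familyA, Finset.sum_eq_single (Fin.last k), Finset.sum_eq_single (Fin.last k)] at sum_eq
  · simpa using sum_eq
  · intro i _ hi
    rw [if_neg hi, map_empty, zero_mul]
  · simp
  · intro i _ hi
    rw [if_neg hi, graphA_empty, zero_mul]
  · simp

theorem IsAdmissible.mul_rpow_le {f : GraphClass →+* ℝ≥0} {α : ℝ} (h : IsAdmissible f α)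
    {G G' : FinGraph} {d d' : ℕ} (hd : 0 < d) (hd' : 0 < d')
    (hle : NCClass.ofGraphClass G.toClass * (idealQuantum d).toClass ≤
      NCClass.ofGraphClass G'.toClass * (idealQuantum d').toClass) :
    f G.toClass * (d : ℝ≥0) ^ α ≤ f G'.toClass * (d' : ℝ≥0) ^ α := by
  obtain ⟨-, φ, hφ, hfα⟩ := h
  rw [← hfα.apply_graphA_mul_quantumA G hd, ← hfα.apply_graphA_mul_quantumA G' hd']
  exact hφ hle

namespace DimGraph

/-- The vertex weights `dim v ^ γ`, by which the exponent `γ` enters the value of a graph with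
dimensions. -/
noncomputable def weight (W : DimGraph) (γ : ℝ) (v : W.graph.V) : ℝ≥0 :=
  (W.dim v : ℝ≥0) ^ γ

theorem one_le_weight (W : DimGraph) {γ : ℝ} (hγ : 0 ≤ γ) (v : W.graph.V) : 1 ≤ W.weight γ v :=
  NNReal.one_le_rpow (by exact_mod_cast W.dim_pos v) hγ

theorem prod_weight_pow (W : DimGraph) (γ : ℝ) (c : W.graph.V → ℕ) :
    ∏ v, W.weight γ v ^ c v = ((∏ v, W.dim v ^ c v : ℕ) : ℝ≥0) ^ γ := by
  push_cast
  rw [← NNReal.finsetProd_rpow]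
  refine Finset.prod_congr rfl fun v _ => ?_
  rw [weight, ← NNReal.rpow_mul_natCast, ← NNReal.rpow_natCast_mul, mul_comm]

theorem prod_dim_pow_pos (W : DimGraph) (c : W.graph.V → ℕ) : 0 < ∏ v, W.dim v ^ c v :=
  Finset.prod_pos fun v _ => pow_pos (W.dim_pos v) _

theorem weight_disjUnion (W W' : DimGraph) (γ : ℝ) :
    (W.disjUnion W').weight γ = Sum.elim (W.weight γ) (W'.weight γ) :=
  (Sum.elim_comp_inl_inr _).symm

theorem weight_strongProd (W W' : DimGraph) (γ : ℝ) :
    (W.strongProd W').weight γ = fun v => W.weight γ v.1 * W'.weight γ v.2 := by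
  funext v
  simp only [weight, Nat.cast_mul, NNReal.mul_rpow]

end DimGraph

section GeomMean

variable {f g : GraphClass →+* ℝ≥0} {α β a b : ℝ}

theorem typeValue_geomMean_weight (ha : 0 ≤ a) (hb : 0 ≤ b) (hα : 0 ≤ α) (hβ : 0 ≤ β)
    (W : DimGraph) (c : W.graph.V → ℕ) :
    typeValue (geomMean (f : GraphClass →* ℝ≥0) g a b) W.graph (W.weight (a * α + b * β)) c =
      (f (typeGraphClass W.graph c) * ((∏ v, W.dim v ^ c v : ℕ) : ℝ≥0) ^ α) ^ a *
        (g (typeGraphClass W.graph c) * ((∏ v, W.dim v ^ c v : ℕ) : ℝ≥0) ^ β) ^ b := by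
  rw [typeValue, DimGraph.prod_weight_pow,
    NNReal.rpow_add_of_nonneg _ (mul_nonneg ha hα) (mul_nonneg hb hβ), NNReal.mul_rpow,
    NNReal.mul_rpow, ← NNReal.rpow_mul, ← NNReal.rpow_mul, mul_comm a α, mul_comm b β]
  exact mul_mul_mul_comm _ _ _ _

theorem value_geomMean_le_of_cohomLE (hf : IsNormalized (f : GraphClass →* ℝ≥0))
    (hg : IsNormalized (g : GraphClass →* ℝ≥0)) (hfα : IsAdmissible f α) (hgβ : IsAdmissible g β)
    (ha : 0 ≤ a) (hb : 0 ≤ b) (hab : a + b = 1) {W W' : DimGraph}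
    (h : W.toNC.CohomLE W'.toNC) :
    value (geomMean (f : GraphClass →* ℝ≥0) g a b) W.graph (W.weight (a * α + b * β)) ≤
      value (geomMean (f : GraphClass →* ℝ≥0) g a b) W'.graph (W'.weight (a * α + b * β)) := by
  obtain ⟨φ, hφ⟩ := exists_map_typeGraphClass h
  have hα : 0 ≤ α := zero_le_one.trans hfα.1
  have hβ : 0 ≤ β := zero_le_one.trans hgβ.1
  refine value_mono (hf.geomMean hg ha hb hab) φ fun c => ?_
  rw [typeValue_geomMean_weight ha hb hα hβ, typeValue_geomMean_weight ha hb hα hβ]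
  have hd := W.prod_dim_pow_pos c
  have hd' := W'.prod_dim_pow_pos (pushCount φ c)
  exact mul_le_mul' (NNReal.rpow_le_rpow (hfα.mul_rpow_le hd hd' (hφ c)) ha)
    (NNReal.rpow_le_rpow (hgβ.mul_rpow_le hd hd' (hφ c)) hb)

end GeomMean

section ValueHom

variable {F : GraphClass →* ℝ≥0}

theorem value_one_mono (hF : IsNormalized F) {G H : FinGraph} (h : G.toClass ≤ H.toClass) :
    value F G 1 ≤ value F H 1 := by
  obtain ⟨φ, hφ⟩ := toClass_le_iff.1 h
  exact value_mono_of_hom hF φ hφ fun _ => le_rfl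

/-- The growth rates of a normalized functional as a semiring homomorphism, an element of the
asymptotic spectrum of graphs. -/
noncomputable def valueHom (hF : IsNormalized F) : GraphClass →+* ℝ≥0 where
  toFun := Quotient.lift (fun G => value F G 1) fun G H h =>
    have toClass_eq : G.toClass = H.toClass := Quotient.sound h
    le_antisymm (value_one_mono hF toClass_eq.le) (value_one_mono hF toClass_eq.ge)
  map_zero' := value_of_isEmpty hF (G := FinGraph.empty) 1
  map_one' := value_point hF 1
  map_add' X Y := Quotient.inductionOn₂ X Y fun G H => by
    refine Eq.trans ?_ (value_disjUnion hF (G := G) (H := H) (fun _ => le_rfl) fun _ => le_rfl)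
    exact congrArg (value F (G.disjUnion H)) Sum.elim_one_one.symm
  map_mul' X Y := Quotient.inductionOn₂ X Y fun G H => by
    refine Eq.trans ?_ (value_strongProd hF (G := G) (H := H) (fun _ => le_rfl) fun _ => le_rfl)
    exact congrArg (value F (G.strongProd H)) (funext fun _ => (one_mul 1).symm)

theorem valueHom_toClass (hF : IsNormalized F) (G : FinGraph) :
    valueHom hF G.toClass = value F G 1 := rfl

theorem valueHom_mem (hF : IsNormalized F) : valueHom hF ∈ asymptoticSpectrum GraphClass :=
  fun X Y => Quotient.inductionOn₂ X Y fun _ _ => value_one_mono hF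

/-- The value of an element of `𝒜` with the exponent `γ`, computed on some graph with dimensions
that represents it. -/
noncomputable def algAValue (F : GraphClass →* ℝ≥0) (γ : ℝ) (x : algA) : ℝ≥0 :=
  value F (exists_dimGraph x).choose.graph ((exists_dimGraph x).choose.weight γ)

variable {γ : ℝ} (hmono : ∀ W W' : DimGraph, W.toNC.CohomLE W'.toNC →
  value F W.graph (W.weight γ) ≤ value F W'.graph (W'.weight γ))

include hmono

theorem algAValue_mono : Monotone (algAValue F γ) := fun x y h =>
  hmono (exists_dimGraph x).choose (exists_dimGraph y).choose <| by
    change (exists_dimGraph x).choose.toNC.toClass ≤ (exists_dimGraph y).choose.toNC.toClass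
    rwa [(exists_dimGraph x).choose_spec, (exists_dimGraph y).choose_spec]

theorem algAValue_eq {x : algA} {W : DimGraph} (h : W.toNC.toClass = x.1) :
    algAValue F γ x = value F W.graph (W.weight γ) := by
  have toClass_eq : (exists_dimGraph x).choose.toNC.toClass = W.toNC.toClass :=
    (exists_dimGraph x).choose_spec.trans h.symm
  exact le_antisymm (hmono _ _ toClass_eq.le) (hmono _ _ toClass_eq.ge)

theorem algAValue_graphA (G : FinGraph) : algAValue F γ (graphA G) = value F G 1 := by
  rw [algAValue_eq hmono (DimGraph.toClass_toNC_const_one G)]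
  refine congrArg (value F G) (funext fun v => ?_)
  rw [DimGraph.weight, Nat.cast_one, NNReal.one_rpow, Pi.one_apply]

theorem algAValue_quantumA (hF : IsNormalized F) {d : ℕ} (hd : 0 < d) :
    algAValue F γ (quantumA d) = (d : ℝ≥0) ^ γ := by
  rw [algAValue_eq hmono (DimGraph.toClass_toNC_const_point d hd)]
  exact value_point hF _

theorem algAValue_zero (hF : IsNormalized F) : algAValue F γ 0 = 0 := by
  rw [← graphA_empty, algAValue_graphA hmono]
  exact value_of_isEmpty hF _

theorem algAValue_one (hF : IsNormalized F) : algAValue F γ 1 = 1 := by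
  have quantumA_one : quantumA 1 = 1 :=
    Subtype.ext (NCGraph.toClass_scalars_congr (Equiv.ofUnique (Fin 1) PUnit))
  rw [← quantumA_one, algAValue_quantumA hmono hF one_pos, Nat.cast_one, NNReal.one_rpow]

theorem algAValue_add (hF : IsNormalized F) (hγ : 0 ≤ γ) (x y : algA) :
    algAValue F γ (x + y) = algAValue F γ x + algAValue F γ y := by
  obtain ⟨W, hW⟩ := exists_dimGraph x
  obtain ⟨W', hW'⟩ := exists_dimGraph y
  have toClass_eq : (W.disjUnion W').toNC.toClass = (x + y).1 := by
    rw [DimGraph.toClass_toNC_disjUnion, hW, hW']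
    rfl
  rw [algAValue_eq hmono toClass_eq, algAValue_eq hmono hW, algAValue_eq hmono hW',
    DimGraph.weight_disjUnion]
  exact value_disjUnion hF (W.one_le_weight hγ) (W'.one_le_weight hγ)

theorem algAValue_mul (hF : IsNormalized F) (hγ : 0 ≤ γ) (x y : algA) :
    algAValue F γ (x * y) = algAValue F γ x * algAValue F γ y := by
  obtain ⟨W, hW⟩ := exists_dimGraph x
  obtain ⟨W', hW'⟩ := exists_dimGraph y
  have toClass_eq : (W.strongProd W').toNC.toClass = (x * y).1 := by
    rw [DimGraph.toClass_toNC_strongProd, hW, hW']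
    rfl
  rw [algAValue_eq hmono toClass_eq, algAValue_eq hmono hW, algAValue_eq hmono hW',
    DimGraph.weight_strongProd]
  exact value_strongProd hF (W.one_le_weight hγ) (W'.one_le_weight hγ)

theorem isAdmissible_valueHom (hF : IsNormalized F) (hγ : 1 ≤ γ) :
    IsAdmissible (valueHom hF) γ := by
  have hγ' : 0 ≤ γ := zero_le_one.trans hγ
  let φ : algA →+* ℝ≥0 :=
    { toFun := algAValue F γ
      map_zero' := algAValue_zero hmono hF
      map_one' := algAValue_one hmono hF
      map_add' := algAValue_add hmono hF hγ'
      map_mul' := algAValue_mul hmono hF hγ' }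
  refine ⟨hγ, φ, algAValue_mono hmono, fun r G => ?_⟩
  rw [familyA, map_sum]
  refine Finset.sum_congr rfl fun d _ => ?_
  rw [map_mul, valueHom_toClass, ← algAValue_graphA hmono (G d), ← Nat.cast_add_one,
    ← algAValue_quantumA hmono hF d.val.succ_pos]
  rfl

end ValueHom

theorem exists_geomMean {f g : GraphClass →+* ℝ≥0} (hf : f ∈ asymptoticSpectrum GraphClass)
    (hg : g ∈ asymptoticSpectrum GraphClass) {α β : ℝ} (hfα : IsAdmissible f α)
    (hgβ : IsAdmissible g β) {a b : ℝ} (ha : 0 ≤ a) (hb : 0 ≤ b) (hab : a + b = 1) :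
    ∃ h ∈ asymptoticSpectrum GraphClass,
      (∀ G : FinGraph, ∀ Q ∈ stdSimplex ℝ G.V, Real.log (probRefinement h G Q) =
        a * Real.log (probRefinement f G Q) + b * Real.log (probRefinement g G Q)) ∧
      IsAdmissible h (a * α + b * β) := by
  have hF := isNormalized_of_mem hf
  have hG := isNormalized_of_mem hg
  have hM := hF.geomMean hG ha hb hab
  refine ⟨valueHom hM, valueHom_mem hM, fun G Q hQ => ?_, isAdmissible_valueHom
    (fun _ _ => value_geomMean_le_of_cohomLE hF hG hfα hgβ ha hb hab) hM ?_⟩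
  · obtain ⟨L, hL⟩ := exists_hasLogRate (G := G) hF hQ
    obtain ⟨L', hL'⟩ := exists_hasLogRate (G := G) hG hQ
    have hasLogRate_valueHom := (HasLogRate.geomMean hF hG a b hL hL').of_value hM
      (F' := (valueHom hM : GraphClass →* ℝ≥0)) (valueHom_toClass hM)
    rw [probRefinement_eq_exp hf hQ hL, probRefinement_eq_exp hg hQ hL',
      probRefinement_eq_exp (valueHom_mem hM) hQ hasLogRate_valueHom, Real.log_exp, Real.log_exp,
      Real.log_exp]
  · rw [← hab]
    exact add_le_add (le_mul_of_one_le_right ha hfα.1) (le_mul_of_one_le_right hb hgβ.1)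

theorem ProbFamily.cond_mem (X : ProbFamily) {d : Fin X.r} (hd : X.marginal d ≠ 0) :
    X.cond d ∈ stdSimplex ℝ (X.G d).V := by
  refine ⟨fun v => div_nonneg (X.Q_mem.1 _) (Finset.sum_nonneg fun v _ => X.Q_mem.1 _), ?_⟩
  change ∑ v, X.Q ⟨d, v⟩ / X.marginal d = 1
  rw [← Finset.sum_div]
  exact div_self hd

theorem logRefinement_convexCombination {f g h : GraphClass →+* ℝ≥0} {α β a b : ℝ}
    (hab : a + b = 1)
    (hh : ∀ G : FinGraph, ∀ Q ∈ stdSimplex ℝ G.V, Real.log (probRefinement h G Q) =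
      a * Real.log (probRefinement f G Q) + b * Real.log (probRefinement g G Q)) :
    a • logRefinement f α + b • logRefinement g β = logRefinement h (a * α + b * β) := by
  ext X
  have marginal_mul (d : Fin X.r) :
      X.marginal d * (Real.log (probRefinement h (X.G d) (X.cond d)) +
        (a * α + b * β) * Real.log ((d : ℝ) + 1)) =
      a * (X.marginal d * (Real.log (probRefinement f (X.G d) (X.cond d)) +
        α * Real.log ((d : ℝ) + 1))) + b * (X.marginal d *
        (Real.log (probRefinement g (X.G d) (X.cond d)) + β * Real.log ((d : ℝ) + 1))) := by
    by_cases hd : X.marginal d = 0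
    · simp only [hd, zero_mul, mul_zero, add_zero]
    · rw [hh _ _ (X.cond_mem hd)]
      ring
  simp only [Pi.add_apply, Pi.smul_apply, smul_eq_mul, logRefinement, marginal_mul,
    Finset.sum_add_distrib, ← Finset.mul_sum]
  linear_combination (∑ d, Real.negMulLog (X.marginal d)) * hab

end ZeroError

theorem mainTheorem2 :
    (∀ f ∈ ZeroError.asymptoticSpectrum ZeroError.GraphClass, ∀ G : ZeroError.FinGraph,
      ∀ Q ∈ stdSimplex ℝ G.V,
        ZeroError.IsRefinementValue f G Q (ZeroError.probRefinement f G Q) ∧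
          0 < ZeroError.probRefinement f G Q) ∧
    Convex ℝ ZeroError.logFunctionals ∧
    (∀ f ∈ ZeroError.asymptoticSpectrum ZeroError.GraphClass,
      ∀ g ∈ ZeroError.asymptoticSpectrum ZeroError.GraphClass, ∀ α β : ℝ,
        ZeroError.IsAdmissible f α → ZeroError.IsAdmissible g β →
          ∀ a b : ℝ, 0 ≤ a → 0 ≤ b → a + b = 1 →
            ∃ h ∈ ZeroError.asymptoticSpectrum ZeroError.GraphClass,
              (∀ G : ZeroError.FinGraph, ∀ Q ∈ stdSimplex ℝ G.V,
                Real.log (ZeroError.probRefinement h G Q) =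
                  a * Real.log (ZeroError.probRefinement f G Q) +
                    b * Real.log (ZeroError.probRefinement g G Q)) ∧
              ZeroError.IsAdmissible h (a * α + b * β)) := by
  refine ⟨fun f hf G Q hQ => ?_, ?_, fun f hf g hg α β hfα hgβ a b ha hb hab =>
    ZeroError.exists_geomMean hf hg hfα hgβ ha hb hab⟩
  · obtain ⟨L, hL⟩ := ZeroError.exists_hasLogRate (ZeroError.isNormalized_of_mem hf) hQ
    rw [ZeroError.probRefinement_eq_exp hf hQ hL]
    exact ⟨ZeroError.isRefinementValue_of_hasLogRate hf hL, Real.exp_pos L⟩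
  · rintro _ ⟨f, hf, α, hfα, rfl⟩ _ ⟨g, hg, β, hgβ, rfl⟩ a b ha hb hab
    obtain ⟨h, hh, hlog, hadm⟩ := ZeroError.exists_geomMean hf hg hfα hgβ ha hb hab
    exact ⟨h, hh, _, hadm, ZeroError.logRefinement_convexCombination hab hlog⟩
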